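/- Let $K:\{(x,y)\in\mathbb R^2: x\neq y\}\to\mathbb C$ be a kernel for which there are constants $\delta>0$ and $C>0$ such that - $|K(x,y)|\le \dfrac{C}{|x-y|}$ for $x\ne y$; - $|K(x,y)-K(z,y)|\le \dfrac{C|x-z|^\delta}{|x-y|^{1+\delta}}$ for $|x-y|>2|x-z|$; - $|K(y,x)-K(y,z)|\le \dfrac{C|x-z|^\delta}{|x-y|^{1+\delta}}$ for $|x-y|>2|x-z|$. For $t>0$ let $K_t(f)(x)=\int_{|x-y|>t}K(x,y)f(y)\,dy$, and for $1\le q<\infty$ let $$\mathcal V_q\mathcal K(f)(x)=\sup_{\{t_j\}}\Big(\sum_{j=0}^\infty |K_{t_j}(f)(x)-K_{t_{j+1}}(f)(x)|^q\Big)^{1/q},$$ where the supremum runs over all increasing sequences $\{t_j\}_{j\ge0}$ of positive numbers. A weight is a nonnegative locally integrable function $w$ on $\mathbb R$, and $w(E)=\int_E w\,dx$. A weight $w$ is in $A_1$ if there is a constant $C$ with $M(w)\le Cw$ almost everywhere, where $M(w)(x)=\sup_{I\ni x}\frac1{|I|}\int_I w$ is the Hardy–Littlewood maximal function (supremum over bounded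 intervals of positive length); for $1<p<\infty$, $w$ is in $A_p$ if there is a constant $C$ with $$\int_I w\,dx\,\Big(\int_I w^{-1/(p-1)}dx\Big)^{p-1}\le C|I|^p$$ for all bounded intervals $I$ of positive length, where $0^{-1/(p-1)}=\infty$ and $0\cdot\infty=0$. Let $2<q<\infty$, and assume that for some $1<p_0<\infty$ there is a constant $C_0$ with $$\int_{\mathbb R}\big(\mathcal V_q\mathcal K(f)(x)\big)^{p_0}dx\le C_0\int_{\mathbb R}|f(x)|^{p_0}dx\qquad\text{for all } f\in L^{p_0}(\mathbb R).$$ Then: (i) for every $w\in A_1$ there is a constant $C$ such that for all $f\in L^1(\mathbb R,w)$, the integrals defining $K_t(f)(x)$, $t>0$, converge absolutely for $w\,dx$-almost every $x$, and $$w\big(\{x:\mathcal V_q\mathcal K(f)(x)>\lambda\}\big)\le\frac C\lambda\int_{\mathbb R}|f(x)|\,w(x)\,dx\qquad\text{for all }\lambda>0;$$ (ii) for every $1<p<\infty$ and every $w\in A_p$ there is a constant $C$ such that for all $f\in L^p(\mathbb R,w)$, the integrals defining $K_t(f)(x)$, $t>0$, converge absolutely for $w\,dx$-almost every $x$, and $$\int_{\mathbb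 R}\big(\mathcal V_q\mathcal K(f)(x)\big)^p\,w(x)\,dx\le C\int_{\mathbb R}|f(x)|^p\,w(x)\,dx.$$ The constants $C$ in (i) and (ii) may depend on $K$, $p$, $q$, $p_0$ and $w$, but not on $f$ or $\lambda$. Functions $f$ are complex-valued. -/

import Mathlib

open MeasureTheory
open scoped ENNReal NNReal

noncomputable section

/-- A kernel `K` on `ℝ × ℝ` minus the diagonal (the values `K x x` are irrelevant) which satisfies,
for some constants `δ > 0` and `C > 0`, the size condition and the Hölder regularity conditions
in the first and in the second variable. -/
def IsRegularKernel (K : ℝ → ℝ → ℂ) : Prop :=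
  ∃ δ : ℝ, 0 < δ ∧ ∃ C : ℝ, 0 < C ∧
    (∀ x y, x ≠ y → ‖K x y‖ ≤ C / |x - y|) ∧
    (∀ x y z, 2 * |x - z| < |x - y| →
      ‖K x y - K z y‖ ≤ C * |x - z| ^ δ / |x - y| ^ (1 + δ)) ∧
    (∀ x y z, 2 * |x - z| < |x - y| →
      ‖K y x - K y z‖ ≤ C * |x - z| ^ δ / |x - y| ^ (1 + δ))

/-- The truncated singular integral `K_t f (x) = ∫_{|x - y| > t} K(x, y) f(y) dy`. -/
def truncOp (K : ℝ → ℝ → ℂ) (t : ℝ) (f : ℝ → ℂ) (x : ℝ) : ℂ :=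
  ∫ y in {y : ℝ | t < |x - y|}, K x y * f y

/-- The truncated integrals `K_t f (x)`, `t > 0`, all converge absolutely. -/
def TruncConverges (K : ℝ → ℝ → ℂ) (f : ℝ → ℂ) (x : ℝ) : Prop :=
  ∀ t : ℝ, 0 < t → IntegrableOn (fun y => K x y * f y) {y : ℝ | t < |x - y|}

/-- The `q`-variation (with values in `[0, ∞]`) of a family `(a_t)_{t > 0}` of complex numbers:
the supremum over increasing sequences of positive numbers. -/
def qVariation (q : ℝ) (a : ℝ → ℂ) : ℝ≥0∞ :=
  ⨆ t : {t : ℕ → ℝ // Monotone t ∧ ∀ j, 0 < t j},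
    (∑' j : ℕ, ‖a (t.1 j) - a (t.1 (j + 1))‖ₑ ^ q) ^ (1 / q)

/-- The variation operator `V_q 𝒦 f (x) = ‖(K_t f (x))_{t > 0}‖_{v_q}`. -/
def varOp (q : ℝ) (K : ℝ → ℝ → ℂ) (f : ℝ → ℂ) (x : ℝ) : ℝ≥0∞ :=
  qVariation q (fun t => truncOp K t f x)

/-- A weight on `ℝ`: a nonnegative locally integrable function. -/
structure IsWeight (w : ℝ → ℝ) : Prop where
  nonneg : ∀ x, 0 ≤ w x
  locallyIntegrable : LocallyIntegrable w volume

/-- The measure `w(x) dx`. -/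
def weightMeasure (w : ℝ → ℝ) : Measure ℝ :=
  volume.withDensity (fun x => ENNReal.ofReal (w x))

/-- The Hardy–Littlewood maximal function: the supremum of the averages of `|f|` over the bounded
intervals of positive length that contain `x`. -/
def maximalFn (f : ℝ → ℝ) (x : ℝ) : ℝ≥0∞ :=
  ⨆ (a : ℝ) (b : ℝ) (_ : a < b) (_ : x ∈ Set.Icc a b),
    (∫⁻ y in Set.Icc a b, ‖f y‖ₑ) / ENNReal.ofReal (b - a)

/-- The Muckenhoupt class `A_1`: `M w ≤ C w` almost everywhere. -/
def IsA1 (w : ℝ → ℝ) : Prop :=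
  IsWeight w ∧ ∃ C : ℝ≥0, ∀ᵐ x : ℝ, maximalFn w x ≤ C * ENNReal.ofReal (w x)

/-- The Muckenhoupt class `A_p`, `1 < p < ∞`. Powers are taken in `[0, ∞]`, so that
`w(x) ^ (-1 / (p - 1)) = ∞` where `w(x) = 0`. -/
def IsAp (p : ℝ) (w : ℝ → ℝ) : Prop :=
  IsWeight w ∧ ∃ C : ℝ≥0, ∀ a b : ℝ, a < b →
    (∫⁻ x in Set.Icc a b, ENNReal.ofReal (w x)) *
      (∫⁻ x in Set.Icc a b, ENNReal.ofReal (w x) ^ (-1 / (p - 1))) ^ (p - 1)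
      ≤ C * ENNReal.ofReal (b - a) ^ p

end

open Filter Topology

noncomputable section

section ENNRealLemmas

theorem ENNReal.sum_rpow_le_rpow_sum {ι : Type*} (s : Finset ι) (f : ι → ℝ≥0∞) {p : ℝ}
    (hp : 1 ≤ p) : ∑ i ∈ s, f i ^ p ≤ (∑ i ∈ s, f i) ^ p := by
  classical
  induction s using Finset.induction_on with
  | empty => simp
  | insert i s hi ih =>
    rw [Finset.sum_insert hi, Finset.sum_insert hi]
    have h := ENNReal.rpow_add_rpow_le_add (f i) (∑ i ∈ s, f i) hp
    have hp0 : 0 < p := by linarith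
    calc f i ^ p + ∑ i ∈ s, f i ^ p ≤ f i ^ p + (∑ i ∈ s, f i) ^ p := by gcongr
      _ = ((f i ^ p + (∑ i ∈ s, f i) ^ p) ^ (1 / p)) ^ p := by
        rw [← ENNReal.rpow_mul, one_div_mul_cancel hp0.ne', ENNReal.rpow_one]
      _ ≤ _ := by gcongr

theorem ENNReal.tsum_rpow_le_rpow_tsum {ι : Type*} (f : ι → ℝ≥0∞) {p : ℝ} (hp : 1 ≤ p) :
    ∑' i, f i ^ p ≤ (∑' i, f i) ^ p := by
  rw [ENNReal.tsum_eq_iSup_sum]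
  refine iSup_le fun s => (ENNReal.sum_rpow_le_rpow_sum s f hp).trans ?_
  have := ENNReal.sum_le_tsum (f := f) s
  gcongr

theorem ENNReal.Lp_add_le_tsum' {ι : Type*} (f g : ι → ℝ≥0∞) {p : ℝ} (hp : 1 ≤ p) :
    (∑' i, (f i + g i) ^ p) ^ (1 / p) ≤
      (∑' i, f i ^ p) ^ (1 / p) + (∑' i, g i ^ p) ^ (1 / p) := by
  let _ : MeasurableSpace ι := ⊤
  have : MeasurableSingletonClass ι := ⟨fun _ => trivial⟩
  have := ENNReal.lintegral_Lp_add_le (μ := (Measure.count : Measure ι)) (f := f) (g := g)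
    (measurable_from_top).aemeasurable (measurable_from_top).aemeasurable hp
  simpa [lintegral_count] using this

/-- If each row of an array has at most `N` nonzero entries, then the `ℓ^p` norm of the row sums
is controlled by the `ℓ^p` norm of the column sums. -/
theorem ENNReal.tsum_rpow_tsum_le_of_card_le {κ : Type*} (v : ℕ → κ → ℝ≥0∞) {p : ℝ} (hp : 1 ≤ p)
    (N : ℕ) (hN : ∀ j, ∃ F : Finset κ, F.card ≤ N ∧ ∀ k ∉ F, v j k = 0) :
    ∑' j, (∑' k, v j k) ^ p ≤ (N : ℝ≥0∞) ^ p * ∑' k, (∑' j, v j k) ^ p := by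
  have row : ∀ j, (∑' k, v j k) ^ p ≤ (N : ℝ≥0∞) ^ p * ∑' k, v j k ^ p := by
    intro j
    obtain ⟨F, hF, h0⟩ := hN j
    rw [tsum_eq_sum h0]
    rcases F.eq_empty_or_nonempty with rfl | hne
    · simp [show 0 < p by linarith]
    have h1 : 1 ≤ F.card := hne.card_pos
    calc (∑ k ∈ F, v j k) ^ p ≤ (F.card : ℝ≥0∞) ^ (p - 1) * ∑ k ∈ F, v j k ^ p :=
          ENNReal.rpow_sum_le_const_mul_sum_rpow F _ hp
      _ ≤ (F.card : ℝ≥0∞) ^ p * ∑' k, v j k ^ p := by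
        refine mul_le_mul' ?_ (ENNReal.sum_le_tsum F)
        exact ENNReal.rpow_le_rpow_of_exponent_le (by exact_mod_cast h1) (by linarith)
      _ ≤ _ := by gcongr
  calc ∑' j, (∑' k, v j k) ^ p ≤ ∑' j, (N : ℝ≥0∞) ^ p * ∑' k, v j k ^ p :=
        ENNReal.tsum_le_tsum row
    _ = (N : ℝ≥0∞) ^ p * ∑' k, ∑' j, v j k ^ p := by
        rw [ENNReal.tsum_mul_left, ENNReal.tsum_comm]
    _ ≤ _ := by
        gcongr with k
        exact ENNReal.tsum_rpow_le_rpow_tsum _ hp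

theorem lintegral_rpow_le_measure_rpow_mul {α : Type*} [MeasurableSpace α] (μ : Measure α)
    {f : α → ℝ≥0∞} (hf : AEMeasurable f μ) {p : ℝ} (hp : 1 < p) :
    (∫⁻ x, f x ∂μ) ^ p ≤ μ Set.univ ^ (p - 1) * ∫⁻ x, f x ^ p ∂μ := by
  have hpq := Real.HolderConjugate.conjExponent hp
  have h := ENNReal.lintegral_mul_le_Lp_mul_Lq μ hpq hf (aemeasurable_const (b := (1 : ℝ≥0∞)))
  simp only [Pi.mul_apply, mul_one, ENNReal.one_rpow, lintegral_const, one_mul] at h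
  calc (∫⁻ x, f x ∂μ) ^ p ≤ ((∫⁻ x, f x ^ p ∂μ) ^ (1 / p) *
        (μ Set.univ) ^ (1 / p.conjExponent)) ^ p := by
        gcongr
    _ = _ := by
      rw [ENNReal.mul_rpow_of_nonneg _ _ (by linarith), ← ENNReal.rpow_mul, ← ENNReal.rpow_mul,
        one_div_mul_cancel (by linarith), ENNReal.rpow_one, mul_comm]
      congr 2
      rw [Real.conjExponent]
      field_simp

end ENNRealLemmas

section PowerIntegral

theorem lintegral_rpow_tail_le (a : ℝ) {ρ s : ℝ} (hρ : 0 < ρ) (hs : 1 < s) :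
    ∫⁻ x in {x : ℝ | ρ < |x - a|}, ENNReal.ofReal (|x - a| ^ (-s)) ≤
      ENNReal.ofReal (2 / (s - 1) * ρ ^ (1 - s)) := by
  have key : ∫⁻ x in Set.Ioi ρ, ENNReal.ofReal (x ^ (-s)) =
      ENNReal.ofReal (1 / (s - 1) * ρ ^ (1 - s)) := by
    rw [← ofReal_integral_eq_lintegral_ofReal]
    · rw [integral_Ioi_rpow_of_lt (by linarith) hρ]
      congr 1
      rw [show -s + 1 = 1 - s by ring, ← neg_div_neg_eq, neg_neg, neg_sub]; ring
    · exact integrableOn_Ioi_rpow_of_lt (by linarith) hρ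
    · filter_upwards [ae_restrict_mem measurableSet_Ioi] with x hx
      have : 0 < x := hρ.trans hx
      positivity
  have hsub : {x : ℝ | ρ < |x - a|} ⊆
        (fun x => x - a) ⁻¹' Set.Ioi ρ ∪ (fun x => a - x) ⁻¹' Set.Ioi ρ := by
    intro x hx
    rcases lt_abs.1 (show ρ < |x - a| from hx) with h | h
    · exact Or.inl h
    · exact Or.inr (show ρ < a - x by linarith)
  calc ∫⁻ x in {x : ℝ | ρ < |x - a|}, ENNReal.ofReal (|x - a| ^ (-s))
      ≤ ∫⁻ x in (fun x => x - a) ⁻¹' Set.Ioi ρ ∪ (fun x => a - x) ⁻¹' Set.Ioi ρ,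
        ENNReal.ofReal (|x - a| ^ (-s)) := lintegral_mono_set hsub
    _ ≤ (∫⁻ x in (fun x => x - a) ⁻¹' Set.Ioi ρ, ENNReal.ofReal (|x - a| ^ (-s))) +
        ∫⁻ x in (fun x => a - x) ⁻¹' Set.Ioi ρ, ENNReal.ofReal (|x - a| ^ (-s)) :=
        lintegral_union_le _ _ _
    _ = (∫⁻ x in Set.Ioi ρ, ENNReal.ofReal (x ^ (-s))) +
        ∫⁻ x in Set.Ioi ρ, ENNReal.ofReal (x ^ (-s)) := by
      have m : Measurable fun x : ℝ => ENNReal.ofReal (x ^ (-s)) := by fun_prop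
      congr 1
      · rw [← (measurePreserving_sub_right volume a).setLIntegral_comp_preimage
          measurableSet_Ioi m]
        refine setLIntegral_congr_fun (measurableSet_Ioi.preimage (by fun_prop)) fun x hx => ?_
        have : 0 < x - a := hρ.trans hx
        simp [abs_of_pos this]
      · rw [← (Measure.measurePreserving_sub_left volume a).setLIntegral_comp_preimage
          measurableSet_Ioi m]
        refine setLIntegral_congr_fun (measurableSet_Ioi.preimage (by fun_prop)) fun x hx => ?_
        have : 0 < a - x := hρ.trans hx
        simp [abs_sub_comm x a, abs_of_pos this]
    _ = _ := by
      have : 0 < s - 1 := by linarith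
      rw [key, ← ENNReal.ofReal_add (by positivity) (by positivity)]
      congr 1; ring

end PowerIntegral

section Components

/-- The connected components of an open set of finite measure, as pairs of endpoints. -/
def gaps (Ω : Set ℝ) : Set (ℝ × ℝ) :=
  {c | c.1 < c.2 ∧ Set.Ioo c.1 c.2 ⊆ Ω ∧ c.1 ∉ Ω ∧ c.2 ∉ Ω}

theorem gaps_pairwiseDisjoint (Ω : Set ℝ) :
    (gaps Ω).PairwiseDisjoint (fun c => Set.Ioo c.1 c.2) := by
  rintro ⟨a, b⟩ ⟨hab, hI, ha, hb⟩ ⟨a', b'⟩ ⟨hab', hI', ha', hb'⟩ hne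
  simp only [] at *
  rw [Function.onFun, Set.disjoint_left]
  rintro x ⟨h1, h2⟩ ⟨h3, h4⟩
  apply hne
  have e1 : a = a' := by
    rcases lt_trichotomy a a' with h | h | h
    · exact absurd (hI ⟨h, h3.trans h2⟩) ha'
    · exact h
    · exact absurd (hI' ⟨h, h1.trans h4⟩) ha
  have e2 : b = b' := by
    rcases lt_trichotomy b b' with h | h | h
    · exact absurd (hI' ⟨h3.trans h2, h⟩) hb
    · exact h
    · exact absurd (hI ⟨h1.trans h4, h⟩) hb'
  rw [e1, e2]

theorem gaps_countable (Ω : Set ℝ) : (gaps Ω).Countable :=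
  (gaps_pairwiseDisjoint Ω).countable_of_isOpen (fun _ _ => isOpen_Ioo)
    (fun _ hc => Set.nonempty_Ioo.2 hc.1)

theorem exists_mem_gaps {Ω : Set ℝ} (hΩ : IsOpen Ω) (hfin : volume Ω ≠ ∞) {x : ℝ} (hx : x ∈ Ω) :
    ∃ c ∈ gaps Ω, x ∈ Set.Ioo c.1 c.2 := by
  have hc : IsClosed Ωᶜ := hΩ.isClosed_compl
  have hl : (Ωᶜ ∩ Set.Iic x).Nonempty := by
    by_contra h
    rw [Set.not_nonempty_iff_eq_empty] at h
    have : Set.Iic x ⊆ Ω := fun y hy => by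
      by_contra hy'
      exact (h ▸ (⟨hy', hy⟩ : y ∈ Ωᶜ ∩ Set.Iic x) : y ∈ (∅ : Set ℝ))
    exact hfin (top_le_iff.1 (Real.volume_Iic (a := x) ▸ measure_mono this))
  have hr : (Ωᶜ ∩ Set.Ici x).Nonempty := by
    by_contra h
    rw [Set.not_nonempty_iff_eq_empty] at h
    have : Set.Ici x ⊆ Ω := fun y hy => by
      by_contra hy'
      exact (h ▸ (⟨hy', hy⟩ : y ∈ Ωᶜ ∩ Set.Ici x) : y ∈ (∅ : Set ℝ))
    exact hfin (top_le_iff.1 (Real.volume_Ici (a := x) ▸ measure_mono this))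
  have bl : BddAbove (Ωᶜ ∩ Set.Iic x) := ⟨x, fun y hy => hy.2⟩
  have br : BddBelow (Ωᶜ ∩ Set.Ici x) := ⟨x, fun y hy => hy.2⟩
  have ha := (hc.inter isClosed_Iic).csSup_mem hl bl
  have hb := (hc.inter isClosed_Ici).csInf_mem hr br
  set a := sSup (Ωᶜ ∩ Set.Iic x)
  set b := sInf (Ωᶜ ∩ Set.Ici x)
  have hax : a < x := lt_of_le_of_ne ha.2 fun h => ha.1 (h ▸ hx)
  have hxb : x < b := lt_of_le_of_ne hb.2 fun h => hb.1 (h ▸ hx)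
  refine ⟨(a, b), ⟨hax.trans hxb, ?_, ha.1, hb.1⟩, hax, hxb⟩
  intro y hy
  by_contra hy'
  rcases le_total y x with h | h
  · exact absurd (le_csSup bl ⟨hy', h⟩) (not_le.2 hy.1)
  · exact absurd (csInf_le br ⟨hy', h⟩) (not_le.2 hy.2)

theorem biUnion_gaps {Ω : Set ℝ} (hΩ : IsOpen Ω) (hfin : volume Ω ≠ ∞) :
    ⋃ c : gaps Ω, Set.Ioo c.1.1 c.1.2 = Ω := by
  ext x
  simp only [Set.mem_iUnion]
  constructor
  · rintro ⟨c, hx⟩; exact c.2.2.1 hx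
  · intro hx
    obtain ⟨c, hc, h⟩ := exists_mem_gaps hΩ hfin hx
    exact ⟨⟨c, hc⟩, h⟩

theorem mem_gaps_of_Ioo_subset {Ω : Set ℝ} {a b x : ℝ} {c : ℝ × ℝ} (hc : c ∈ gaps Ω)
    (hab : Set.Ioo a b ⊆ Ω) (hx : x ∈ Set.Ioo a b) (hxc : x ∈ Set.Ioo c.1 c.2) :
    c.1 ≤ a ∧ b ≤ c.2 := by
  constructor
  · by_contra h
    exact hc.2.2.1 (hab ⟨not_le.1 h, hxc.1.trans hx.2⟩)
  · by_contra h
    exact hc.2.2.2 (hab ⟨hx.1.trans hxc.2, not_le.1 h⟩)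

end Components

section LayerCake

theorem ENNReal.rpow_le_tsum_indicator {β : ℝ} (hβ : 1 < β) {p : ℝ} (hp : 0 < p) (t : ℝ≥0∞) :
    t ^ p ≤ ENNReal.ofReal (β ^ p) *
      ∑' k : ℤ, ENNReal.ofReal ((β ^ k) ^ p) * (if ENNReal.ofReal (β ^ k) < t then 1 else 0) := by
  have hβ0 : 0 < β := by linarith
  rcases eq_or_ne t ∞ with rfl | ht
  · have : ∑' k : ℤ, ENNReal.ofReal ((β ^ k) ^ p) *
        (if ENNReal.ofReal (β ^ k) < ∞ then 1 else 0) = ∞ := by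
      rw [← top_le_iff]
      calc (∞ : ℝ≥0∞) = ∑' n : ℕ, (1 : ℝ≥0∞) := by simp
        _ ≤ ∑' n : ℕ, ENNReal.ofReal ((β ^ (n : ℤ)) ^ p) *
            (if ENNReal.ofReal (β ^ (n : ℤ)) < ∞ then 1 else 0) := by
          refine ENNReal.tsum_le_tsum fun n => ?_
          rw [if_pos ENNReal.ofReal_lt_top, mul_one, ← ENNReal.ofReal_one]
          refine ENNReal.ofReal_le_ofReal (Real.one_le_rpow ?_ hp.le)
          rw [zpow_natCast]; exact one_le_pow₀ hβ.le
        _ ≤ _ := ENNReal.tsum_comp_le_tsum_of_injective Nat.cast_injective _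
    rw [this, ENNReal.mul_top]
    · exact le_top
    · simp; positivity
  rcases eq_or_ne t 0 with rfl | ht0
  · simp [hp]
  lift t to ℝ≥0 using ht
  have ht0 : 0 < (t : ℝ) := by
    have : t ≠ 0 := by simpa using ht0
    positivity
  obtain ⟨k, hk1, hk2⟩ := _root_.exists_mem_Ioc_zpow ht0 hβ
  calc (t : ℝ≥0∞) ^ p = ENNReal.ofReal ((t : ℝ) ^ p) := by
        rw [← ENNReal.ofReal_rpow_of_pos ht0]; simp
    _ ≤ ENNReal.ofReal (β ^ p * (β ^ k) ^ p) := by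
        refine ENNReal.ofReal_le_ofReal ?_
        rw [← Real.mul_rpow hβ0.le (by positivity)]
        refine Real.rpow_le_rpow ht0.le (hk2.trans_eq ?_) hp.le
        rw [zpow_add_one₀ hβ0.ne', mul_comm]
    _ = ENNReal.ofReal (β ^ p) * (ENNReal.ofReal ((β ^ k) ^ p) *
          (if ENNReal.ofReal (β ^ k) < t then 1 else 0)) := by
        rw [if_pos, mul_one, ENNReal.ofReal_mul (by positivity)]
        rw [← ENNReal.ofReal_coe_nnreal]
        exact (ENNReal.ofReal_lt_ofReal_iff ht0).2 hk1
    _ ≤ _ := by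
        gcongr
        exact ENNReal.le_tsum (f := fun k : ℤ => ENNReal.ofReal ((β ^ k) ^ p) *
          (if ENNReal.ofReal (β ^ k) < (t : ℝ≥0∞) then 1 else 0)) k

theorem ENNReal.exists_tsum_indicator_le {β : ℝ} (hβ : 1 < β) {p : ℝ} (hp : 0 < p) :
    ∃ C : ℝ≥0, ∀ t : ℝ≥0∞, ∑' k : ℤ, ENNReal.ofReal ((β ^ k) ^ p) *
      (if ENNReal.ofReal (β ^ k) < t then 1 else 0) ≤ C * t ^ p := by
  have hβ0 : 0 < β := by linarith
  have hr : (β ^ (-p)) < 1 := Real.rpow_lt_one_of_one_lt_of_neg hβ (by linarith)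
  have hgeo : ∑' n : ℕ, ENNReal.ofReal (β ^ (-p)) ^ n ≠ ∞ := by
    rw [ENNReal.tsum_geometric]
    refine ENNReal.inv_ne_top.2 ?_
    rw [Ne, tsub_eq_zero_iff_le, not_le, ← ENNReal.ofReal_one]
    exact (ENNReal.ofReal_lt_ofReal_iff one_pos).2 hr
  refine ⟨1 + (∑' n : ℕ, ENNReal.ofReal (β ^ (-p)) ^ n).toNNReal, fun t => ?_⟩
  rcases eq_or_ne t ∞ with rfl | ht
  · rw [ENNReal.top_rpow_of_pos hp, ENNReal.mul_top]
    · exact le_top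
    · simp
  rcases eq_or_ne t 0 with rfl | ht0
  · simp
  lift t to ℝ≥0 using ht
  have ht0 : 0 < (t : ℝ) := by
    have : t ≠ 0 := by simpa using ht0
    positivity
  obtain ⟨m, hm1, hm2⟩ := _root_.exists_mem_Ioc_zpow ht0 hβ
  have hiff : ∀ k : ℤ, ENNReal.ofReal (β ^ k) < t → k ≤ m := by
    intro k hk
    rw [← ENNReal.ofReal_coe_nnreal, ENNReal.ofReal_lt_ofReal_iff ht0] at hk
    have := (zpow_lt_zpow_iff_right₀ hβ).1 (hk.trans_le hm2)
    omega
  have e : Function.Injective (fun n : ℕ => m - (n : ℤ)) := by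
    intro a b h; simpa using h
  have hsupp : Function.support (fun k : ℤ => ENNReal.ofReal ((β ^ k) ^ p) *
      (if ENNReal.ofReal (β ^ k) < (t : ℝ≥0∞) then 1 else 0)) ⊆
      Set.range (fun n : ℕ => m - (n : ℤ)) := by
    intro k hk
    have : ENNReal.ofReal (β ^ k) < t := by
      by_contra h; simp [h] at hk
    have := hiff k this
    exact ⟨(m - k).toNat, by simp; omega⟩
  rw [← e.tsum_eq hsupp]
  calc ∑' n : ℕ, ENNReal.ofReal ((β ^ (m - (n : ℤ))) ^ p) *
        (if ENNReal.ofReal (β ^ (m - (n : ℤ))) < (t : ℝ≥0∞) then 1 else 0)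
      ≤ ∑' n : ℕ, ENNReal.ofReal (β ^ (-p)) ^ n * (t : ℝ≥0∞) ^ p := by
        refine ENNReal.tsum_le_tsum fun n => ?_
        calc _ ≤ ENNReal.ofReal ((β ^ (m - (n : ℤ))) ^ p) * 1 := by
              gcongr; split_ifs <;> simp
          _ = ENNReal.ofReal (β ^ (-p)) ^ n * ENNReal.ofReal ((β ^ m) ^ p) := by
              rw [mul_one, ← ENNReal.ofReal_pow (by positivity),
                ← ENNReal.ofReal_mul (by positivity)]
              congr 1
              rw [sub_eq_add_neg, zpow_add₀ hβ0.ne', Real.mul_rpow (by positivity) (by positivity),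
                mul_comm]
              congr 1
              rw [zpow_neg, zpow_natCast, ← Real.rpow_natCast, ← Real.rpow_neg hβ0.le,
                ← Real.rpow_mul hβ0.le, ← Real.rpow_natCast, ← Real.rpow_mul hβ0.le]
              congr 1; ring
          _ ≤ _ := by
              gcongr
              rw [← ENNReal.ofReal_coe_nnreal, ENNReal.ofReal_rpow_of_pos ht0]
              exact ENNReal.ofReal_le_ofReal (Real.rpow_le_rpow (by positivity) hm1.le hp.le)
    _ = (∑' n : ℕ, ENNReal.ofReal (β ^ (-p)) ^ n) * (t : ℝ≥0∞) ^ p := ENNReal.tsum_mul_right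
    _ ≤ _ := by
        gcongr
        rw [ENNReal.coe_add, ENNReal.coe_toNNReal hgeo]
        exact le_add_self

variable {α : Type*} [MeasurableSpace α]

theorem lintegral_rpow_le_tsum_measure {β : ℝ} (hβ : 1 < β) {p : ℝ} (hp : 0 < p) (μ : Measure α)
    {F : α → ℝ≥0∞} (hF : Measurable F) :
    ∫⁻ x, F x ^ p ∂μ ≤ ENNReal.ofReal (β ^ p) *
      ∑' k : ℤ, ENNReal.ofReal ((β ^ k) ^ p) * μ {x | ENNReal.ofReal (β ^ k) < F x} := by
  have hm : ∀ k : ℤ, MeasurableSet {x | ENNReal.ofReal (β ^ k) < F x} := fun k =>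
    measurableSet_lt measurable_const hF
  have hm' : ∀ k : ℤ, Measurable fun x => (if ENNReal.ofReal (β ^ k) < F x then 1 else 0 : ℝ≥0∞) :=
    fun k => Measurable.ite (hm k) measurable_const measurable_const
  calc ∫⁻ x, F x ^ p ∂μ ≤ ∫⁻ x, ENNReal.ofReal (β ^ p) * ∑' k : ℤ, ENNReal.ofReal ((β ^ k) ^ p) *
        (if ENNReal.ofReal (β ^ k) < F x then 1 else 0) ∂μ :=
        lintegral_mono fun x => ENNReal.rpow_le_tsum_indicator hβ hp (F x)
    _ = _ := by
      rw [lintegral_const_mul' _ _ ENNReal.ofReal_ne_top, lintegral_tsum]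
      · congr 2; ext k
        rw [lintegral_const_mul' _ _ ENNReal.ofReal_ne_top]
        congr 1
        rw [← lintegral_indicator_one (hm k)]
        simp [Set.indicator_apply]
      · intro k; exact ((hm' k).const_mul _).aemeasurable

theorem exists_tsum_measure_le_lintegral_rpow {β : ℝ} (hβ : 1 < β) {p : ℝ} (hp : 0 < p) :
    ∃ C : ℝ≥0, ∀ (μ : Measure α) (F : α → ℝ≥0∞), Measurable F →
      ∑' k : ℤ, ENNReal.ofReal ((β ^ k) ^ p) * μ {x | ENNReal.ofReal (β ^ k) < F x} ≤
        C * ∫⁻ x, F x ^ p ∂μ := by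
  obtain ⟨C, hC⟩ := ENNReal.exists_tsum_indicator_le hβ hp
  refine ⟨C, fun μ F hF => ?_⟩
  have hm : ∀ k : ℤ, MeasurableSet {x | ENNReal.ofReal (β ^ k) < F x} := fun k =>
    measurableSet_lt measurable_const hF
  have hm' : ∀ k : ℤ, Measurable fun x => (if ENNReal.ofReal (β ^ k) < F x then 1 else 0 : ℝ≥0∞) :=
    fun k => Measurable.ite (hm k) measurable_const measurable_const
  calc _ = ∫⁻ x, ∑' k : ℤ, ENNReal.ofReal ((β ^ k) ^ p) *
        (if ENNReal.ofReal (β ^ k) < F x then 1 else 0) ∂μ := by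
        rw [lintegral_tsum]
        · congr 1; ext k
          rw [lintegral_const_mul' _ _ ENNReal.ofReal_ne_top]
          congr 1
          rw [← lintegral_indicator_one (hm k)]
          simp [Set.indicator_apply]
        · intro k; exact ((hm' k).const_mul _).aemeasurable
    _ ≤ ∫⁻ x, C * F x ^ p ∂μ := lintegral_mono fun x => hC (F x)
    _ = _ := lintegral_const_mul' _ _ ENNReal.coe_ne_top

end LayerCake

/-- The uncentred maximal function over bounded open intervals with respect to `μ`. -/
def maxFn (μ : Measure ℝ) (f : ℝ → ℝ≥0∞) (x : ℝ) : ℝ≥0∞ :=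
  ⨆ (a : ℝ) (b : ℝ) (_ : x ∈ Set.Ioo a b), (∫⁻ y in Set.Ioo a b, f y ∂μ) / μ (Set.Ioo a b)

/-- Intervals and their fivefold dilates have comparable measures. -/
def DoublingOnIntervals (μ : Measure ℝ) : Prop :=
  ∃ C : ℝ≥0, ∀ a b : ℝ, a < b →
    μ (Set.Icc (a - 2 * (b - a)) (b + 2 * (b - a))) ≤ C * μ (Set.Ioo a b)

theorem lt_maxFn_iff {μ : Measure ℝ} {f : ℝ → ℝ≥0∞} {x : ℝ} {l : ℝ≥0∞} :
    l < maxFn μ f x ↔ ∃ a b, x ∈ Set.Ioo a b ∧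
      l < (∫⁻ y in Set.Ioo a b, f y ∂μ) / μ (Set.Ioo a b) := by
  simp only [maxFn, lt_iSup_iff, exists_prop]

theorem average_le_maxFn (μ : Measure ℝ) (f : ℝ → ℝ≥0∞) {a b x : ℝ} (hx : x ∈ Set.Ioo a b) :
    (∫⁻ y in Set.Ioo a b, f y ∂μ) / μ (Set.Ioo a b) ≤ maxFn μ f x :=
  le_iSup_of_le a (le_iSup_of_le b (le_iSup_of_le hx le_rfl))

theorem lintegral_le_maxFn_mul (μ : Measure ℝ) [IsLocallyFiniteMeasure μ] (f : ℝ → ℝ≥0∞)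
    {a b x : ℝ} (hx : x ∈ Set.Ioo a b) :
    ∫⁻ y in Set.Ioo a b, f y ∂μ ≤ maxFn μ f x * μ (Set.Ioo a b) := by
  rcases eq_or_ne (μ (Set.Ioo a b)) 0 with h | h
  · rw [Measure.restrict_eq_zero.2 h]; simp
  · rw [← ENNReal.div_le_iff h measure_Ioo_lt_top.ne]
    exact average_le_maxFn μ f hx

theorem isOpen_lt_maxFn (μ : Measure ℝ) (f : ℝ → ℝ≥0∞) (l : ℝ≥0∞) :
    IsOpen {x | l < maxFn μ f x} := by
  rw [isOpen_iff_mem_nhds]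
  intro x hx
  obtain ⟨a, b, hab, h⟩ := lt_maxFn_iff.1 hx
  filter_upwards [isOpen_Ioo.mem_nhds hab] with y hy
  exact lt_maxFn_iff.2 ⟨a, b, hy, h⟩

theorem measurable_maxFn (μ : Measure ℝ) (f : ℝ → ℝ≥0∞) : Measurable (maxFn μ f) :=
  measurable_of_Ioi fun l => (isOpen_lt_maxFn μ f l).measurableSet

theorem DoublingOnIntervals.exists_maxFn_weak {μ : Measure ℝ} [IsLocallyFiniteMeasure μ]
    (hμ : DoublingOnIntervals μ) : ∃ C : ℝ≥0, ∀ (f : ℝ → ℝ≥0∞) (l : ℝ≥0∞),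
      l * μ {x | l < maxFn μ f x} ≤ C * ∫⁻ x, f x ∂μ := by
  obtain ⟨C, hC⟩ := hμ
  refine ⟨C, fun f l => ?_⟩
  rw [(isOpen_lt_maxFn μ f l).measure_eq_iSup_isCompact, ENNReal.mul_iSup]
  refine iSup_le fun K => ?_
  rw [ENNReal.mul_iSup]
  refine iSup_le fun hKU => ?_
  rw [ENNReal.mul_iSup]
  refine iSup_le fun hK => ?_
  have hex : ∀ x ∈ K, ∃ c : ℝ × ℝ, x ∈ Set.Ioo c.1 c.2 ∧
      l < (∫⁻ y in Set.Ioo c.1 c.2, f y ∂μ) / μ (Set.Ioo c.1 c.2) := fun x hx => by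
    obtain ⟨a, b, h⟩ := lt_maxFn_iff.1 (hKU hx)
    exact ⟨(a, b), h⟩
  choose! c hc1 hc2 using hex
  obtain ⟨t, htK, hcov⟩ := hK.elim_nhds_subcover (fun x => Set.Ioo (c x).1 (c x).2)
    fun x hx => isOpen_Ioo.mem_nhds (hc1 x hx)
  obtain ⟨R, hR⟩ := (t.image fun x => ((c x).2 - (c x).1) / 2).exists_le
  obtain ⟨u, hut, hdis, hu⟩ := Vitali.exists_disjoint_subfamily_covering_enlargement_closedBall
    (t : Set ℝ) (fun x => ((c x).1 + (c x).2) / 2) (fun x => ((c x).2 - (c x).1) / 2) R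
    (fun a ha => hR _ (Finset.mem_image_of_mem _ ha)) 5 (by norm_num)
  have hufin : u.Finite := t.finite_toSet.subset hut
  lift u to Finset ℝ using hufin
  have hlt : ∀ x ∈ u, (c x).1 < (c x).2 := fun x hx =>
    (hc1 x (htK x (hut hx))).1.trans (hc1 x (htK x (hut hx))).2
  have hball : ∀ x, Metric.closedBall (((c x).1 + (c x).2) / 2) (((c x).2 - (c x).1) / 2) =
      Set.Icc (c x).1 (c x).2 := fun x => by
    rw [Real.closedBall_eq_Icc]; congr 1 <;> ring
  have hball5 : ∀ x, Metric.closedBall (((c x).1 + (c x).2) / 2) (5 * (((c x).2 - (c x).1) / 2)) =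
      Set.Icc ((c x).1 - 2 * ((c x).2 - (c x).1)) ((c x).2 + 2 * ((c x).2 - (c x).1)) := fun x => by
    rw [Real.closedBall_eq_Icc]; congr 1 <;> ring
  have hsub : K ⊆ ⋃ x ∈ u, Set.Icc ((c x).1 - 2 * ((c x).2 - (c x).1))
      ((c x).2 + 2 * ((c x).2 - (c x).1)) := by
    intro y hy
    obtain ⟨x, hx, hyx⟩ := Set.mem_iUnion₂.1 (hcov hy)
    obtain ⟨z, hz, hxz⟩ := hu x hx
    refine Set.mem_iUnion₂.2 ⟨z, hz, ?_⟩
    rw [← hball5]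
    exact hxz (by rw [hball]; exact Set.Ioo_subset_Icc_self hyx)
  have hdis' : (u : Set ℝ).PairwiseDisjoint fun x => Set.Ioo (c x).1 (c x).2 := by
    intro x hx y hy hxy
    have := hdis hx hy hxy
    rw [Function.onFun, hball, hball] at this
    exact this.mono Set.Ioo_subset_Icc_self Set.Ioo_subset_Icc_self
  calc l * μ K ≤ l * ∑ x ∈ u, C * μ (Set.Ioo (c x).1 (c x).2) := by
        gcongr
        exact (measure_mono hsub).trans ((measure_biUnion_finset_le u _).trans
          (Finset.sum_le_sum fun x hx => hC _ _ (hlt x hx)))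
    _ = C * ∑ x ∈ u, l * μ (Set.Ioo (c x).1 (c x).2) := by
        rw [← Finset.mul_sum, ← Finset.mul_sum]; ring
    _ ≤ C * ∑ x ∈ u, ∫⁻ y in Set.Ioo (c x).1 (c x).2, f y ∂μ := by
        gcongr with x hx
        exact ENNReal.mul_le_of_le_div (hc2 x (htK x (hut hx))).le
    _ = C * ∫⁻ y in ⋃ x ∈ u, Set.Ioo (c x).1 (c x).2, f y ∂μ := by
        rw [lintegral_biUnion_finset hdis' fun _ _ => measurableSet_Ioo]
    _ ≤ _ := by
        gcongr
        exact Measure.restrict_le_self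

theorem DoublingOnIntervals.exists_maxFn_strong {μ : Measure ℝ} [IsLocallyFiniteMeasure μ]
    (hμ : DoublingOnIntervals μ) {s : ℝ} (hs : 1 < s) :
    ∃ C : ℝ≥0, ∀ f : ℝ → ℝ≥0∞, Measurable f →
      ∫⁻ x, maxFn μ f x ^ s ∂μ ≤ C * ∫⁻ x, f x ^ s ∂μ := by
  obtain ⟨C, hC⟩ := hμ.exists_maxFn_weak
  obtain ⟨D, hD⟩ := ENNReal.exists_tsum_indicator_le (β := 2) (by norm_num) (p := s - 1)
    (by linarith)
  have h2 : ∀ k : ℤ, (0 : ℝ) < 2 ^ k := fun k => by positivity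
  refine ⟨((2 : ℝ) ^ s).toNNReal * (((2 : ℝ) ^ s).toNNReal * C * D), fun f hf => ?_⟩
  have hset : ∀ k : ℤ, MeasurableSet {x | ENNReal.ofReal (2 ^ k) < f x} := fun k =>
    measurableSet_lt measurable_const hf
  have trunc : ∀ k : ℤ, ENNReal.ofReal (2 ^ k) *
      μ {x | ENNReal.ofReal (2 ^ (k + 1)) < maxFn μ f x} ≤
      C * ∫⁻ x, f x * (if ENNReal.ofReal (2 ^ k) < f x then 1 else 0) ∂μ := by
    intro k
    refine le_trans (mul_le_mul' le_rfl (measure_mono fun x hx => ?_))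
      (hC _ (ENNReal.ofReal (2 ^ k)))
    obtain ⟨a, b, hab, h⟩ := lt_maxFn_iff.1 hx
    refine lt_maxFn_iff.2 ⟨a, b, hab, ?_⟩
    have hle : ∫⁻ y in Set.Ioo a b, f y ∂μ ≤
        (∫⁻ y in Set.Ioo a b, f y * (if ENNReal.ofReal (2 ^ k) < f y then 1 else 0) ∂μ) +
          ENNReal.ofReal (2 ^ k) * μ (Set.Ioo a b) := by
      rw [← setLIntegral_const, ← lintegral_add_right _ measurable_const]
      refine lintegral_mono fun y => ?_
      dsimp only
      split_ifs with hy
      · simp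
      · simpa using hy
    have h3 : ENNReal.ofReal (2 ^ (k + 1)) = ENNReal.ofReal (2 ^ k) + ENNReal.ofReal (2 ^ k) := by
      rw [← ENNReal.ofReal_add (h2 k).le (h2 k).le, zpow_add_one₀ two_ne_zero]; congr 1; ring
    rw [h3] at h
    have h4 := h.trans_le (ENNReal.div_le_div_right hle _)
    rw [ENNReal.add_div] at h4
    have h5 : ENNReal.ofReal (2 ^ k) * μ (Set.Ioo a b) / μ (Set.Ioo a b) ≤
        ENNReal.ofReal (2 ^ k) := ENNReal.div_le_of_le_mul le_rfl
    exact lt_of_add_lt_add_right (h4.trans_le (add_le_add_right h5 _))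
  have key : ∀ k : ℤ, ENNReal.ofReal ((2 ^ (k + 1)) ^ s) *
      μ {x | ENNReal.ofReal (2 ^ (k + 1)) < maxFn μ f x} ≤
      ENNReal.ofReal (2 ^ s) * C * ∫⁻ x, f x * (ENNReal.ofReal ((2 ^ k) ^ (s - 1)) *
        (if ENNReal.ofReal (2 ^ k) < f x then 1 else 0)) ∂μ := by
    intro k
    have e : ENNReal.ofReal ((2 ^ (k + 1)) ^ s) =
        ENNReal.ofReal (2 ^ s) * ENNReal.ofReal ((2 ^ k) ^ (s - 1)) * ENNReal.ofReal (2 ^ k) := by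
      rw [← ENNReal.ofReal_mul (by positivity), ← ENNReal.ofReal_mul (by positivity)]
      congr 1
      rw [zpow_add_one₀ two_ne_zero, Real.mul_rpow (h2 k).le (by norm_num),
        Real.rpow_sub_one (h2 k).ne']
      field_simp
    calc _ = ENNReal.ofReal (2 ^ s) * ENNReal.ofReal ((2 ^ k) ^ (s - 1)) * (ENNReal.ofReal (2 ^ k) *
          μ {x | ENNReal.ofReal (2 ^ (k + 1)) < maxFn μ f x}) := by rw [e]; ring
      _ ≤ ENNReal.ofReal (2 ^ s) * ENNReal.ofReal ((2 ^ k) ^ (s - 1)) *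
          (C * ∫⁻ x, f x * (if ENNReal.ofReal (2 ^ k) < f x then 1 else 0) ∂μ) := by
          exact mul_le_mul' le_rfl (trunc k)
      _ = ENNReal.ofReal (2 ^ s) * C * (ENNReal.ofReal ((2 ^ k) ^ (s - 1)) *
          ∫⁻ x, f x * (if ENNReal.ofReal (2 ^ k) < f x then 1 else 0) ∂μ) := by ring
      _ = _ := by
          rw [← lintegral_const_mul' _ _ ENNReal.ofReal_ne_top]
          congr 2; ext x; ring
  calc ∫⁻ x, maxFn μ f x ^ s ∂μ
      ≤ ENNReal.ofReal (2 ^ s) * ∑' k : ℤ, ENNReal.ofReal ((2 ^ k) ^ s) *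
        μ {x | ENNReal.ofReal (2 ^ k) < maxFn μ f x} :=
        lintegral_rpow_le_tsum_measure (by norm_num) (by linarith) μ (measurable_maxFn μ f)
    _ = ENNReal.ofReal (2 ^ s) * ∑' k : ℤ, ENNReal.ofReal ((2 ^ (k + 1)) ^ s) *
        μ {x | ENNReal.ofReal (2 ^ (k + 1)) < maxFn μ f x} := by
        congr 1
        exact ((Equiv.addRight (1 : ℤ)).tsum_eq (fun k : ℤ => ENNReal.ofReal ((2 ^ k) ^ s) *
          μ {x | ENNReal.ofReal (2 ^ k) < maxFn μ f x})).symm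
    _ ≤ ENNReal.ofReal (2 ^ s) * ∑' k : ℤ, ENNReal.ofReal (2 ^ s) * C *
        ∫⁻ x, f x * (ENNReal.ofReal ((2 ^ k) ^ (s - 1)) *
        (if ENNReal.ofReal (2 ^ k) < f x then 1 else 0)) ∂μ := by
        exact mul_le_mul' le_rfl (ENNReal.tsum_le_tsum key)
    _ = ENNReal.ofReal (2 ^ s) * (ENNReal.ofReal (2 ^ s) * C * ∫⁻ x, f x *
        ∑' k : ℤ, ENNReal.ofReal ((2 ^ k) ^ (s - 1)) *
        (if ENNReal.ofReal (2 ^ k) < f x then 1 else 0) ∂μ) := by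
        rw [ENNReal.tsum_mul_left, ← lintegral_tsum]
        · simp_rw [ENNReal.tsum_mul_left]
        · intro k
          exact (hf.mul (measurable_const.mul (Measurable.ite (hset k) measurable_const
            measurable_const))).aemeasurable
    _ ≤ ENNReal.ofReal (2 ^ s) * (ENNReal.ofReal (2 ^ s) * C * ∫⁻ x, D * f x ^ s ∂μ) := by
        refine mul_le_mul' le_rfl (mul_le_mul' le_rfl (lintegral_mono fun x => ?_))
        calc _ ≤ f x * (D * f x ^ (s - 1)) := mul_le_mul' le_rfl (hD (f x))
          _ = D * (f x * f x ^ (s - 1)) := by ring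
          _ = D * f x ^ s := by
            congr 1
            conv_lhs => rw [← ENNReal.rpow_one (f x), ← ENNReal.rpow_mul,
              ← ENNReal.rpow_add_of_nonneg _ _ (by norm_num) (by linarith)]
            congr 1; ring
    _ = _ := by
        rw [lintegral_const_mul' _ _ ENNReal.coe_ne_top]
        simp only [ENNReal.coe_mul, ENNReal.ofReal]
        ring

/-- The kernel conditions with explicit constants and a Hölder exponent at most one. -/
structure KernelBounds (K : ℝ → ℝ → ℂ) (δ A : ℝ) : Prop where
  exponent_pos : 0 < δ
  exponent_le_one : δ ≤ 1
  const_pos : 0 < A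
  size : ∀ x y, x ≠ y → ‖K x y‖ ≤ A / |x - y|
  regular_left : ∀ x y z, 2 * |x - z| < |x - y| →
    ‖K x y - K z y‖ ≤ A * (|x - z| / |x - y|) ^ δ / |x - y|
  regular_right : ∀ x y z, 2 * |x - z| < |x - y| →
    ‖K y x - K y z‖ ≤ A * (|x - z| / |x - y|) ^ δ / |x - y|

theorem IsRegularKernel.exists_kernelBounds {K : ℝ → ℝ → ℂ} (hK : IsRegularKernel K) :
    ∃ δ A, KernelBounds K δ A := by
  obtain ⟨δ, hδ, A, hA, h0, h1, h2⟩ := hK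
  have aux : ∀ x y z : ℝ, 2 * |x - z| < |x - y| →
      A * |x - z| ^ δ / |x - y| ^ (1 + δ) ≤
        A * (|x - z| / |x - y|) ^ min δ 1 / |x - y| := by
    intro x y z h
    have hxy : 0 < |x - y| := by linarith [abs_nonneg (x - z)]
    have e : A * |x - z| ^ δ / |x - y| ^ (1 + δ) = A * (|x - z| / |x - y|) ^ δ / |x - y| := by
      rw [Real.div_rpow (abs_nonneg _) hxy.le, Real.rpow_add hxy, Real.rpow_one]
      field_simp
    rw [e]
    have : (|x - z| / |x - y|) ^ δ ≤ (|x - z| / |x - y|) ^ min δ 1 := by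
      refine Real.rpow_le_rpow_of_exponent_ge' (by positivity) ?_ (by positivity) (min_le_left _ _)
      rw [div_le_one hxy]
      linarith [abs_nonneg (x - z)]
    gcongr
  exact ⟨min δ 1, A, by positivity, min_le_right _ _, hA, h0,
    fun x y z h => (h1 x y z h).trans (aux x y z h),
    fun x y z h => (h2 x y z h).trans (aux x y z h)⟩

namespace KernelBounds

variable {K : ℝ → ℝ → ℂ} {δ A : ℝ} (hK : KernelBounds K δ A)
include hK

theorem enorm_le {x y : ℝ} {t : ℝ} (ht : 0 < t) (hxy : t ≤ |x - y|) :
    ‖K x y‖ₑ ≤ ENNReal.ofReal (A / t) := by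
  rw [← ofReal_norm]
  refine ENNReal.ofReal_le_ofReal ((hK.size x y ?_).trans ?_)
  · rintro rfl; simp at hxy; linarith
  · have := hK.const_pos; gcongr

theorem tendsto_aux (x y : ℝ) :
    Tendsto (fun z => A * (|x - z| / |x - y|) ^ δ / |x - y|) (𝓝 x) (𝓝 0) := by
  have : Continuous fun z => A * (|x - z| / |x - y|) ^ δ / |x - y| := by
    have hδ : 0 ≤ δ := hK.exponent_pos.le
    refine Continuous.div_const (continuous_const.mul (Continuous.rpow_const ?_ ?_)) _
    · fun_prop
    · intro z; exact Or.inr hδ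
  have h := this.tendsto x
  simpa [Real.zero_rpow hK.exponent_pos.ne'] using h

theorem continuousAt_left {x y : ℝ} (hxy : x ≠ y) : ContinuousAt (fun z => K z y) x := by
  rw [ContinuousAt, tendsto_iff_norm_sub_tendsto_zero]
  refine squeeze_zero' (Eventually.of_forall fun _ => norm_nonneg _) ?_ (hK.tendsto_aux x y)
  have h0 : 0 < |x - y| := abs_pos.2 (sub_ne_zero.2 hxy)
  filter_upwards [Metric.ball_mem_nhds x (half_pos h0)] with z hz
  rw [norm_sub_rev]
  refine hK.regular_left x y z ?_
  rw [Metric.mem_ball, Real.dist_eq, abs_sub_comm] at hz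
  linarith

theorem continuousAt_right {x y : ℝ} (hxy : x ≠ y) : ContinuousAt (fun z => K y z) x := by
  rw [ContinuousAt, tendsto_iff_norm_sub_tendsto_zero]
  refine squeeze_zero' (Eventually.of_forall fun _ => norm_nonneg _) ?_ (hK.tendsto_aux x y)
  have h0 : 0 < |x - y| := abs_pos.2 (sub_ne_zero.2 hxy)
  filter_upwards [Metric.ball_mem_nhds x (half_pos h0)] with z hz
  rw [norm_sub_rev]
  refine hK.regular_right x y z ?_
  rw [Metric.mem_ball, Real.dist_eq, abs_sub_comm] at hz
  linarith

theorem aestronglyMeasurable (x : ℝ) : AEStronglyMeasurable (K x) volume := by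
  have h1 : ContinuousOn (K x) {x}ᶜ := fun y hy =>
    (hK.continuousAt_right (x := y) (y := x) hy).continuousWithinAt
  have h2 := h1.aestronglyMeasurable (μ := volume) (measurableSet_singleton x).compl
  rwa [Measure.restrict_eq_self_of_ae_mem] at h2
  simp [ae_iff]

theorem truncConverges {f : ℝ → ℂ} (hf : Integrable f) (x : ℝ) : TruncConverges K f x := by
  intro t ht
  refine Integrable.mono' (g := fun y => A / t * ‖f y‖) (hf.norm.const_mul _).integrableOn
    ((hK.aestronglyMeasurable x).mul hf.1).restrict ?_
  have hm : MeasurableSet {y : ℝ | t < |x - y|} := measurableSet_lt measurable_const (by fun_prop)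
  filter_upwards [ae_restrict_mem hm] with y hy
  rw [norm_mul]
  gcongr
  have hy' : t < |x - y| := hy
  refine (hK.size x y ?_).trans ?_
  · rintro rfl; simp at hy'; linarith
  · have := hK.const_pos; gcongr

end KernelBounds

section Truncations

variable {K : ℝ → ℝ → ℂ} {f g : ℝ → ℂ} {x : ℝ} {q : ℝ}

/-- The annulus `{y | s < |x - y| ≤ t}`. -/
def annulus (x s t : ℝ) : Set ℝ := {y | s < |x - y| ∧ |x - y| ≤ t}

theorem measurableSet_annulus (x s t : ℝ) : MeasurableSet (annulus x s t) := by
  have h : Measurable fun y : ℝ => |x - y| := by fun_prop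
  exact (measurableSet_lt measurable_const h).inter (measurableSet_le h measurable_const)

theorem measurableSet_truncSet (x t : ℝ) : MeasurableSet {y : ℝ | t < |x - y|} :=
  measurableSet_lt measurable_const (by fun_prop)

theorem disjoint_annulus {t : ℕ → ℝ} (ht : Monotone t) (x : ℝ) :
    Pairwise (Function.onFun Disjoint fun j => annulus x (t j) (t (j + 1))) := by
  intro i j hij
  have := ht.pairwise_disjoint_on_Ioc_succ hij
  rw [Function.onFun, Set.disjoint_left] at this ⊢
  intro y hy hy'
  exact this (a := |x - y|) ⟨hy.1, hy.2⟩ ⟨hy'.1, hy'.2⟩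

theorem TruncConverges.integrableOn_annulus (hf : TruncConverges K f x) {s t : ℝ} (hs : 0 < s) :
    IntegrableOn (fun y => K x y * f y) (annulus x s t) :=
  (hf s hs).mono_set fun _ hy => hy.1

theorem truncOp_sub_truncOp (hf : TruncConverges K f x) {s t : ℝ} (hs : 0 < s) (hst : s ≤ t) :
    truncOp K s f x - truncOp K t f x = ∫ y in annulus x s t, K x y * f y := by
  have hu : {y : ℝ | s < |x - y|} = annulus x s t ∪ {y : ℝ | t < |x - y|} := by
    ext y
    simp only [annulus, Set.mem_ofPred_eq, Set.mem_union]
    constructor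
    · intro h
      rcases le_or_gt (|x - y|) t with h' | h'
      · exact Or.inl ⟨h, h'⟩
      · exact Or.inr h'
    · rintro (h | h)
      · exact h.1
      · exact hst.trans_lt h
  have hd : Disjoint (annulus x s t) {y : ℝ | t < |x - y|} := by
    rw [Set.disjoint_left]; intro y hy hy'; exact absurd hy.2 (not_le.2 hy')
  rw [truncOp, truncOp, hu, setIntegral_union hd (measurableSet_truncSet x t)
    (hf.integrableOn_annulus hs) (hf t (hs.trans_le hst)), add_sub_cancel_right]

theorem TruncConverges.indicator (hf : TruncConverges K f x) {s : Set ℝ} (hs : MeasurableSet s) :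
    TruncConverges K (s.indicator f) x := fun t ht => by
  have := (hf t ht).indicator hs
  refine this.congr (Eventually.of_forall fun y => ?_)
  by_cases h : y ∈ s <;> simp [h]

theorem truncOp_add (hf : TruncConverges K f x) (hg : TruncConverges K g x) {t : ℝ} (ht : 0 < t) :
    truncOp K t (f + g) x = truncOp K t f x + truncOp K t g x := by
  rw [truncOp, truncOp, truncOp, ← integral_add (hf t ht) (hg t ht)]
  simp [mul_add]

theorem truncOp_congr_ae (h : f =ᵐ[volume] g) (t x : ℝ) : truncOp K t f x = truncOp K t g x := by
  refine integral_congr_ae (ae_restrict_of_ae ?_)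
  filter_upwards [h] with y hy
  rw [hy]

theorem varOp_congr_ae (h : f =ᵐ[volume] g) (x : ℝ) : varOp q K f x = varOp q K g x := by
  simp only [varOp, truncOp_congr_ae h]

/-- The `ℓ^q` norm of a sequence in `[0, ∞]`. -/
def lqNorm (q : ℝ) (u : ℕ → ℝ≥0∞) : ℝ≥0∞ := (∑' j, u j ^ q) ^ (1 / q)

theorem lqNorm_mono (hq : 1 ≤ q) {u v : ℕ → ℝ≥0∞} (h : ∀ j, u j ≤ v j) :
    lqNorm q u ≤ lqNorm q v := by
  have : 0 ≤ q := by linarith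
  unfold lqNorm
  gcongr with j
  exact h j

theorem lqNorm_add_le (hq : 1 ≤ q) (u v : ℕ → ℝ≥0∞) :
    lqNorm q (fun j => u j + v j) ≤ lqNorm q u + lqNorm q v :=
  ENNReal.Lp_add_le_tsum' u v hq

theorem lqNorm_le_tsum (hq : 1 ≤ q) (u : ℕ → ℝ≥0∞) : lqNorm q u ≤ ∑' j, u j := by
  have : 0 < q := by linarith
  calc lqNorm q u ≤ ((∑' j, u j) ^ q) ^ (1 / q) := by
        unfold lqNorm
        gcongr
        exact ENNReal.tsum_rpow_le_rpow_tsum u hq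
    _ = _ := by rw [← ENNReal.rpow_mul, mul_one_div_cancel this.ne', ENNReal.rpow_one]

theorem qVariation_le {a : ℝ → ℂ} {B : ℝ≥0∞} (h : ∀ t : ℕ → ℝ, Monotone t → (∀ j, 0 < t j) →
    lqNorm q (fun j => ‖a (t j) - a (t (j + 1))‖ₑ) ≤ B) : qVariation q a ≤ B :=
  iSup_le fun t => h t.1 t.2.1 t.2.2

theorem lqNorm_le_qVariation {a : ℝ → ℂ} {t : ℕ → ℝ} (ht : Monotone t) (h0 : ∀ j, 0 < t j) :
    lqNorm q (fun j => ‖a (t j) - a (t (j + 1))‖ₑ) ≤ qVariation q a :=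
  le_iSup (fun t : {t : ℕ → ℝ // Monotone t ∧ ∀ j, 0 < t j} =>
    (∑' j : ℕ, ‖a (t.1 j) - a (t.1 (j + 1))‖ₑ ^ q) ^ (1 / q)) ⟨t, ht, h0⟩

theorem varOp_add_le (hq : 1 ≤ q) (hf : TruncConverges K f x) (hg : TruncConverges K g x) :
    varOp q K (f + g) x ≤ varOp q K f x + varOp q K g x := by
  refine qVariation_le fun t ht h0 => ?_
  refine le_trans ?_ (add_le_add (lqNorm_le_qVariation ht h0) (lqNorm_le_qVariation ht h0))
  refine (lqNorm_mono hq fun j => ?_).trans (lqNorm_add_le hq _ _)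
  rw [truncOp_add hf hg (h0 _), truncOp_add hf hg (h0 _), add_sub_add_comm]
  exact enorm_add_le _ _

theorem tsum_lintegral_annulus_le {t : ℕ → ℝ} (ht : Monotone t) (x : ℝ) (φ : ℝ → ℝ≥0∞) :
    ∑' j, ∫⁻ y in annulus x (t j) (t (j + 1)), φ y ≤ ∫⁻ y, φ y := by
  rw [← lintegral_iUnion (fun j => measurableSet_annulus _ _ _) (disjoint_annulus ht x)]
  exact lintegral_mono' Measure.restrict_le_self le_rfl

theorem varOp_le_lintegral (hq : 1 ≤ q) (hf : TruncConverges K f x) :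
    varOp q K f x ≤ ∫⁻ y, ‖K x y * f y‖ₑ := by
  refine qVariation_le fun t ht h0 => ?_
  refine (lqNorm_le_tsum hq _).trans (le_trans (ENNReal.tsum_le_tsum fun j => ?_)
    (tsum_lintegral_annulus_le ht x _))
  rw [truncOp_sub_truncOp hf (h0 j) (ht j.le_succ)]
  exact enorm_integral_le_lintegral_enorm _

theorem truncOp_indicator_far (r t : ℝ) :
    truncOp K t ({y | r < |x - y|}.indicator f) x = truncOp K (max t r) f x := by
  rw [truncOp, truncOp, ← integral_indicator (measurableSet_truncSet _ _),
    ← integral_indicator (measurableSet_truncSet _ _)]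
  congr 1; ext y
  by_cases h1 : t < |x - y| <;> by_cases h2 : r < |x - y| <;> simp [Set.indicator, h1, h2]

theorem varOp_indicator_far_le (r : ℝ) :
    varOp q K ({y | r < |x - y|}.indicator f) x ≤ varOp q K f x := by
  refine qVariation_le fun t ht h0 => ?_
  simp only [truncOp_indicator_far]
  exact lqNorm_le_qVariation (a := fun t => truncOp K t f x) (t := fun j => max (t j) r)
    (fun i j hij => max_le_max_right _ (ht hij)) fun j => lt_max_of_lt_left (h0 j)

theorem KernelBounds.continuous_truncOp {δ A : ℝ} (hK : KernelBounds K δ A) (hf : Integrable f)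
    {t : ℝ} (ht : 0 < t) : Continuous (truncOp K t f) := by
  have e : truncOp K t f = fun x => ∫ y, {y | t < |x - y|}.indicator (fun y => K x y * f y) y := by
    ext x; rw [truncOp, integral_indicator (measurableSet_truncSet _ _)]
  rw [e, continuous_iff_continuousAt]
  intro x
  refine continuousAt_of_dominated (bound := fun y => A / t * ‖f y‖) ?_ ?_
    (hf.norm.const_mul _) ?_
  · exact Eventually.of_forall fun z =>
      ((hK.aestronglyMeasurable z).mul hf.1).indicator (measurableSet_truncSet _ _)
  · refine Eventually.of_forall fun z => Eventually.of_forall fun y => ?_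
    have hA := hK.const_pos
    by_cases h : t < |z - y|
    · rw [Set.indicator_of_mem (by exact h), norm_mul]
      gcongr
      refine (hK.size z y ?_).trans ?_
      · rintro rfl; simp at h; linarith
      · gcongr
    · rw [Set.indicator_of_notMem (by exact h), norm_zero]; positivity
  · have h1 : ∀ᵐ y : ℝ, y ≠ x - t := by simp [ae_iff]
    have h2 : ∀ᵐ y : ℝ, y ≠ x + t := by simp [ae_iff]
    filter_upwards [h1, h2] with y hy1 hy2
    have hc : ContinuousAt (fun z : ℝ => |z - y|) x := by fun_prop
    have hne : |x - y| ≠ t := by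
      intro h
      rcases (abs_eq ht.le).1 h with h | h
      · exact hy1 (by linarith)
      · exact hy2 (by linarith)
    rcases lt_or_gt_of_ne hne with h | h
    · refine (continuousAt_const (y := (0 : ℂ))).congr ?_
      filter_upwards [hc.eventually_lt continuousAt_const h] with z hz
      rw [Set.indicator_of_notMem]
      exact not_lt.2 hz.le
    · have hxy : x ≠ y := by rintro rfl; simp at h; linarith
      refine ((hK.continuousAt_left hxy).mul (continuousAt_const (y := f y))).congr ?_
      filter_upwards [continuousAt_const.eventually_lt hc h] with z hz
      exact (Set.indicator_of_mem (s := {y | t < |z - y|}) hz (fun y => K z y * f y)).symm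

theorem KernelBounds.measurable_varOp {δ A : ℝ} (hK : KernelBounds K δ A) (hf : Integrable f)
    (hq : 1 ≤ q) : Measurable (varOp q K f) := by
  refine LowerSemicontinuous.measurable (lowerSemicontinuous_iSup fun t => ?_)
  refine (ENNReal.continuous_rpow_const).comp_lowerSemicontinuous
    (lowerSemicontinuous_tsum fun j => Continuous.lowerSemicontinuous ?_)
    (ENNReal.monotone_rpow_of_nonneg (by positivity))
  exact ENNReal.continuous_rpow_const.comp (((hK.continuous_truncOp hf (t.2.2 j)).sub
    (hK.continuous_truncOp hf (t.2.2 (j + 1)))).enorm)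

end Truncations

section GrandMaximal

variable {K : ℝ → ℝ → ℂ} {f g : ℝ → ℂ} {x : ℝ} {q : ℝ}

/-- The fivefold dilate of the interval with endpoints `a` and `b`. -/
def dilate (a b : ℝ) : Set ℝ := Set.Icc (a - 2 * (b - a)) (b + 2 * (b - a))

theorem measurableSet_dilate (a b : ℝ) : MeasurableSet (dilate a b) := measurableSet_Icc

/-- The grand maximal truncation of the variation operator. -/
def grandMax (q : ℝ) (K : ℝ → ℝ → ℂ) (f : ℝ → ℂ) (x : ℝ) : ℝ≥0∞ :=
  ⨆ (a : ℝ) (b : ℝ) (z : ℝ) (_ : x ∈ Set.Ioo a b) (_ : z ∈ Set.Ioo a b),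
    varOp q K ((dilate a b)ᶜ.indicator f) z

theorem lt_grandMax_iff {l : ℝ≥0∞} : l < grandMax q K f x ↔ ∃ a b z, x ∈ Set.Ioo a b ∧
    z ∈ Set.Ioo a b ∧ l < varOp q K ((dilate a b)ᶜ.indicator f) z := by
  simp only [grandMax, lt_iSup_iff, exists_prop]

theorem le_grandMax {a b z : ℝ} (hx : x ∈ Set.Ioo a b) (hz : z ∈ Set.Ioo a b) :
    varOp q K ((dilate a b)ᶜ.indicator f) z ≤ grandMax q K f x :=
  le_iSup_of_le a (le_iSup_of_le b (le_iSup_of_le z (le_iSup_of_le hx (le_iSup_of_le hz le_rfl))))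

theorem grandMax_le {B : ℝ≥0∞} (h : ∀ a b z, x ∈ Set.Ioo a b → z ∈ Set.Ioo a b →
    varOp q K ((dilate a b)ᶜ.indicator f) z ≤ B) : grandMax q K f x ≤ B :=
  iSup_le fun a => iSup_le fun b => iSup_le fun z => iSup_le fun hx => iSup_le fun hz =>
    h a b z hx hz

theorem isOpen_lt_grandMax (l : ℝ≥0∞) : IsOpen {x | l < grandMax q K f x} := by
  rw [isOpen_iff_mem_nhds]
  intro x hx
  obtain ⟨a, b, z, hab, hz, h⟩ := lt_grandMax_iff.1 hx
  filter_upwards [isOpen_Ioo.mem_nhds hab] with y hy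
  exact lt_grandMax_iff.2 ⟨a, b, z, hy, hz, h⟩

theorem measurable_grandMax : Measurable (grandMax q K f) :=
  measurable_of_Ioi fun l => (isOpen_lt_grandMax l).measurableSet

theorem grandMax_add_le (hq : 1 ≤ q) (hf : ∀ z, TruncConverges K f z)
    (hg : ∀ z, TruncConverges K g z) (x : ℝ) :
    grandMax q K (f + g) x ≤ grandMax q K f x + grandMax q K g x := by
  refine grandMax_le fun a b z hx hz => ?_
  rw [Set.indicator_add']
  have hm := (measurableSet_dilate a b).compl
  exact (varOp_add_le hq ((hf z).indicator hm) ((hg z).indicator hm)).trans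
    (add_le_add (le_grandMax hx hz) (le_grandMax hx hz))

theorem varOp_le_grandMax (f : ℝ → ℂ) (x : ℝ) : varOp q K f x ≤ grandMax q K f x := by
  refine qVariation_le fun t ht h0 => ?_
  set h := t 0 / 10 with hh
  have hpos : 0 < h := by have := h0 0; positivity
  have hx : x ∈ Set.Ioo (x - h) (x + h) := ⟨by linarith, by linarith⟩
  have e : ∀ j, truncOp K (t j) f x =
      truncOp K (t j) ((dilate (x - h) (x + h))ᶜ.indicator f) x := by
    intro j
    refine setIntegral_congr_fun (measurableSet_truncSet _ _) fun y hy => ?_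
    have hy' : t j < |x - y| := hy
    have h1 := ht (Nat.zero_le j)
    rw [Set.indicator_of_mem]
    rintro ⟨h2, h3⟩
    have : |x - y| ≤ 5 * h := abs_le.2 ⟨by linarith, by linarith⟩
    linarith
  simp only [e]
  exact (lqNorm_le_qVariation ht h0).trans (le_grandMax hx hx)

end GrandMaximal

theorem lintegral_rpow_far_le (a : ℝ) {ρ s : ℝ} (hρ : 0 < ρ) (hs : 1 < s) :
    ∫⁻ y in {y : ℝ | ρ < |a - y|}, ENNReal.ofReal (|a - y| ^ (-s)) ≤
      ENNReal.ofReal (2 / (s - 1) * ρ ^ (1 - s)) := by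
  simp_rw [abs_sub_comm a]
  exact lintegral_rpow_tail_le a hρ hs

theorem lqNorm_setLIntegral_le {q : ℝ} (hq : 1 < q) {E : ℕ → Set ℝ} (hE : ∀ j, MeasurableSet (E j))
    (hd : Pairwise (Function.onFun Disjoint E)) {m : ℝ≥0∞} (hm : ∀ j, volume (E j) ≤ m)
    {φ : ℝ → ℝ≥0∞} (hφ : AEMeasurable φ) :
    lqNorm q (fun j => ∫⁻ y in E j, φ y) ≤ (m ^ (q - 1) * ∫⁻ y, φ y ^ q) ^ (1 / q) := by
  unfold lqNorm
  refine ENNReal.rpow_le_rpow ?_ (by positivity)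
  calc ∑' j, (∫⁻ y in E j, φ y) ^ q ≤ ∑' j, m ^ (q - 1) * ∫⁻ y in E j, φ y ^ q := by
        refine ENNReal.tsum_le_tsum fun j => ?_
        refine (lintegral_rpow_le_measure_rpow_mul _ hφ.restrict hq).trans
          (mul_le_mul' (ENNReal.rpow_le_rpow ?_ (by linarith)) le_rfl)
        rw [Measure.restrict_apply_univ]; exact hm j
    _ = m ^ (q - 1) * ∫⁻ y in ⋃ j, E j, φ y ^ q := by
        rw [ENNReal.tsum_mul_left, lintegral_iUnion hE hd]
    _ ≤ _ := mul_le_mul' le_rfl (lintegral_mono' Measure.restrict_le_self le_rfl)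

theorem volume_annulus_diff_le {x z h : ℝ} (hxz : |x - z| ≤ h) (s t : ℝ) :
    volume (annulus z s t \ annulus x s t) ≤ ENNReal.ofReal (4 * h) := by
  have hh : 0 ≤ h := (abs_nonneg _).trans hxz
  have hsub : annulus z s t \ annulus x s t ⊆
      (Set.Icc (z + s) (z + s + h) ∪ Set.Icc (z - s - h) (z - s)) ∪
      (Set.Icc (z + t - h) (z + t) ∪ Set.Icc (z - t) (z - t + h)) := by
    rintro y ⟨⟨h1, h2⟩, h3⟩
    have tri : |z - y| ≤ |x - y| + h := by
      have := abs_sub_le z x y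
      rw [abs_sub_comm z x] at this
      linarith
    have tri' : |x - y| ≤ |z - y| + h := by
      have := abs_sub_le x z y
      linarith
    simp only [annulus, Set.mem_ofPred_eq, not_and_or, not_lt, not_le] at h3
    rcases h3 with h3 | h3
    · left
      rcases abs_cases (z - y) with ⟨e, _⟩ | ⟨e, _⟩
      · right; constructor <;> linarith
      · left; constructor <;> linarith
    · right
      rcases abs_cases (z - y) with ⟨e, _⟩ | ⟨e, _⟩
      · right; constructor <;> linarith
      · left; constructor <;> linarith
  refine (measure_mono hsub).trans ((measure_union_le _ _).trans
    ((add_le_add (measure_union_le _ _) (measure_union_le _ _)).trans (le_of_eq ?_)))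
  simp only [Real.volume_Icc]
  rw [← ENNReal.ofReal_add, ← ENNReal.ofReal_add, ← ENNReal.ofReal_add] <;> ring_nf <;> positivity

namespace KernelBounds

variable {K : ℝ → ℝ → ℂ} {δ A : ℝ} (hK : KernelBounds K δ A) {q : ℝ}
include hK

theorem enorm_sub_le {x y z h : ℝ} (hxz : |x - z| ≤ h) (hy : 2 * h < |x - y|) :
    ‖K z y - K x y‖ₑ ≤ ENNReal.ofReal (A * h ^ δ * |x - y| ^ (-(1 + δ))) := by
  have hh : 0 ≤ h := (abs_nonneg _).trans hxz
  have h0 : 0 < |x - y| := by linarith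
  have hA := hK.const_pos
  rw [← ofReal_norm, norm_sub_rev]
  refine ENNReal.ofReal_le_ofReal ((hK.regular_left x y z (by linarith)).trans ?_)
  rw [Real.div_rpow (abs_nonneg _) h0.le, Real.rpow_neg h0.le, Real.rpow_add h0, Real.rpow_one]
  have := Real.rpow_le_rpow (abs_nonneg (x - z)) hxz hK.exponent_pos.le
  calc A * (|x - z| ^ δ / |x - y| ^ δ) / |x - y| ≤ A * (h ^ δ / |x - y| ^ δ) / |x - y| := by gcongr
    _ = _ := by field_simp

/-- Comparison of the variation at two points for a bounded function vanishing near them. -/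
theorem varOp_far_le (hq : 1 < q) {g : ℝ → ℂ} (hg : Integrable g) {l : ℝ≥0}
    (hl : ∀ᵐ y, ‖g y‖ₑ ≤ l) {x z h : ℝ} (hh : 0 < h) (hxz : |x - z| ≤ h) :
    varOp q K ({y | 3 * h < |x - y|}.indicator g) z ≤ varOp q K g x +
      (ENNReal.ofReal (2 * A / δ) * l + 2 * (ENNReal.ofReal (A ^ q * (2 / (q - 1)) *
        (4 / 3) ^ (q - 1)) * (l : ℝ≥0∞) ^ q) ^ (1 / q)) := by
  set S : Set ℝ := {y | 3 * h < |x - y|}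
  set F := S.indicator g with hF
  have hSm : MeasurableSet S := measurableSet_truncSet x _
  have hA := hK.const_pos
  have hδ := hK.exponent_pos
  have hFi : Integrable F := hg.indicator hSm
  have hFl : ∀ᵐ y, ‖F y‖ₑ ≤ l := by
    filter_upwards [hl] with y hy
    by_cases h : y ∈ S
    · rw [hF, Set.indicator_of_mem h]; exact hy
    · rw [hF, Set.indicator_of_notMem h]; simp
  have hcz := hK.truncConverges hFi z
  have hcx := hK.truncConverges hFi x
  have hkx : Integrable fun y => K x y * F y := by
    have h1 := hK.truncConverges hg x (3 * h) (by positivity)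
    rw [← integrable_indicator_iff hSm] at h1
    refine h1.congr (Eventually.of_forall fun y => ?_)
    by_cases h : y ∈ S
    · simp [hF, h]
    · simp [hF, h]
  have hsmooth : ∫⁻ y, ‖K z y * F y - K x y * F y‖ₑ ≤ ENNReal.ofReal (2 * A / δ) * l := by
    calc ∫⁻ y, ‖K z y * F y - K x y * F y‖ₑ
        ≤ ∫⁻ y, S.indicator (fun y => ENNReal.ofReal (|x - y| ^ (-(1 + δ)))) y *
          (ENNReal.ofReal (A * h ^ δ) * l) := by
          refine lintegral_mono_ae ?_
          filter_upwards [hFl] with y hy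
          by_cases hyS : y ∈ S
          · have hyS' : 3 * h < |x - y| := hyS
            rw [← sub_mul, enorm_mul, Set.indicator_of_mem hyS, ← mul_assoc,
              ← ENNReal.ofReal_mul (by positivity), mul_comm (|x - y| ^ (-(1 + δ)))]
            exact mul_le_mul' (hK.enorm_sub_le hxz (by linarith)) hy
          · simp [hF, hyS]
      _ ≤ ENNReal.ofReal (2 / (1 + δ - 1) * (3 * h) ^ (1 - (1 + δ))) *
          (ENNReal.ofReal (A * h ^ δ) * l) := by
          rw [lintegral_mul_const' _ _ (by finiteness), lintegral_indicator hSm]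
          exact mul_le_mul' (lintegral_rpow_far_le x (by positivity) (by linarith)) le_rfl
      _ ≤ _ := by
          rw [show 1 - (1 + δ) = -δ by ring, show 1 + δ - 1 = δ by ring, ← mul_assoc,
            ← ENNReal.ofReal_mul (by positivity)]
          gcongr
          rw [Real.mul_rpow (by norm_num) hh.le, Real.rpow_neg hh.le]
          have h3 : (3 : ℝ) ^ (-δ) ≤ 1 :=
            Real.rpow_le_one_of_one_le_of_nonpos (by norm_num) (by linarith)
          calc 2 / δ * (3 ^ (-δ) * (h ^ δ)⁻¹) * (A * h ^ δ) = 2 * A / δ * 3 ^ (-δ) := by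
                field_simp
            _ ≤ 2 * A / δ * 1 := by gcongr
            _ = _ := mul_one _
  have hpow : ∫⁻ y, ‖K x y * F y‖ₑ ^ q ≤
      ENNReal.ofReal (A ^ q * (2 / (q - 1)) * (3 * h) ^ (1 - q)) * (l : ℝ≥0∞) ^ q := by
    calc ∫⁻ y, ‖K x y * F y‖ₑ ^ q
        ≤ ∫⁻ y, S.indicator (fun y => ENNReal.ofReal (|x - y| ^ (-q))) y *
          (ENNReal.ofReal (A ^ q) * (l : ℝ≥0∞) ^ q) := by
          refine lintegral_mono_ae ?_
          filter_upwards [hFl] with y hy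
          by_cases hyS : y ∈ S
          · have hyS' : 3 * h < |x - y| := hyS
            have h0 : 0 < |x - y| := by linarith
            rw [enorm_mul, Set.indicator_of_mem hyS, ← mul_assoc,
              ← ENNReal.ofReal_mul (by positivity), ENNReal.mul_rpow_of_nonneg _ _ (by linarith)]
            refine mul_le_mul' ?_ (ENNReal.rpow_le_rpow hy (by linarith))
            refine (ENNReal.rpow_le_rpow (hK.enorm_le h0 le_rfl) (by linarith)).trans ?_
            rw [ENNReal.ofReal_rpow_of_pos (by positivity), Real.div_rpow hA.le h0.le,
              Real.rpow_neg h0.le, div_eq_mul_inv, mul_comm]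
          · simp [hF, hyS, show 0 < q by linarith]
      _ ≤ ENNReal.ofReal (2 / (q - 1) * (3 * h) ^ (1 - q)) *
          (ENNReal.ofReal (A ^ q) * (l : ℝ≥0∞) ^ q) := by
          rw [lintegral_mul_const' _ _ (by finiteness), lintegral_indicator hSm]
          exact mul_le_mul' (lintegral_rpow_far_le x (by positivity) hq) le_rfl
      _ = _ := by
          have : 0 < q - 1 := by linarith
          rw [← mul_assoc, ← ENNReal.ofReal_mul (by positivity)]
          congr 2; ring
  have hjump : ∀ E : ℕ → Set ℝ, (∀ j, MeasurableSet (E j)) → Pairwise (Function.onFun Disjoint E) →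
      (∀ j, volume (E j) ≤ ENNReal.ofReal (4 * h)) →
      lqNorm q (fun j => ∫⁻ y in E j, ‖K x y * F y‖ₑ) ≤
        (ENNReal.ofReal (A ^ q * (2 / (q - 1)) * (4 / 3) ^ (q - 1)) *
          (l : ℝ≥0∞) ^ q) ^ (1 / q) := by
    intro E hE hd hv
    refine (lqNorm_setLIntegral_le hq hE hd hv hkx.1.enorm).trans
      (ENNReal.rpow_le_rpow ?_ (by positivity))
    refine (mul_le_mul' le_rfl hpow).trans (le_of_eq ?_)
    have : 0 < q - 1 := by linarith
    rw [ENNReal.ofReal_rpow_of_pos (by positivity), ← mul_assoc,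
      ← ENNReal.ofReal_mul (by positivity)]
    congr 2
    rw [show 1 - q = -(q - 1) by ring, Real.rpow_neg (by positivity),
      Real.mul_rpow (by norm_num) hh.le, Real.mul_rpow (by norm_num) hh.le,
      Real.div_rpow (by norm_num) (by norm_num)]
    field_simp
  refine qVariation_le fun t ht h0 => ?_
  have hstep : ∀ j, ‖truncOp K (t j) F z - truncOp K (t (j + 1)) F z‖ₑ ≤
      ‖truncOp K (t j) F x - truncOp K (t (j + 1)) F x‖ₑ +
      ((∫⁻ y in annulus z (t j) (t (j + 1)), ‖K z y * F y - K x y * F y‖ₑ) +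
      ((∫⁻ y in annulus z (t j) (t (j + 1)) \ annulus x (t j) (t (j + 1)), ‖K x y * F y‖ₑ) +
      ∫⁻ y in annulus x (t j) (t (j + 1)) \ annulus z (t j) (t (j + 1)), ‖K x y * F y‖ₑ)) := by
    intro j
    rw [truncOp_sub_truncOp hcz (h0 j) (ht j.le_succ),
      truncOp_sub_truncOp hcx (h0 j) (ht j.le_succ)]
    set Z := annulus z (t j) (t (j + 1))
    set X := annulus x (t j) (t (j + 1))
    have hZ : MeasurableSet Z := measurableSet_annulus _ _ _
    have hX : MeasurableSet X := measurableSet_annulus _ _ _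
    have e : ∫ y in Z, K z y * F y = (∫ y in X, K x y * F y) +
        ((∫ y in Z, (K z y * F y - K x y * F y)) +
        ((∫ y in Z \ X, K x y * F y) - ∫ y in X \ Z, K x y * F y)) := by
      rw [integral_sub (hcz.integrableOn_annulus (h0 j)) hkx.integrableOn,
        ← integral_inter_add_sdiff hZ (hkx.integrableOn (s := X)),
        ← integral_inter_add_sdiff hX (hkx.integrableOn (s := Z)), Set.inter_comm Z X]
      ring
    rw [e]
    refine (enorm_add_le _ _).trans (add_le_add le_rfl ((enorm_add_le _ _).trans
      (add_le_add (enorm_integral_le_lintegral_enorm _) ((_root_.enorm_sub_le).trans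
      (add_le_add (enorm_integral_le_lintegral_enorm _) (enorm_integral_le_lintegral_enorm _))))))
  refine (lqNorm_mono hq.le hstep).trans ((lqNorm_add_le hq.le _ _).trans ?_)
  refine add_le_add ((lqNorm_le_qVariation ht h0).trans (varOp_indicator_far_le _)) ?_
  refine (lqNorm_add_le hq.le _ _).trans (add_le_add ?_ ?_)
  · exact (lqNorm_le_tsum hq.le _).trans ((tsum_lintegral_annulus_le ht z _).trans hsmooth)
  · refine (lqNorm_add_le hq.le _ _).trans ?_
    rw [two_mul]
    refine add_le_add (hjump _ (fun j => (measurableSet_annulus _ _ _).diff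
      (measurableSet_annulus _ _ _)) (fun i j hij => (disjoint_annulus ht z hij).mono
      Set.sdiff_subset Set.sdiff_subset) fun j => volume_annulus_diff_le hxz _ _)
      (hjump _ (fun j => (measurableSet_annulus _ _ _).diff
      (measurableSet_annulus _ _ _)) (fun i j hij => (disjoint_annulus ht x hij).mono
      Set.sdiff_subset Set.sdiff_subset) fun j => volume_annulus_diff_le ?_ _ _)
    rwa [abs_sub_comm]

theorem exists_grandMax_le_of_bounded (hq : 1 < q) : ∃ C : ℝ≥0, ∀ g : ℝ → ℂ, Integrable g →
    ∀ l : ℝ≥0, (∀ᵐ y, ‖g y‖ₑ ≤ l) → ∀ x, grandMax q K g x ≤ varOp q K g x + C * l := by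
  have hA := hK.const_pos
  refine ⟨(2 * A / δ).toNNReal + 2 * (A ^ q * (2 / (q - 1)) *
        (4 / 3) ^ (q - 1)).toNNReal ^ (1 / q) + (3 * A).toNNReal, fun g hg l hl x => ?_⟩
  refine grandMax_le fun a b z hx hz => ?_
  set h := b - a
  have h0 : 0 < h := by linarith [hx.1, hx.2]
  have hxz : |x - z| ≤ h := abs_le.2 ⟨by linarith [hx.1, hz.2], by linarith [hx.2, hz.1]⟩
  set S : Set ℝ := {y | 3 * h < |x - y|}
  have hSm : MeasurableSet S := measurableSet_truncSet x _
  have hDm : MeasurableSet ((dilate a b)ᶜ \ S) := (measurableSet_dilate a b).compl.diff hSm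
  have hSD : S ⊆ (dilate a b)ᶜ := by
    rintro y hy ⟨h1, h2⟩
    have : |x - y| ≤ 3 * h := abs_le.2 ⟨by linarith [hx.1], by linarith [hx.2]⟩
    exact absurd this (not_le.2 hy)
  have e : (dilate a b)ᶜ.indicator g = S.indicator g + ((dilate a b)ᶜ \ S).indicator g := by
    ext y
    by_cases h1 : y ∈ S
    · have h2 : y ∈ (dilate a b)ᶜ := hSD h1
      rw [Pi.add_apply, Set.indicator_of_mem h2, Set.indicator_of_mem h1,
        Set.indicator_of_notMem (fun h => h.2 h1), add_zero]
    · by_cases h2 : y ∈ (dilate a b)ᶜ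
      · rw [Pi.add_apply, Set.indicator_of_mem h2, Set.indicator_of_notMem h1,
          Set.indicator_of_mem (show y ∈ (dilate a b)ᶜ \ S from ⟨h2, h1⟩), zero_add]
      · rw [Pi.add_apply, Set.indicator_of_notMem h2, Set.indicator_of_notMem h1,
          Set.indicator_of_notMem (fun h => h2 h.1), zero_add]
  have hnear : varOp q K (((dilate a b)ᶜ \ S).indicator g) z ≤ ENNReal.ofReal (3 * A) * l := by
    refine (varOp_le_lintegral hq.le (hK.truncConverges (hg.indicator hDm) z)).trans ?_
    calc ∫⁻ y, ‖K z y * ((dilate a b)ᶜ \ S).indicator g y‖ₑ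
        ≤ ∫⁻ y, (Set.Icc (x - 3 * h) (x + 3 * h)).indicator
          (fun _ => ENNReal.ofReal (A / (2 * h)) * l) y := by
          refine lintegral_mono_ae ?_
          filter_upwards [hl] with y hy
          by_cases hyD : y ∈ (dilate a b)ᶜ \ S
          · have h1 : y ∉ dilate a b := hyD.1
            have h2 : |x - y| ≤ 3 * h := not_lt.1 hyD.2
            have h3 := abs_le.1 h2
            have h4 : 2 * h ≤ |z - y| := by
              by_contra hc
              have := abs_lt.1 (not_le.1 hc)
              exact h1 ⟨by linarith [hz.1], by linarith [hz.2]⟩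
            have h5 : y ∈ Set.Icc (x - 3 * h) (x + 3 * h) := ⟨by linarith, by linarith⟩
            rw [Set.indicator_of_mem hyD, Set.indicator_of_mem h5, enorm_mul]
            exact mul_le_mul' (hK.enorm_le (by positivity) h4) hy
          · simp [hyD]
      _ = _ := by
          rw [lintegral_indicator measurableSet_Icc, setLIntegral_const, Real.volume_Icc,
            mul_right_comm, ← ENNReal.ofReal_mul (by positivity)]
          congr 2; field_simp; ring
  rw [e]
  refine (varOp_add_le hq.le (hK.truncConverges (hg.indicator hSm) z)
    (hK.truncConverges (hg.indicator hDm) z)).trans ?_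
  refine (add_le_add (hK.varOp_far_le hq hg hl h0 hxz) hnear).trans (le_of_eq ?_)
  have e1 : (ENNReal.ofReal (A ^ q * (2 / (q - 1)) * (4 / 3) ^ (q - 1)) * (l : ℝ≥0∞) ^ q) ^ (1 / q)
      = ((A ^ q * (2 / (q - 1)) * (4 / 3) ^ (q - 1)).toNNReal ^ (1 / q) : ℝ≥0) * (l : ℝ≥0∞) := by
    rw [ENNReal.mul_rpow_of_nonneg _ _ (by positivity), ← ENNReal.rpow_mul,
      mul_one_div_cancel (by linarith), ENNReal.rpow_one,
      ENNReal.coe_rpow_of_nonneg _ (by positivity)]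
    rfl
  rw [e1]
  simp only [ENNReal.ofReal, ENNReal.coe_add, ENNReal.coe_mul]
  push_cast
  ring

end KernelBounds

theorem exists_finset_card_le_of_disjoint {κ : Type*} {I : κ → Set ℝ}
    (hI : Pairwise (Function.onFun Disjoint I)) (E : Finset ℝ) :
    ∃ F : Finset κ, F.card ≤ E.card ∧ ∀ k ∉ F, ∀ e ∈ E, e ∉ I k := by
  classical
  have huniq : ∀ e k k', e ∈ I k → e ∈ I k' → k = k' := by
    intro e k k' h h'
    by_contra hne
    exact Set.disjoint_left.1 (hI hne) h h'
  refine ⟨E.biUnion fun e => if h : ∃ k, e ∈ I k then {h.choose} else ∅, ?_, ?_⟩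
  · refine (Finset.card_biUnion_le_card_mul _ _ 1 fun e _ => ?_).trans (mul_one _).le
    split_ifs <;> simp
  · intro k hk e he hek
    apply hk
    rw [Finset.mem_biUnion]
    refine ⟨e, he, ?_⟩
    have h : ∃ k, e ∈ I k := ⟨k, hek⟩
    rw [dif_pos h, Finset.mem_singleton]
    exact huniq e _ _ hek h.choose_spec

theorem mem_annulus_sdiff_dilate_iff {a b c d z s t y w : ℝ} (hy : y ∈ Set.Ioo a b)
    (hw : w ∈ Set.Ioo a b)
    (h : ∀ e ∈ ({z - s, z + s, z - t, z + t, c - 2 * (d - c), d + 2 * (d - c)} : Finset ℝ),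
      e ∉ Set.Ioo a b) (hyP : y ∈ annulus z s t \ dilate c d) :
    w ∈ annulus z s t \ dilate c d := by
  simp only [Finset.mem_insert, Finset.mem_singleton, forall_eq_or_imp, forall_eq] at h
  have side : ∀ e, e ∉ Set.Ioo a b → (e ≤ y → e ≤ w ∧ e < w) ∧ (y ≤ e → w ≤ e ∧ w < e) := by
    intro e he
    have : e ≤ a ∨ b ≤ e := by
      by_contra hc
      push Not at hc
      exact he ⟨hc.1, hc.2⟩
    rcases this with h1 | h1
    · exact ⟨fun _ => ⟨by linarith [hw.1], by linarith [hw.1]⟩, fun h2 => by linarith [hy.1]⟩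
    · exact ⟨fun h2 => by linarith [hy.2], fun _ => ⟨by linarith [hw.2], by linarith [hw.2]⟩⟩
  obtain ⟨h1, h2, h3, h4, h5, h6⟩ := h
  obtain ⟨⟨p1, p2⟩, p3⟩ := hyP
  refine ⟨⟨?_, ?_⟩, ?_⟩
  · rcases lt_abs.1 p1 with p | p
    · exact lt_abs.2 (Or.inl (by linarith [((side _ h1).2 (by linarith)).2]))
    · exact lt_abs.2 (Or.inr (by linarith [((side _ h2).1 (by linarith)).2]))
  · obtain ⟨p4, p5⟩ := abs_le.1 p2
    exact abs_le.2 ⟨by linarith [((side _ h4).2 (by linarith)).2],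
      by linarith [((side _ h3).1 (by linarith)).2]⟩
  · rintro ⟨p4, p5⟩
    apply p3
    constructor
    · by_contra hc
      linarith [((side _ h5).2 (by linarith)).2]
    · by_contra hc
      linarith [((side _ h6).1 (by linarith)).2]

/-- Points of an interval which is not contained in the dilate of an interval around `x` and `z`
are about as far from `z` as from `x`. -/
theorem dist_le_of_not_subset_dilate {a b c d x z y : ℝ} (hab : a < b) (hx : x ∈ Set.Ioo c d)
    (hz : z ∈ Set.Ioo c d) (hxI : x ∉ Set.Ioo (a - 6 * (b - a)) (b + 6 * (b - a)))
    (hI : ¬ Set.Ioo a b ⊆ dilate c d) (hy : y ∈ Set.Icc a b) :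
    3 * (b - a) ≤ |z - y| ∧ |x - y| ≤ 2 * |z - y| ∧ 6 * (b - a) ≤ |x - y| := by
  obtain ⟨y0, hy0, hyD⟩ := Set.not_subset.1 hI
  have hxy : 6 * (b - a) ≤ |x - y| := by
    by_contra hc
    have := abs_lt.1 (not_le.1 hc)
    exact hxI ⟨by linarith [hy.1], by linarith [hy.2]⟩
  have hxz : |x - z| ≤ d - c := abs_le.2 ⟨by linarith [hx.1, hz.2], by linarith [hx.2, hz.1]⟩
  have tri := abs_sub_le x z y
  rcases le_or_gt (d - c) (b - a) with h | h
  · exact ⟨by linarith, by linarith, hxy⟩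
  · have h1 : d - c ≤ |z - y| := by
      by_contra hc
      have := abs_lt.1 (not_le.1 hc)
      exact hyD ⟨by linarith [hz.1, hy.1, hy.2, hy0.1, hy0.2],
        by linarith [hz.2, hy.1, hy.2, hy0.1, hy0.2]⟩
    exact ⟨by linarith, by linarith, hxy⟩

namespace KernelBounds

variable {K : ℝ → ℝ → ℂ} {δ A : ℝ} (hK : KernelBounds K δ A) {q : ℝ}
include hK

theorem enorm_integral_le_of_integral_eq_zero {f : ℝ → ℂ} {a b x z : ℝ} {l : ℝ≥0} (hab : a < b)
    (hint : IntegrableOn f (Set.Ioo a b)) (h0 : ∫ y in Set.Ioo a b, f y = 0)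
    (hl : ∫⁻ y in Set.Ioo a b, ‖f y‖ₑ ≤ 2 * l * ENNReal.ofReal (b - a))
    (hKf : IntegrableOn (fun y => K z y * f y) (Set.Ioo a b))
    (hza : 3 * (b - a) ≤ |z - a|) (hxa : |x - a| ≤ 2 * |z - a|) (hxa' : 0 < |x - a|) :
    ‖∫ y in Set.Ioo a b, K z y * f y‖ₑ ≤
      ENNReal.ofReal (8 * A) * l * ENNReal.ofReal (((b - a) / |x - a|) ^ (1 + δ)) := by
  have hA := hK.const_pos
  have hδ := hK.exponent_pos
  have hza0 : 0 < |z - a| := by linarith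
  have e : ∫ y in Set.Ioo a b, K z y * f y = ∫ y in Set.Ioo a b, (K z y - K z a) * f y := by
    simp_rw [sub_mul]
    rw [integral_sub hKf (hint.const_mul _), integral_const_mul, h0, mul_zero, sub_zero]
  rw [e]
  have hbound : ∀ y ∈ Set.Ioo a b, ‖K z y - K z a‖ₑ ≤
      ENNReal.ofReal (4 * A * ((b - a) / |x - a|) ^ δ / |x - a|) := by
    intro y hy
    rw [← ofReal_norm, norm_sub_rev]
    have h1 : |a - y| ≤ b - a := abs_le.2 ⟨by linarith [hy.2], by linarith [hy.1]⟩
    have h2 := hK.regular_right a z y (by rw [abs_sub_comm a z]; linarith)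
    refine ENNReal.ofReal_le_ofReal (h2.trans ?_)
    rw [abs_sub_comm a z]
    have h3 : |a - y| / |z - a| ≤ 2 * ((b - a) / |x - a|) := by
      rw [div_le_iff₀ hza0]
      calc |a - y| ≤ (b - a) * 1 := by linarith
        _ ≤ (b - a) * (2 * |z - a| / |x - a|) := by
          gcongr; rw [le_div_iff₀ hxa']; linarith
        _ = _ := by ring
    have h4 : (|a - y| / |z - a|) ^ δ ≤ 2 * ((b - a) / |x - a|) ^ δ := by
      calc (|a - y| / |z - a|) ^ δ ≤ (2 * ((b - a) / |x - a|)) ^ δ := by gcongr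
        _ = 2 ^ δ * ((b - a) / |x - a|) ^ δ := by
          rw [Real.mul_rpow (by norm_num) (by positivity)]
        _ ≤ 2 ^ (1 : ℝ) * ((b - a) / |x - a|) ^ δ := by
          gcongr
          · norm_num
          · exact hK.exponent_le_one
        _ = _ := by rw [Real.rpow_one]
    have h5 : 1 / |z - a| ≤ 2 / |x - a| := by
      rw [div_le_div_iff₀ hza0 hxa']; linarith
    calc A * (|a - y| / |z - a|) ^ δ / |z - a| = A * (|a - y| / |z - a|) ^ δ * (1 / |z - a|) := by
          ring
      _ ≤ A * (2 * ((b - a) / |x - a|) ^ δ) * (2 / |x - a|) := by gcongr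
      _ = _ := by ring
  calc ‖∫ y in Set.Ioo a b, (K z y - K z a) * f y‖ₑ
      ≤ ∫⁻ y in Set.Ioo a b, ‖(K z y - K z a) * f y‖ₑ := enorm_integral_le_lintegral_enorm _
    _ ≤ ∫⁻ y in Set.Ioo a b,
        ENNReal.ofReal (4 * A * ((b - a) / |x - a|) ^ δ / |x - a|) * ‖f y‖ₑ := by
        refine setLIntegral_mono' measurableSet_Ioo fun y hy => ?_
        rw [enorm_mul]
        exact mul_le_mul' (hbound y hy) le_rfl
    _ ≤ ENNReal.ofReal (4 * A * ((b - a) / |x - a|) ^ δ / |x - a|) *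
        (2 * l * ENNReal.ofReal (b - a)) := by
        rw [lintegral_const_mul' _ _ ENNReal.ofReal_ne_top]
        exact mul_le_mul' le_rfl hl
    _ = _ := by
        rw [show (2 : ℝ≥0∞) = ENNReal.ofReal 2 by simp]
        calc _ = (ENNReal.ofReal (4 * A * ((b - a) / |x - a|) ^ δ / |x - a|) * ENNReal.ofReal 2 *
              ENNReal.ofReal (b - a)) * l := by ring
          _ = (ENNReal.ofReal (8 * A) * ENNReal.ofReal (((b - a) / |x - a|) ^ (1 + δ))) * l := by
            rw [← ENNReal.ofReal_mul (by positivity), ← ENNReal.ofReal_mul (by positivity),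
              ← ENNReal.ofReal_mul (by positivity)]
            congr 2
            rw [Real.rpow_add (by positivity), Real.rpow_one]
            field_simp; ring
          _ = _ := by ring

theorem lintegral_le_of_dist_le {f : ℝ → ℂ} {a b x z : ℝ} {l : ℝ≥0} (hab : a < b)
    (hl : ∫⁻ y in Set.Ioo a b, ‖f y‖ₑ ≤ 2 * l * ENNReal.ofReal (b - a))
    (hd : ∀ y ∈ Set.Icc a b, |x - y| ≤ 2 * |z - y| ∧ 6 * (b - a) ≤ |x - y|) :
    ∫⁻ y in Set.Ioo a b, ‖K z y * f y‖ₑ ≤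
      ENNReal.ofReal (8 * A) * l * ENNReal.ofReal ((b - a) / |x - a|) := by
  have hA := hK.const_pos
  have hxa : 0 < |x - a| := by linarith [(hd a ⟨le_rfl, hab.le⟩).2]
  calc ∫⁻ y in Set.Ioo a b, ‖K z y * f y‖ₑ
      ≤ ∫⁻ y in Set.Ioo a b, ENNReal.ofReal (A / (|x - a| / 4)) * ‖f y‖ₑ := by
        refine setLIntegral_mono' measurableSet_Ioo fun y hy => ?_
        rw [enorm_mul]
        refine mul_le_mul' (hK.enorm_le (by positivity) ?_) le_rfl
        obtain ⟨h1, h2⟩ := hd y ⟨hy.1.le, hy.2.le⟩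
        have h3 := abs_sub_le x y a
        have h4 : |y - a| ≤ b - a := abs_le.2 ⟨by linarith [hy.1], by linarith [hy.2]⟩
        linarith
    _ ≤ ENNReal.ofReal (A / (|x - a| / 4)) * (2 * l * ENNReal.ofReal (b - a)) := by
        rw [lintegral_const_mul' _ _ ENNReal.ofReal_ne_top]
        exact mul_le_mul' le_rfl hl
    _ = _ := by
        rw [show (2 : ℝ≥0∞) = ENNReal.ofReal 2 by simp]
        calc _ = (ENNReal.ofReal (A / (|x - a| / 4)) * ENNReal.ofReal 2 *
              ENNReal.ofReal (b - a)) * l := by ring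
          _ = (ENNReal.ofReal (8 * A) * ENNReal.ofReal ((b - a) / |x - a|)) * l := by
            rw [← ENNReal.ofReal_mul (by positivity), ← ENNReal.ofReal_mul (by positivity),
              ← ENNReal.ofReal_mul (by positivity)]
            congr 2
            field_simp; ring
          _ = _ := by ring

/-- Pointwise bound, away from the intervals `(a k, b k)`, for the grand maximal truncation of a
sum of functions with mean zero supported on these intervals. -/
theorem grandMax_le_of_cancel (hq : 2 ≤ q) {κ : Type*} [Countable κ] {a b : κ → ℝ}
    (hab : ∀ k, a k < b k) (hdis : Pairwise (Function.onFun Disjoint fun k => Set.Ioo (a k) (b k)))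
    {f : ℝ → ℂ} (hf : Integrable f) (hsupp : ∀ y, (∀ k, y ∉ Set.Ioo (a k) (b k)) → f y = 0)
    (hmean : ∀ k, ∫ y in Set.Ioo (a k) (b k), f y = 0) {l : ℝ≥0}
    (hl : ∀ k, ∫⁻ y in Set.Ioo (a k) (b k), ‖f y‖ₑ ≤ 2 * l * ENNReal.ofReal (b k - a k)) {x : ℝ}
    (hx : ∀ k, x ∉ Set.Ioo (a k - 6 * (b k - a k)) (b k + 6 * (b k - a k))) :
    grandMax q K f x ≤ ENNReal.ofReal (8 * A) * l *
      ((∑' k, ENNReal.ofReal (((b k - a k) / |x - a k|) ^ (1 + δ))) +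
        6 * (∑' k, ENNReal.ofReal (((b k - a k) / |x - a k|) ^ (1 + δ))) ^ (1 / q)) := by
  classical
  have hq1 : 1 ≤ q := by linarith
  have hδ1 := hK.exponent_le_one
  refine grandMax_le fun c d z hxc hz => qVariation_le fun t ht h0 => ?_
  set D := dilate c d
  have hDm : MeasurableSet D := measurableSet_dilate c d
  set I : κ → Set ℝ := fun k => Set.Ioo (a k) (b k)
  have hIm : ∀ k, MeasurableSet (I k) := fun k => measurableSet_Ioo
  set P : ℕ → Set ℝ := fun j => annulus z (t j) (t (j + 1)) \ D
  have hPm : ∀ j, MeasurableSet (P j) := fun j => (measurableSet_annulus _ _ _).diff hDm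
  have hPd : Pairwise (Function.onFun Disjoint P) := fun i j hij =>
    (disjoint_annulus ht z hij).mono Set.sdiff_subset Set.sdiff_subset
  have hcz := hK.truncConverges hf z
  have hKfP : ∀ j, IntegrableOn (fun y => K z y * f y) (P j) := fun j =>
    (hcz.integrableOn_annulus (h0 j)).mono_set Set.sdiff_subset
  set ρ : κ → ℝ≥0∞ := fun k => ENNReal.ofReal (((b k - a k) / |x - a k|) ^ (1 + δ))
  set s : κ → ℝ≥0∞ := fun k => ENNReal.ofReal (8 * A) * l * ρ k
  set S : ℕ → κ → ℝ≥0∞ := fun j k => if I k ⊆ P j then s k else 0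
  set v : ℕ → κ → ℝ≥0∞ := fun j k =>
    if I k ⊆ P j then 0 else ∫⁻ y in P j ∩ I k, ‖K z y * f y‖ₑ with hv
  have hdist : ∀ k, ¬ I k ⊆ D → ∀ y ∈ Set.Icc (a k) (b k), 3 * (b k - a k) ≤ |z - y| ∧
      |x - y| ≤ 2 * |z - y| ∧ 6 * (b k - a k) ≤ |x - y| := fun k hk y hy =>
    dist_le_of_not_subset_dilate (hab k) hxc hz (hx k) hk hy
  have hstep : ∀ j, ‖truncOp K (t j) (Dᶜ.indicator f) z -
      truncOp K (t (j + 1)) (Dᶜ.indicator f) z‖ₑ ≤ (∑' k, S j k) + ∑' k, v j k := by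
    intro j
    rw [truncOp_sub_truncOp (hcz.indicator hDm.compl) (h0 j) (ht j.le_succ)]
    have e1 : ∫ y in annulus z (t j) (t (j + 1)), K z y * Dᶜ.indicator f y =
        ∫ y in P j, K z y * f y := by
      have : P j = annulus z (t j) (t (j + 1)) ∩ Dᶜ := rfl
      rw [this, ← setIntegral_indicator hDm.compl]
      congr 1; ext y
      by_cases h : y ∈ Dᶜ
      · rw [Set.indicator_of_mem h, Set.indicator_of_mem h]
      · rw [Set.indicator_of_notMem h, Set.indicator_of_notMem h, mul_zero]
    have e2 : ∫ y in P j, K z y * f y = ∫ y in ⋃ k, P j ∩ I k, K z y * f y := by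
      refine setIntegral_eq_of_subset_of_forall_sdiff_eq_zero (hPm j)
        (Set.iUnion_subset fun k => Set.inter_subset_left) ?_
      rintro y ⟨hy, hy'⟩
      rw [hsupp y, mul_zero]
      intro k hk
      exact hy' (Set.mem_iUnion.2 ⟨k, hy, hk⟩)
    have hsum := hasSum_integral_iUnion (μ := volume) (f := fun y => K z y * f y)
      (s := fun k => P j ∩ I k) (fun k => (hPm j).inter (hIm k))
      (fun i k hik => (hdis hik).mono Set.inter_subset_right Set.inter_subset_right)
      ((hKfP j).mono_set (Set.iUnion_subset fun k => Set.inter_subset_left))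
    rw [e1, e2, ← hsum.tsum_eq, ← ENNReal.tsum_add]
    refine enorm_tsum_le_tsum_enorm.trans (ENNReal.tsum_le_tsum fun k => ?_)
    by_cases hk : I k ⊆ P j
    · have hkD : ¬ I k ⊆ D := by
        intro h
        obtain ⟨y, hy⟩ := Set.nonempty_Ioo.2 (hab k)
        exact (hk hy).2 (h hy)
      obtain ⟨d1, d2, d3⟩ := hdist k hkD (a k) ⟨le_rfl, (hab k).le⟩
      simp only [S, v, if_pos hk, add_zero, Set.inter_eq_right.2 hk]
      exact hK.enorm_integral_le_of_integral_eq_zero (hab k) hf.integrableOn (hmean k) (hl k)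
        ((hKfP j).mono_set hk) d1 d2 (by linarith [hab k])
    · simp only [S, v, if_neg hk, zero_add]
      exact enorm_integral_le_lintegral_enorm _
  have hSsum : lqNorm q (fun j => ∑' k, S j k) ≤ ∑' k, s k := by
    refine (lqNorm_le_tsum hq1 _).trans ?_
    rw [ENNReal.tsum_comm]
    refine ENNReal.tsum_le_tsum fun k => ?_
    by_cases hex : ∃ j, I k ⊆ P j
    · obtain ⟨j, hj⟩ := hex
      rw [tsum_eq_single j]
      · simp [S, hj]
      · intro i hi
        have : ¬ I k ⊆ P i := by
          intro h
          obtain ⟨y, hy⟩ := Set.nonempty_Ioo.2 (hab k)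
          exact Set.disjoint_left.1 (hPd hi) (h hy) (hj hy)
        simp [S, this]
    · push Not at hex
      simp [S, hex]
  have hvcol : ∀ k, ∑' j, v j k ≤ ENNReal.ofReal (8 * A) * l *
      ENNReal.ofReal ((b k - a k) / |x - a k|) := by
    intro k
    by_cases hkD : I k ⊆ D
    · have : ∀ j, v j k = 0 := by
        intro j
        have h : P j ∩ I k = ∅ := by
          rw [← Set.disjoint_iff_inter_eq_empty, Set.disjoint_left]
          exact fun y hy hy' => hy.2 (hkD hy')
        simp [v, h]
      simp [this]
    · calc ∑' j, v j k ≤ ∑' j, ∫⁻ y in P j ∩ I k, ‖K z y * f y‖ₑ := by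
            refine ENNReal.tsum_le_tsum fun j => ?_
            simp only [v]; split_ifs <;> simp
        _ = ∫⁻ y in ⋃ j, P j ∩ I k, ‖K z y * f y‖ₑ :=
            (lintegral_iUnion (fun j => (hPm j).inter (hIm k)) (fun i j hij =>
              (hPd hij).mono Set.inter_subset_left Set.inter_subset_left) _).symm
        _ ≤ ∫⁻ y in I k, ‖K z y * f y‖ₑ :=
            lintegral_mono_set (Set.iUnion_subset fun j => Set.inter_subset_right)
        _ ≤ _ := hK.lintegral_le_of_dist_le (hab k) (hl k) fun y hy => (hdist k hkD y hy).2
  have hvcol' : ∀ k, (∑' j, v j k) ^ q ≤ (ENNReal.ofReal (8 * A) * l) ^ q * ρ k := by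
    intro k
    refine (ENNReal.rpow_le_rpow (hvcol k) (by linarith)).trans ?_
    rw [ENNReal.mul_rpow_of_nonneg _ _ (by linarith)]
    refine mul_le_mul' le_rfl ?_
    have h1 : 0 < b k - a k := by linarith [hab k]
    have h6 : 6 * (b k - a k) ≤ |x - a k| := by
      by_contra hc
      have := abs_lt.1 (not_le.1 hc)
      exact hx k ⟨by linarith, by linarith⟩
    have h2 : 0 < |x - a k| := by linarith
    have hle : (b k - a k) / |x - a k| ≤ 1 := by rw [div_le_one h2]; linarith
    rw [ENNReal.ofReal_rpow_of_pos (by positivity)]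
    exact ENNReal.ofReal_le_ofReal
      (Real.rpow_le_rpow_of_exponent_ge (by positivity) hle (by linarith))
  have hrow : ∀ j, ∃ F : Finset κ, F.card ≤ 6 ∧ ∀ k ∉ F, v j k = 0 := by
    intro j
    obtain ⟨F, hF, hF'⟩ := exists_finset_card_le_of_disjoint hdis
      {z - t j, z + t j, z - t (j + 1), z + t (j + 1), c - 2 * (d - c), d + 2 * (d - c)}
    refine ⟨F, hF.trans Finset.card_le_six, fun k hk => ?_⟩
    simp only [v]
    split_ifs with hkP
    · rfl
    · have : P j ∩ I k = ∅ := by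
        by_contra hne
        obtain ⟨y, hyP, hyI⟩ := Set.nonempty_iff_ne_empty.2 hne
        exact hkP fun w hw => mem_annulus_sdiff_dilate_iff hyI hw (hF' k hk) hyP
      simp [this]
  have hvsum : lqNorm q (fun j => ∑' k, v j k) ≤
      6 * (ENNReal.ofReal (8 * A) * l) * (∑' k, ρ k) ^ (1 / q) := by
    have hq0 : 0 < q := by linarith
    calc lqNorm q (fun j => ∑' k, v j k)
        ≤ ((6 : ℝ≥0∞) ^ q * ((ENNReal.ofReal (8 * A) * l) ^ q * ∑' k, ρ k)) ^ (1 / q) := by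
          refine ENNReal.rpow_le_rpow ?_ (by positivity)
          refine (ENNReal.tsum_rpow_tsum_le_of_card_le v hq1 6 hrow).trans ?_
          have hle := ENNReal.tsum_le_tsum hvcol'
          rw [ENNReal.tsum_mul_left] at hle
          exact mul_le_mul' le_rfl hle
      _ = _ := by
          rw [ENNReal.mul_rpow_of_nonneg _ _ (by positivity),
            ENNReal.mul_rpow_of_nonneg _ _ (by positivity), ← ENNReal.rpow_mul, ← ENNReal.rpow_mul,
            mul_one_div_cancel hq0.ne', ENNReal.rpow_one, ENNReal.rpow_one]
          ring
  calc _ ≤ lqNorm q (fun j => (∑' k, S j k) + ∑' k, v j k) := lqNorm_mono hq1 hstep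
    _ ≤ _ := lqNorm_add_le hq1 _ _
    _ ≤ (∑' k, s k) + 6 * (ENNReal.ofReal (8 * A) * l) * (∑' k, ρ k) ^ (1 / q) :=
        add_le_add hSsum hvsum
    _ = _ := by
        rw [ENNReal.tsum_mul_left]; ring

end KernelBounds

theorem doublingOnIntervals_volume : DoublingOnIntervals volume := by
  refine ⟨5, fun a b hab => ?_⟩
  rw [Real.volume_Icc, Real.volume_Ioo, show ((5 : ℝ≥0) : ℝ≥0∞) = ENNReal.ofReal 5 by simp,
    ← ENNReal.ofReal_mul (by norm_num)]
  exact ENNReal.ofReal_le_ofReal (by linarith)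

theorem ae_le_maxFn_volume {φ : ℝ → ℝ≥0∞} (hφ : AEMeasurable φ) (hfin : ∫⁻ x, φ x ≠ ∞) :
    ∀ᵐ x, φ x ≤ maxFn volume φ x := by
  filter_upwards [(Besicovitch.vitaliFamily (volume : Measure ℝ)).ae_tendsto_lintegral_div hφ hfin]
    with x hx
  refine le_of_tendsto (hx.comp (Besicovitch.tendsto_filterAt volume x)) ?_
  filter_upwards [self_mem_nhdsWithin] with r hr
  have hr' : 0 < r := hr
  simp only [Function.comp]
  rw [Real.closedBall_eq_Icc, ← setLIntegral_congr Ioo_ae_eq_Icc, ← measure_congr Ioo_ae_eq_Icc]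
  exact average_le_maxFn volume φ ⟨by linarith, by linarith⟩

theorem lintegral_gap_le {φ : ℝ → ℝ≥0∞} {l : ℝ≥0} {c : ℝ × ℝ}
    (hc : c ∈ gaps {x | l < maxFn volume φ x}) :
    ∫⁻ y in Set.Ioo c.1 c.2, φ y ≤ l * ENNReal.ofReal (c.2 - c.1) := by
  have hlim : Tendsto (fun ε : ℝ => (l : ℝ≥0∞) * ENNReal.ofReal (c.2 - (c.1 - ε))) (𝓝[>] 0)
      (𝓝 (l * ENNReal.ofReal (c.2 - c.1))) := by
    refine ENNReal.Tendsto.const_mul ?_ (Or.inr ENNReal.coe_ne_top)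
    refine (ENNReal.continuous_ofReal.tendsto _).comp ?_
    have : Continuous fun ε : ℝ => c.2 - (c.1 - ε) := by fun_prop
    simpa using (this.tendsto 0).mono_left nhdsWithin_le_nhds
  refine ge_of_tendsto hlim ?_
  filter_upwards [self_mem_nhdsWithin] with ε hε
  have hε' : 0 < ε := hε
  have hmem : c.1 ∈ Set.Ioo (c.1 - ε) c.2 := ⟨by linarith, hc.1⟩
  calc ∫⁻ y in Set.Ioo c.1 c.2, φ y ≤ ∫⁻ y in Set.Ioo (c.1 - ε) c.2, φ y :=
        lintegral_mono_set (Set.Ioo_subset_Ioo_left (by linarith))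
    _ ≤ maxFn volume φ c.1 * volume (Set.Ioo (c.1 - ε) c.2) := lintegral_le_maxFn_mul _ _ hmem
    _ ≤ _ := by
      rw [Real.volume_Ioo]
      exact mul_le_mul' (not_lt.1 hc.2.2.1) le_rfl

section Decomposition

open Classical in
/-- The good part of the Calderón–Zygmund decomposition of `f`: on each gap of `Ω` the function
is replaced by its average. -/
def goodPart (Ω : Set ℝ) (f : ℝ → ℂ) (y : ℝ) : ℂ :=
  if h : ∃ c ∈ gaps Ω, y ∈ Set.Ioo c.1 c.2 then
    ⨍ u in Set.Ioo h.choose.1 h.choose.2, f u else f y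

variable {Ω : Set ℝ} {f : ℝ → ℂ}

theorem goodPart_of_mem {c : ℝ × ℝ} (hc : c ∈ gaps Ω) {y : ℝ} (hy : y ∈ Set.Ioo c.1 c.2) :
    goodPart Ω f y = ⨍ u in Set.Ioo c.1 c.2, f u := by
  have h : ∃ c ∈ gaps Ω, y ∈ Set.Ioo c.1 c.2 := ⟨c, hc, hy⟩
  have e : h.choose = c := by
    by_contra hne
    exact Set.disjoint_left.1 (gaps_pairwiseDisjoint Ω h.choose_spec.1 hc hne) h.choose_spec.2 hy
  rw [goodPart, dif_pos h, e]

theorem goodPart_of_notMem {y : ℝ} (hy : y ∉ Ω) : goodPart Ω f y = f y := by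
  rw [goodPart, dif_neg]
  rintro ⟨c, hc, h⟩
  exact hy (hc.2.1 h)

theorem pairwise_disjoint_gaps (Ω : Set ℝ) :
    Pairwise (Function.onFun Disjoint fun c : gaps Ω => Set.Ioo c.1.1 c.1.2) := fun c c' hne =>
  gaps_pairwiseDisjoint Ω c.2 c'.2 fun h => hne (Subtype.ext h)

instance countable_gaps (Ω : Set ℝ) : Countable (gaps Ω) := (gaps_countable Ω).to_subtype

variable (hΩ : IsOpen Ω) (hfin : volume Ω ≠ ∞)
include hΩ hfin

theorem tsum_gaps : ∑' c : gaps Ω, ENNReal.ofReal (c.1.2 - c.1.1) = volume Ω := by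
  conv_rhs => rw [← biUnion_gaps hΩ hfin, measure_iUnion (pairwise_disjoint_gaps Ω)
    fun _ => measurableSet_Ioo]
  simp only [Real.volume_Ioo]

theorem aestronglyMeasurable_goodPart (hf : AEStronglyMeasurable f) :
    AEStronglyMeasurable (goodPart Ω f) := by
  rw [← Measure.restrict_univ (μ := (volume : Measure ℝ)), ← Set.union_compl_self Ω,
    aestronglyMeasurable_union_iff]
  constructor
  · rw [← biUnion_gaps hΩ hfin, aestronglyMeasurable_iUnion_iff]
    intro c
    refine (aestronglyMeasurable_const (b := ⨍ u in Set.Ioo c.1.1 c.1.2, f u)).congr ?_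
    filter_upwards [ae_restrict_mem measurableSet_Ioo] with y hy
    rw [biUnion_gaps hΩ hfin, goodPart_of_mem c.2 hy]
  · refine hf.restrict.congr ?_
    filter_upwards [ae_restrict_mem hΩ.measurableSet.compl] with y hy
    rw [goodPart_of_notMem hy]

omit hΩ hfin in
theorem lintegral_goodPart_gap_le {c : ℝ × ℝ} (hc : c ∈ gaps Ω) :
    ∫⁻ y in Set.Ioo c.1 c.2, ‖goodPart Ω f y‖ₑ ≤ ∫⁻ y in Set.Ioo c.1 c.2, ‖f y‖ₑ := by
  have h0 : volume (Set.Ioo c.1 c.2) ≠ 0 := by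
    rw [Real.volume_Ioo]; simpa using hc.1
  have hne : volume (Set.Ioo c.1 c.2) ≠ ∞ := measure_Ioo_lt_top.ne
  calc ∫⁻ y in Set.Ioo c.1 c.2, ‖goodPart Ω f y‖ₑ
      = ∫⁻ y in Set.Ioo c.1 c.2, ‖⨍ u in Set.Ioo c.1 c.2, f u‖ₑ :=
        setLIntegral_congr_fun measurableSet_Ioo fun y hy => by
          simp only [goodPart_of_mem hc hy]
    _ = ‖⨍ u in Set.Ioo c.1 c.2, f u‖ₑ * volume (Set.Ioo c.1 c.2) := setLIntegral_const _ _
    _ = ‖∫ u in Set.Ioo c.1 c.2, f u‖ₑ := by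
        rw [setAverage_eq, enorm_smul, Measure.real, Real.enorm_of_nonneg (by positivity),
          ENNReal.ofReal_inv_of_pos (ENNReal.toReal_pos h0 hne), ENNReal.ofReal_toReal hne,
          mul_right_comm, ENNReal.inv_mul_cancel h0 hne, one_mul]
    _ ≤ _ := enorm_integral_le_lintegral_enorm _

theorem lintegral_goodPart_le : ∫⁻ y, ‖goodPart Ω f y‖ₑ ≤ ∫⁻ y, ‖f y‖ₑ := by
  rw [← lintegral_add_compl _ hΩ.measurableSet, ← lintegral_add_compl (fun y => ‖f y‖ₑ)
    hΩ.measurableSet]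
  refine add_le_add ?_ (le_of_eq (setLIntegral_congr_fun hΩ.measurableSet.compl fun y hy => by
    simp only [goodPart_of_notMem hy]))
  have e : ∀ φ : ℝ → ℝ≥0∞, ∫⁻ y in Ω, φ y = ∑' c : gaps Ω, ∫⁻ y in Set.Ioo c.1.1 c.1.2, φ y := by
    intro φ
    conv_lhs => rw [← biUnion_gaps hΩ hfin]
    exact lintegral_iUnion (fun _ => measurableSet_Ioo) (pairwise_disjoint_gaps Ω) _
  rw [e, e]
  exact ENNReal.tsum_le_tsum fun c => lintegral_goodPart_gap_le c.2

theorem integrable_goodPart (hf : Integrable f) : Integrable (goodPart Ω f) :=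
  ⟨aestronglyMeasurable_goodPart hΩ hfin hf.1, (lintegral_goodPart_le hΩ hfin).trans_lt hf.2⟩

omit hΩ hfin in
theorem integral_sub_goodPart_gap {c : ℝ × ℝ} (hc : c ∈ gaps Ω) :
    ∫ y in Set.Ioo c.1 c.2, (f - goodPart Ω f) y = 0 := by
  have e : ∫ y in Set.Ioo c.1 c.2, (f - goodPart Ω f) y =
      ∫ y in Set.Ioo c.1 c.2, (f y - ⨍ u in Set.Ioo c.1 c.2, f u) :=
    setIntegral_congr_fun measurableSet_Ioo fun y hy => by
      simp only [Pi.sub_apply, goodPart_of_mem hc hy]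
  have : IsFiniteMeasure (volume.restrict (Set.Ioo c.1 c.2)) :=
    ⟨by simp [Real.volume_Ioo]⟩
  rw [e]
  exact integral_sub_average _ _

omit hΩ hfin in
theorem lintegral_sub_goodPart_gap_le (hf : Integrable f) {l : ℝ≥0} {c : ℝ × ℝ}
    (hc : c ∈ gaps {x | l < maxFn volume (fun y => ‖f y‖ₑ) x}) :
    ∫⁻ y in Set.Ioo c.1 c.2, ‖(f - goodPart {x | l < maxFn volume (fun y => ‖f y‖ₑ) x} f) y‖ₑ ≤
      2 * l * ENNReal.ofReal (c.2 - c.1) := by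
  calc _ ≤ ∫⁻ y in Set.Ioo c.1 c.2, (‖f y‖ₑ +
        ‖goodPart {x | l < maxFn volume (fun y => ‖f y‖ₑ) x} f y‖ₑ) :=
        lintegral_mono fun y => enorm_sub_le
    _ = (∫⁻ y in Set.Ioo c.1 c.2, ‖f y‖ₑ) + ∫⁻ y in Set.Ioo c.1 c.2,
        ‖goodPart {x | l < maxFn volume (fun y => ‖f y‖ₑ) x} f y‖ₑ :=
        lintegral_add_left' hf.1.enorm.restrict _
    _ ≤ l * ENNReal.ofReal (c.2 - c.1) + l * ENNReal.ofReal (c.2 - c.1) :=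
        add_le_add (lintegral_gap_le hc)
          ((lintegral_goodPart_gap_le hc).trans (lintegral_gap_le hc))
    _ = _ := by ring

omit hΩ hfin in
theorem ae_enorm_goodPart_le (hf : Integrable f) (l : ℝ≥0)
    (hfin : volume {x | l < maxFn volume (fun y => ‖f y‖ₑ) x} ≠ ∞) :
    ∀ᵐ y, ‖goodPart {x | l < maxFn volume (fun y => ‖f y‖ₑ) x} f y‖ₑ ≤ l := by
  filter_upwards [ae_le_maxFn_volume hf.1.enorm hf.2.ne] with y hy
  by_cases h : ∃ c ∈ gaps {x | l < maxFn volume (fun y => ‖f y‖ₑ) x}, y ∈ Set.Ioo c.1 c.2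
  · obtain ⟨c, hc, hyc⟩ := h
    have h0 : volume (Set.Ioo c.1 c.2) ≠ 0 := by
      rw [Real.volume_Ioo]; simpa using hc.1
    have hne : volume (Set.Ioo c.1 c.2) ≠ ∞ := measure_Ioo_lt_top.ne
    have h1 := (lintegral_goodPart_gap_le (f := f) hc).trans (lintegral_gap_le hc)
    rw [setLIntegral_congr_fun (g := fun _ =>
      ‖goodPart {x | l < maxFn volume (fun y => ‖f y‖ₑ) x} f y‖ₑ) measurableSet_Ioo
      (fun z hz => by simp only [goodPart_of_mem hc hz, goodPart_of_mem hc hyc]),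
      setLIntegral_const, ← Real.volume_Ioo] at h1
    exact (ENNReal.mul_le_mul_iff_left h0 hne).1 h1
  · by_cases hyΩ : y ∈ {x | l < maxFn volume (fun y => ‖f y‖ₑ) x}
    · exact absurd (exists_mem_gaps (isOpen_lt_maxFn _ _ _) hfin hyΩ) h
    · rw [goodPart_of_notMem hyΩ]
      exact hy.trans (not_lt.1 hyΩ)

end Decomposition

theorem tsum_measure_dilate_gaps_le {Ω : Set ℝ} (hΩ : IsOpen Ω) (hfin : volume Ω ≠ ∞) :
    volume (⋃ c : gaps Ω, Set.Ioo (c.1.1 - 6 * (c.1.2 - c.1.1)) (c.1.2 + 6 * (c.1.2 - c.1.1))) ≤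
      13 * volume Ω := by
  refine (measure_iUnion_le _).trans ?_
  rw [← tsum_gaps hΩ hfin, ← ENNReal.tsum_mul_left]
  refine ENNReal.tsum_le_tsum fun c => ?_
  rw [Real.volume_Ioo, show (13 : ℝ≥0∞) = ENNReal.ofReal 13 by simp,
    ← ENNReal.ofReal_mul (by norm_num)]
  exact ENNReal.ofReal_le_ofReal (by linarith)

theorem lintegral_ratio_rpow_le {a b δ : ℝ} (hδ : 0 < δ) (hab : a < b) :
    ∫⁻ x in (Set.Ioo (a - 6 * (b - a)) (b + 6 * (b - a)))ᶜ,
      ENNReal.ofReal (((b - a) / |x - a|) ^ (1 + δ)) ≤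
      ENNReal.ofReal (2 / δ) * ENNReal.ofReal (b - a) := by
  have hba : 0 < b - a := by linarith
  have hsub : (Set.Ioo (a - 6 * (b - a)) (b + 6 * (b - a)))ᶜ ⊆ {x | b - a < |x - a|} := by
    intro x hx
    by_contra hc
    have := abs_le.1 (not_lt.1 (show ¬ (b - a < |x - a|) from hc))
    exact hx ⟨by linarith, by linarith⟩
  calc _ ≤ ∫⁻ x in {x | b - a < |x - a|}, ENNReal.ofReal (((b - a) / |x - a|) ^ (1 + δ)) :=
        lintegral_mono_set hsub
    _ = ∫⁻ x in {x | b - a < |x - a|}, ENNReal.ofReal ((b - a) ^ (1 + δ)) *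
        ENNReal.ofReal (|x - a| ^ (-(1 + δ))) := by
        congr 1; ext x
        rw [← ENNReal.ofReal_mul (by positivity), Real.div_rpow hba.le (abs_nonneg _),
          Real.rpow_neg (abs_nonneg _), div_eq_mul_inv]
    _ ≤ ENNReal.ofReal ((b - a) ^ (1 + δ)) *
        ENNReal.ofReal (2 / (1 + δ - 1) * (b - a) ^ (1 - (1 + δ))) := by
        rw [lintegral_const_mul' _ _ ENNReal.ofReal_ne_top]
        exact mul_le_mul' le_rfl (lintegral_rpow_tail_le a hba (by linarith))
    _ = _ := by
        rw [← ENNReal.ofReal_mul (by positivity), ← ENNReal.ofReal_mul (by positivity)]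
        congr 1
        rw [show 1 + δ - 1 = δ by ring, show 1 - (1 + δ) = -δ by ring, Real.rpow_neg hba.le,
          Real.rpow_add hba, Real.rpow_one]
        have : 0 < (b - a) ^ δ := by positivity
        field_simp

theorem memLp_of_integrable_of_ae_le {g : ℝ → ℂ} (hg : Integrable g) {l : ℝ≥0}
    (hl : ∀ᵐ y, ‖g y‖ₑ ≤ l) {p : ℝ} (hp : 1 < p) :
    MemLp g (ENNReal.ofReal p) ∧
      ∫⁻ y, ‖g y‖ₑ ^ p ≤ (l : ℝ≥0∞) ^ (p - 1) * ∫⁻ y, ‖g y‖ₑ := by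
  have hle : ∫⁻ y, ‖g y‖ₑ ^ p ≤ (l : ℝ≥0∞) ^ (p - 1) * ∫⁻ y, ‖g y‖ₑ := by
    rw [← lintegral_const_mul' _ _ (ENNReal.rpow_ne_top_of_nonneg (by linarith) ENNReal.coe_ne_top)]
    refine lintegral_mono_ae ?_
    filter_upwards [hl] with y hy
    calc ‖g y‖ₑ ^ p = ‖g y‖ₑ ^ (p - 1) * ‖g y‖ₑ := by
          conv_rhs => rw [← ENNReal.rpow_one ‖g y‖ₑ, ← ENNReal.rpow_mul,
            ← ENNReal.rpow_add_of_nonneg _ _ (by linarith) (by norm_num)]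
          congr 1; ring
      _ ≤ _ := mul_le_mul' (ENNReal.rpow_le_rpow hy (by linarith)) le_rfl
  refine ⟨⟨hg.1, ?_⟩, hle⟩
  rw [eLpNorm_lt_top_iff_lintegral_rpow_enorm_lt_top (by simp; linarith) ENNReal.ofReal_ne_top,
    ENNReal.toReal_ofReal (by linarith)]
  exact hle.trans_lt (ENNReal.mul_lt_top
    (ENNReal.rpow_lt_top_of_nonneg (by linarith) ENNReal.coe_ne_top) hg.2)

namespace KernelBounds

variable {K : ℝ → ℝ → ℂ} {δ A : ℝ} (hK : KernelBounds K δ A) {q : ℝ}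
include hK

/-- Unweighted weak type `(1, 1)` of the grand maximal truncation. -/
theorem exists_grandMax_weak (hq : 2 ≤ q) {p₀ : ℝ} (hp₀ : 1 < p₀)
    (hbdd : ∃ C : ℝ≥0, ∀ f : ℝ → ℂ, MemLp f (ENNReal.ofReal p₀) volume →
      ∫⁻ x, varOp q K f x ^ p₀ ≤ C * ∫⁻ x, ‖f x‖ₑ ^ p₀) :
    ∃ C : ℝ≥0, ∀ f : ℝ → ℂ, Integrable f → ∀ l : ℝ≥0,
      l * volume {x | l < grandMax q K f x} ≤ C * ∫⁻ y, ‖f y‖ₑ := by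
  obtain ⟨C₀, hC₀⟩ := hbdd
  obtain ⟨C₁, hC₁⟩ := doublingOnIntervals_volume.exists_maxFn_weak
  obtain ⟨C₄, hC₄⟩ := hK.exists_grandMax_le_of_bounded (q := q) (by linarith)
  have hq1 : 1 ≤ q := by linarith
  have hδ := hK.exponent_pos
  set D : ℝ≥0 := 1 + C₄ + (8 * A).toNNReal * 7 with hD
  have hD0 : D ≠ 0 := by positivity
  have main : ∀ f : ℝ → ℂ, Integrable f → ∀ l : ℝ≥0, l ≠ 0 →
      l * volume {x | D * l < grandMax q K f x} ≤
        (13 * C₁ + C₀ + (2 / δ).toNNReal * C₁ : ℝ≥0) * ∫⁻ y, ‖f y‖ₑ := by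
    intro f hf l hl
    set Ω := {x | l < maxFn volume (fun y => ‖f y‖ₑ) x}
    have hl0 : (l : ℝ≥0∞) ≠ 0 := by simpa using hl
    have hΩ : IsOpen Ω := isOpen_lt_maxFn _ _ _
    have hΩv : l * volume Ω ≤ C₁ * ∫⁻ y, ‖f y‖ₑ := hC₁ _ _
    have hfin : volume Ω ≠ ∞ := by
      intro h
      rw [h, ENNReal.mul_top hl0, top_le_iff] at hΩv
      exact (ENNReal.mul_lt_top ENNReal.coe_lt_top hf.2).ne hΩv
    set g := goodPart Ω f with hg
    have hgi : Integrable g := integrable_goodPart hΩ hfin hf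
    have hgl : ∀ᵐ y, ‖g y‖ₑ ≤ l := ae_enorm_goodPart_le hf l hfin
    have hbi : Integrable (f - g) := hf.sub hgi
    set W := ⋃ c : gaps Ω, Set.Ioo (c.1.1 - 6 * (c.1.2 - c.1.1)) (c.1.2 + 6 * (c.1.2 - c.1.1))
      with hW
    set R : ℝ → ℝ≥0∞ := fun x => ∑' c : gaps Ω,
      ENNReal.ofReal (((c.1.2 - c.1.1) / |x - c.1.1|) ^ (1 + δ)) with hR
    have hRm : Measurable R := by
      refine Measurable.tsum fun c => ?_
      fun_prop
    have hsub : {x | (D * l : ℝ≥0∞) < grandMax q K f x} ⊆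
        W ∪ ({x | l < varOp q K g x} ∪ ({x | 1 < R x} ∩ Wᶜ)) := by
      intro x hx
      by_contra hc
      simp only [Set.mem_union, Set.mem_inter_iff, not_or, Set.mem_ofPred_eq, not_lt, not_and_or,
        Set.mem_compl_iff, not_not] at hc
      obtain ⟨hxW, hVx, hRx⟩ := hc
      have hRx : R x ≤ 1 := hRx.resolve_right hxW
      have hb := hK.grandMax_le_of_cancel hq (κ := gaps Ω) (a := fun c => c.1.1)
        (b := fun c => c.1.2) (fun c => c.2.1) (pairwise_disjoint_gaps Ω) hbi
        (fun y hy => by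
          have : y ∉ Ω := by
            intro h
            rw [← biUnion_gaps hΩ hfin] at h
            obtain ⟨c, hc⟩ := Set.mem_iUnion.1 h
            exact hy c hc
          rw [Pi.sub_apply, hg, goodPart_of_notMem this, sub_self])
        (fun c => integral_sub_goodPart_gap c.2)
        (l := l) (fun c => lintegral_sub_goodPart_gap_le hf c.2) (x := x)
        (fun c hxc => hxW (Set.mem_iUnion.2 ⟨c, hxc⟩))
      have hb' : grandMax q K (f - g) x ≤ ENNReal.ofReal (8 * A) * l * (1 + 6 * 1) := by
        refine hb.trans (mul_le_mul' le_rfl (add_le_add hRx (mul_le_mul' le_rfl ?_)))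
        exact ENNReal.rpow_le_one hRx (by positivity)
      have hG := grandMax_add_le hq1 (hK.truncConverges hgi) (hK.truncConverges hbi) x
      rw [add_sub_cancel] at hG
      have hx' : (D * l : ℝ≥0∞) < grandMax q K f x := hx
      refine absurd hx' (not_lt.2 (hG.trans ?_))
      calc grandMax q K g x + grandMax q K (f - g) x
          ≤ (l + C₄ * l) + ENNReal.ofReal (8 * A) * l * (1 + 6 * 1) :=
            add_le_add ((hC₄ g hgi l hgl x).trans (add_le_add hVx le_rfl)) hb'
        _ = D * l := by
          rw [hD, ENNReal.ofReal]; push_cast; ring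
    have h1 : l * volume W ≤ 13 * C₁ * ∫⁻ y, ‖f y‖ₑ := by
      calc l * volume W ≤ l * (13 * volume Ω) :=
            mul_le_mul' le_rfl (tsum_measure_dilate_gaps_le hΩ hfin)
        _ = 13 * (l * volume Ω) := by ring
        _ ≤ 13 * (C₁ * ∫⁻ y, ‖f y‖ₑ) := mul_le_mul' le_rfl hΩv
        _ = _ := by ring
    have h2 : l * volume {x | l < varOp q K g x} ≤ C₀ * ∫⁻ y, ‖f y‖ₑ := by
      obtain ⟨hgp, hgle⟩ := memLp_of_integrable_of_ae_le hgi hgl hp₀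
      have hlp0 : (l : ℝ≥0∞) ^ (p₀ - 1) ≠ 0 := by simp [hl]
      have hlpt : (l : ℝ≥0∞) ^ (p₀ - 1) ≠ ∞ := by simp [hl]
      have hch : (l : ℝ≥0∞) ^ p₀ * volume {x | l < varOp q K g x} ≤
          C₀ * ((l : ℝ≥0∞) ^ (p₀ - 1) * ∫⁻ y, ‖f y‖ₑ) := by
        calc (l : ℝ≥0∞) ^ p₀ * volume {x | l < varOp q K g x}
            ≤ (l : ℝ≥0∞) ^ p₀ * volume {x | (l : ℝ≥0∞) ^ p₀ ≤ varOp q K g x ^ p₀} := by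
              refine mul_le_mul' le_rfl (measure_mono fun x hx => ?_)
              exact ENNReal.rpow_le_rpow (le_of_lt hx) (by linarith)
          _ ≤ ∫⁻ x, varOp q K g x ^ p₀ :=
              mul_meas_ge_le_lintegral ((hK.measurable_varOp hgi hq1).pow_const p₀) _
          _ ≤ C₀ * ∫⁻ x, ‖g x‖ₑ ^ p₀ := hC₀ g hgp
          _ ≤ _ := mul_le_mul' le_rfl
              (hgle.trans (mul_le_mul' le_rfl (lintegral_goodPart_le hΩ hfin)))
      have hlp : (l : ℝ≥0∞) ^ p₀ = (l : ℝ≥0∞) ^ (p₀ - 1) * l := by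
        conv_rhs => rw [← ENNReal.rpow_one (l : ℝ≥0∞), ← ENNReal.rpow_mul,
          ← ENNReal.rpow_add_of_nonneg _ _ (by linarith) (by norm_num)]
        congr 1; ring
      rw [hlp, mul_assoc, mul_left_comm (C₀ : ℝ≥0∞)] at hch
      exact (ENNReal.mul_le_mul_iff_right hlp0 hlpt).1 hch
    have h3 : l * volume ({x | 1 < R x} ∩ Wᶜ) ≤ (2 / δ).toNNReal * C₁ * ∫⁻ y, ‖f y‖ₑ := by
      have hR1 : volume ({x | 1 < R x} ∩ Wᶜ) ≤ ENNReal.ofReal (2 / δ) * volume Ω := by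
        calc volume ({x | 1 < R x} ∩ Wᶜ)
            ≤ (1 : ℝ≥0∞) * (volume.restrict Wᶜ) {x | 1 ≤ R x} := by
              rw [one_mul, Measure.restrict_apply (measurableSet_le measurable_const hRm)]
              exact measure_mono (Set.inter_subset_inter_left _
                fun x (hx : 1 < R x) => show 1 ≤ R x from hx.le)
          _ ≤ ∫⁻ x in Wᶜ, R x := mul_meas_ge_le_lintegral hRm 1
          _ = ∑' c : gaps Ω, ∫⁻ x in Wᶜ,
              ENNReal.ofReal (((c.1.2 - c.1.1) / |x - c.1.1|) ^ (1 + δ)) := by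
              rw [lintegral_tsum fun c => by fun_prop]
          _ ≤ ∑' c : gaps Ω, ENNReal.ofReal (2 / δ) * ENNReal.ofReal (c.1.2 - c.1.1) := by
              refine ENNReal.tsum_le_tsum fun c => ?_
              refine (lintegral_mono_set ?_).trans (lintegral_ratio_rpow_le hδ c.2.1)
              exact Set.compl_subset_compl.2 (Set.subset_iUnion (fun c : gaps Ω =>
                Set.Ioo (c.1.1 - 6 * (c.1.2 - c.1.1)) (c.1.2 + 6 * (c.1.2 - c.1.1))) c)
          _ = _ := by rw [ENNReal.tsum_mul_left, tsum_gaps hΩ hfin]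
      calc l * volume ({x | 1 < R x} ∩ Wᶜ) ≤ l * (ENNReal.ofReal (2 / δ) * volume Ω) :=
            mul_le_mul' le_rfl hR1
        _ = ENNReal.ofReal (2 / δ) * (l * volume Ω) := by ring
        _ ≤ ENNReal.ofReal (2 / δ) * (C₁ * ∫⁻ y, ‖f y‖ₑ) := mul_le_mul' le_rfl hΩv
        _ = _ := by rw [ENNReal.ofReal]; ring
    calc l * volume {x | (D * l : ℝ≥0∞) < grandMax q K f x}
        ≤ l * (volume W + (volume {x | l < varOp q K g x} + volume ({x | 1 < R x} ∩ Wᶜ))) :=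
          mul_le_mul' le_rfl ((measure_mono hsub).trans ((measure_union_le _ _).trans
            (add_le_add le_rfl (measure_union_le _ _))))
      _ = l * volume W + (l * volume {x | l < varOp q K g x} +
          l * volume ({x | 1 < R x} ∩ Wᶜ)) := by ring
      _ ≤ 13 * C₁ * (∫⁻ y, ‖f y‖ₑ) + (C₀ * (∫⁻ y, ‖f y‖ₑ) +
          (2 / δ).toNNReal * C₁ * ∫⁻ y, ‖f y‖ₑ) := add_le_add h1 (add_le_add h2 h3)
      _ = _ := by push_cast; ring
  refine ⟨D * (13 * C₁ + C₀ + (2 / δ).toNNReal * C₁), fun f hf l => ?_⟩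
  rcases eq_or_ne l 0 with rfl | hl
  · simp
  have h := main f hf (l / D) (div_ne_zero hl hD0)
  have e : (D : ℝ≥0∞) * ((l / D : ℝ≥0) : ℝ≥0∞) = l := by
    rw [← ENNReal.coe_mul, mul_div_cancel₀ _ hD0]
  rw [e] at h
  calc (l : ℝ≥0∞) * volume {x | l < grandMax q K f x}
      = D * (((l / D : ℝ≥0) : ℝ≥0∞) * volume {x | l < grandMax q K f x}) := by
        rw [← mul_assoc, e]
    _ ≤ D * ((13 * C₁ + C₀ + (2 / δ).toNNReal * C₁ : ℝ≥0) * ∫⁻ y, ‖f y‖ₑ) := mul_le_mul' le_rfl h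
    _ = _ := by rw [ENNReal.coe_mul D]; ring

end KernelBounds

/-- The comparison `μ(I) |E| ^ p ≤ C |I| ^ p μ(E)` for measurable subsets `E` of intervals `I`. -/
def MuckenhouptBound (μ : Measure ℝ) (p : ℝ) : Prop :=
  ∃ C : ℝ≥0, ∀ a b : ℝ, a < b → ∀ E ⊆ Set.Icc a b, MeasurableSet E →
    μ (Set.Icc a b) * volume E ^ p ≤ C * ENNReal.ofReal (b - a) ^ p * μ E

theorem MuckenhouptBound.doublingOnIntervals {μ : Measure ℝ} {p : ℝ} (hp : 0 < p)
    (h : MuckenhouptBound μ p) : DoublingOnIntervals μ := by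
  obtain ⟨C, hC⟩ := h
  refine ⟨C * 5 ^ p, fun a b hab => ?_⟩
  have h1 := hC (a - 2 * (b - a)) (b + 2 * (b - a)) (by linarith) (Set.Ioo a b)
    (fun y hy => ⟨by linarith [hy.1], by linarith [hy.2]⟩) measurableSet_Ioo
  rw [Real.volume_Ioo, show b + 2 * (b - a) - (a - 2 * (b - a)) = 5 * (b - a) by ring,
    ENNReal.ofReal_mul (by norm_num), ENNReal.mul_rpow_of_nonneg _ _ hp.le] at h1
  have h0 : ENNReal.ofReal (b - a) ^ p ≠ 0 := by simp [hab, hp]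
  have ht : ENNReal.ofReal (b - a) ^ p ≠ ∞ := by simp [hp.le]
  rw [← ENNReal.mul_le_mul_iff_left h0 ht]
  refine h1.trans (le_of_eq ?_)
  rw [ENNReal.coe_mul, ENNReal.coe_rpow_of_nonneg _ hp.le]
  simp only [ENNReal.ofReal_ofNat, ENNReal.coe_ofNat]
  ring

/-- A subset of at most half the length of an interval misses a fixed part of its `μ` measure. -/
theorem MuckenhouptBound.exists_measure_le {μ : Measure ℝ} [IsLocallyFiniteMeasure μ] {p : ℝ}
    (hp : 0 < p) (h : MuckenhouptBound μ p) : ∃ θ : ℝ≥0, θ < 1 ∧ ∀ a b : ℝ, a < b →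
      ∀ E ⊆ Set.Ioo a b, MeasurableSet E → 2 * volume E ≤ ENNReal.ofReal (b - a) →
        μ E ≤ θ * μ (Set.Ioo a b) := by
  obtain ⟨C, hC⟩ := h
  set κ : ℝ≥0 := (2 ^ p * (C + 1))⁻¹ with hκ
  have h2p : (1 : ℝ≥0) ≤ 2 ^ p := NNReal.one_le_rpow (by norm_num) hp.le
  have hκ1 : κ ≤ 1 := inv_le_one_of_one_le₀ (one_le_mul h2p (by simp))
  have hκ0 : 0 < κ := by positivity
  refine ⟨1 - κ, tsub_lt_self one_pos hκ0, fun a b hab E hE hEm hvol => ?_⟩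
  have hfin : μ (Set.Ioo a b) ≠ ∞ := measure_Ioo_lt_top.ne
  have hsplit : μ E + μ (Set.Ioo a b \ E) = μ (Set.Ioo a b) := by
    rw [← measure_union Set.disjoint_sdiff_right (measurableSet_Ioo.diff hEm),
      Set.union_sdiff_cancel hE]
  have hvsplit : volume E + volume (Set.Ioo a b \ E) = ENNReal.ofReal (b - a) := by
    rw [← measure_union Set.disjoint_sdiff_right (measurableSet_Ioo.diff hEm),
      Set.union_sdiff_cancel hE, Real.volume_Ioo]
  have hEfin : volume E ≠ ∞ := ((measure_mono hE).trans_lt measure_Ioo_lt_top).ne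
  have hhalf : ENNReal.ofReal (b - a) ≤ 2 * volume (Set.Ioo a b \ E) := by
    have h3 : volume E ≤ volume (Set.Ioo a b \ E) := by
      rw [← hvsplit, two_mul] at hvol
      exact (ENNReal.add_le_add_iff_left hEfin).1 hvol
    rw [← hvsplit, two_mul]
    exact add_le_add h3 le_rfl
  have h1 := hC a b hab (Set.Ioo a b \ E) (Set.sdiff_subset.trans Set.Ioo_subset_Icc_self)
    (measurableSet_Ioo.diff hEm)
  have h0 : ENNReal.ofReal (b - a) ^ p ≠ 0 := by simp [hab, hp]
  have ht : ENNReal.ofReal (b - a) ^ p ≠ ∞ := by simp [hp.le]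
  have h2 : μ (Set.Ioo a b) ≤ (2 ^ p * (C + 1) : ℝ≥0) * μ (Set.Ioo a b \ E) := by
    rw [← ENNReal.mul_le_mul_iff_left h0 ht]
    calc μ (Set.Ioo a b) * ENNReal.ofReal (b - a) ^ p
        ≤ μ (Set.Icc a b) * (2 * volume (Set.Ioo a b \ E)) ^ p :=
          mul_le_mul' (measure_mono Set.Ioo_subset_Icc_self) (ENNReal.rpow_le_rpow hhalf hp.le)
      _ = 2 ^ p * (μ (Set.Icc a b) * volume (Set.Ioo a b \ E) ^ p) := by
          rw [ENNReal.mul_rpow_of_nonneg _ _ hp.le]; ring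
      _ ≤ 2 ^ p * ((C + 1) * ENNReal.ofReal (b - a) ^ p * μ (Set.Ioo a b \ E)) := by
          refine mul_le_mul' le_rfl (h1.trans (mul_le_mul' (mul_le_mul' ?_ le_rfl) le_rfl))
          exact le_self_add
      _ = _ := by
          rw [ENNReal.coe_mul, ENNReal.coe_rpow_of_nonneg _ hp.le]; push_cast; ring
  have h4 : κ * μ (Set.Ioo a b) ≤ μ (Set.Ioo a b \ E) := by
    calc κ * μ (Set.Ioo a b) ≤ κ * ((2 ^ p * (C + 1) : ℝ≥0) * μ (Set.Ioo a b \ E)) :=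
          mul_le_mul' le_rfl h2
      _ = _ := by
        rw [← mul_assoc, ← ENNReal.coe_mul, hκ, inv_mul_cancel₀ (by positivity), ENNReal.coe_one,
          one_mul]
  have h5 : μ E + κ * μ (Set.Ioo a b) ≤ (1 - κ : ℝ≥0) * μ (Set.Ioo a b) + κ * μ (Set.Ioo a b) := by
    rw [← add_mul, ← ENNReal.coe_add, tsub_add_cancel_of_le hκ1, ENNReal.coe_one, one_mul, ← hsplit]
    exact add_le_add le_rfl (by rw [hsplit]; exact h4)
  exact (ENNReal.add_le_add_iff_right (ENNReal.mul_ne_top ENNReal.coe_ne_top hfin)).1 h5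

namespace KernelBounds

variable {K : ℝ → ℝ → ℂ} {δ A : ℝ} (hK : KernelBounds K δ A) {q : ℝ}
include hK

/-- Localization of the grand maximal truncation to a gap of one of its superlevel sets. -/
theorem lt_grandMax_indicator (hq : 1 ≤ q) {f : ℝ → ℂ} (hf : Integrable f) {l β : ℝ≥0}
    (hβ : 1 < β) {c : ℝ × ℝ} (hc : c ∈ gaps {x | l < grandMax q K f x}) {x : ℝ}
    (hx : x ∈ Set.Ioo c.1 c.2) (hGx : (β * l : ℝ≥0) < grandMax q K f x) :
    ((β - 1) * l : ℝ≥0) <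
      grandMax q K ((dilate (c.1 - (c.2 - c.1)) c.2).indicator f) x := by
  obtain ⟨a, b, z, hxab, hz, hV⟩ := lt_grandMax_iff.1 hGx
  have hc12 := hc.1
  have hsub : Set.Ioo a b ⊆ {x | l < grandMax q K f x} := fun w hw => by
    have h1 : ((β * l : ℝ≥0) : ℝ≥0∞) < grandMax q K f w := lt_grandMax_iff.2 ⟨a, b, z, hw, hz, hV⟩
    refine lt_of_le_of_lt ?_ h1
    exact_mod_cast le_mul_of_one_le_left (by positivity) hβ.le
  obtain ⟨ha, hb⟩ := mem_gaps_of_Ioo_subset hc hsub hxab hx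
  set J := dilate (c.1 - (c.2 - c.1)) c.2
  have hJm : MeasurableSet J := measurableSet_dilate _ _
  have hDm : MeasurableSet (dilate a b)ᶜ := (measurableSet_dilate a b).compl
  have hDJ : dilate a b ⊆ J := by
    rintro y ⟨h1, h2⟩
    exact ⟨by linarith [hxab.1, hxab.2], by linarith [hxab.1, hxab.2]⟩
  have e : (dilate a b)ᶜ.indicator f =
      (dilate a b)ᶜ.indicator (J.indicator f) + Jᶜ.indicator f := by
    ext y
    by_cases h1 : y ∈ dilate a b
    · have h2 : y ∈ J := hDJ h1
      simp [h1, h2]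
    · by_cases h2 : y ∈ J <;> simp [h1, h2]
  have h1 : varOp q K (Jᶜ.indicator f) z ≤ l := by
    have h2 : varOp q K (Jᶜ.indicator f) z ≤ grandMax q K f c.1 :=
      le_grandMax (a := c.1 - (c.2 - c.1)) (b := c.2) ⟨by linarith, hc12⟩
        ⟨by linarith [hz.1], by linarith [hz.2]⟩
    exact h2.trans (not_lt.1 hc.2.2.1)
  have h2 : ((β * l : ℝ≥0) : ℝ≥0∞) < grandMax q K (J.indicator f) x + l := by
    refine hV.trans_le ?_
    rw [e]
    refine (varOp_add_le hq ((hK.truncConverges (hf.indicator hJm) z).indicator hDm)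
      ((hK.truncConverges hf z).indicator hJm.compl)).trans
      (add_le_add (le_grandMax hxab hz) h1)
  have h3 : ((β * l : ℝ≥0) : ℝ≥0∞) = ((β - 1) * l : ℝ≥0) + l := by
    rw [← ENNReal.coe_add]
    congr 1
    rw [tsub_mul, one_mul, tsub_add_cancel_of_le (le_mul_of_one_le_left (by positivity) hβ.le)]
  rw [h3] at h2
  exact lt_of_add_lt_add_right h2

/-- A good-`λ` inequality between the grand maximal truncation and the maximal function. -/
theorem exists_good_lambda (hq : 2 ≤ q) {p₀ : ℝ} (hp₀ : 1 < p₀)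
    (hbdd : ∃ C : ℝ≥0, ∀ f : ℝ → ℂ, MemLp f (ENNReal.ofReal p₀) volume →
      ∫⁻ x, varOp q K f x ^ p₀ ≤ C * ∫⁻ x, ‖f x‖ₑ ^ p₀)
    {μ : Measure ℝ} [IsLocallyFiniteMeasure μ] {p : ℝ} (hp : 0 < p) (hμ : MuckenhouptBound μ p) :
    ∃ θ : ℝ≥0, θ < 1 ∧ ∀ β : ℝ≥0, 1 < β → ∃ γ : ℝ≥0, 0 < γ ∧ ∀ f : ℝ → ℂ, Integrable f →
      ∀ l : ℝ≥0, 0 < l → μ {x | (β * l : ℝ≥0) < grandMax q K f x} ≤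
        θ * μ {x | l < grandMax q K f x} +
          μ {x | (γ * l : ℝ≥0) < maxFn volume (fun y => ‖f y‖ₑ) x} := by
  obtain ⟨C, hC⟩ := hK.exists_grandMax_weak hq hp₀ hbdd
  obtain ⟨θ, hθ, hθ'⟩ := hμ.exists_measure_le hp
  refine ⟨θ, hθ, fun β hβ => ?_⟩
  have hβ1 : 0 < β - 1 := tsub_pos_of_lt hβ
  refine ⟨(β - 1) / (24 * (C + 1)), by positivity, fun f hf l hl => ?_⟩
  set γ := (β - 1) / (24 * (C + 1)) with hγ
  set Ω := {x | l < grandMax q K f x} with hΩdef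
  have hΩ : IsOpen Ω := isOpen_lt_grandMax _
  have hl0 : (l : ℝ≥0∞) ≠ 0 := by simpa using hl.ne'
  have hfin : volume Ω ≠ ∞ := by
    intro h
    have h1 := hC f hf l
    rw [← hΩdef, h, ENNReal.mul_top hl0, top_le_iff] at h1
    exact (ENNReal.mul_lt_top ENNReal.coe_lt_top hf.2).ne h1
  set E : gaps Ω → Set ℝ := fun c => Set.Ioo c.1.1 c.1.2 ∩
    ({x | (β * l : ℝ≥0) < grandMax q K f x} ∩
      {x | (γ * l : ℝ≥0) < maxFn volume (fun y => ‖f y‖ₑ) x}ᶜ) with hE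
  have hEm : ∀ c, MeasurableSet (E c) := fun c => measurableSet_Ioo.inter
    ((isOpen_lt_grandMax _).measurableSet.inter (isOpen_lt_maxFn _ _ _).measurableSet.compl)
  have hEvol : ∀ c : gaps Ω, 2 * volume (E c) ≤ ENNReal.ofReal (c.1.2 - c.1.1) := by
    rintro ⟨c, hc⟩
    rcases (E ⟨c, hc⟩).eq_empty_or_nonempty with h | ⟨x, hx⟩
    · rw [h]; simp
    have hc12 : 0 < c.2 - c.1 := by linarith [hc.1]
    set J := dilate (c.1 - (c.2 - c.1)) c.2
    have hJm : MeasurableSet J := measurableSet_dilate _ _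
    have hJint : ∫⁻ y, ‖J.indicator f y‖ₑ ≤
        (γ * l : ℝ≥0) * ENNReal.ofReal (12 * (c.2 - c.1)) := by
      calc ∫⁻ y, ‖J.indicator f y‖ₑ = ∫⁻ y in J, ‖f y‖ₑ := by
            rw [← lintegral_indicator hJm]
            congr 1; ext y
            exact enorm_indicator_eq_indicator_enorm _ _
        _ ≤ ∫⁻ y in Set.Ioo (c.1 - 6 * (c.2 - c.1)) (c.2 + 5 * (c.2 - c.1)), ‖f y‖ₑ :=
            lintegral_mono_set fun y hy => ⟨by linarith [hy.1], by linarith [hy.2]⟩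
        _ ≤ maxFn volume (fun y => ‖f y‖ₑ) x *
            volume (Set.Ioo (c.1 - 6 * (c.2 - c.1)) (c.2 + 5 * (c.2 - c.1))) :=
            lintegral_le_maxFn_mul _ _ ⟨by linarith [hx.1.1], by linarith [hx.1.2]⟩
        _ ≤ _ := by
            rw [Real.volume_Ioo]
            refine mul_le_mul' (not_lt.1 hx.2.2) (ENNReal.ofReal_le_ofReal (by linarith))
    have hsub : E ⟨c, hc⟩ ⊆ {x | ((β - 1) * l : ℝ≥0) < grandMax q K (J.indicator f) x} :=
      fun w hw => hK.lt_grandMax_indicator (by linarith) hf hβ hc hw.1 hw.2.1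
    have hw := hC (J.indicator f) (hf.indicator hJm) ((β - 1) * l)
    have hne : ((β - 1) * l : ℝ≥0) ≠ 0 := by positivity
    have hne' : (((β - 1) * l : ℝ≥0) : ℝ≥0∞) ≠ 0 := ENNReal.coe_ne_zero.2 hne
    rw [← ENNReal.mul_le_mul_iff_right hne' ENNReal.coe_ne_top]
    have hcoef : 2 * (C * (γ * l)) * 12 ≤ (β - 1) * l := by
      calc 2 * (C * (γ * l)) * 12 = 24 * C * γ * l := by ring
        _ ≤ 24 * (C + 1) * γ * l := by gcongr; exact le_self_add
        _ = _ := by rw [hγ]; field_simp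
    calc (((β - 1) * l : ℝ≥0) : ℝ≥0∞) * (2 * volume (E ⟨c, hc⟩))
        ≤ 2 * ((((β - 1) * l : ℝ≥0) : ℝ≥0∞) *
          volume {x | ((β - 1) * l : ℝ≥0) < grandMax q K (J.indicator f) x}) := by
          rw [mul_left_comm]
          exact mul_le_mul' le_rfl (mul_le_mul' le_rfl (measure_mono hsub))
      _ ≤ 2 * (C * ((γ * l : ℝ≥0) * ENNReal.ofReal (12 * (c.2 - c.1)))) :=
          mul_le_mul' le_rfl (hw.trans (mul_le_mul' le_rfl hJint))
      _ = (2 * (C * (γ * l)) * 12 : ℝ≥0) * ENNReal.ofReal (c.2 - c.1) := by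
          rw [ENNReal.ofReal_mul (by norm_num)]
          push_cast
          simp only [ENNReal.ofReal_ofNat]
          ring
      _ ≤ _ := mul_le_mul' (by exact_mod_cast hcoef) le_rfl
  have hcover : {x | (β * l : ℝ≥0) < grandMax q K f x} ⊆
      (⋃ c, E c) ∪ {x | (γ * l : ℝ≥0) < maxFn volume (fun y => ‖f y‖ₑ) x} := by
    intro x hx
    by_cases hM : x ∈ {x | (γ * l : ℝ≥0) < maxFn volume (fun y => ‖f y‖ₑ) x}
    · exact Or.inr hM
    · left
      have hxΩ : x ∈ Ω := by
        have hx' : ((β * l : ℝ≥0) : ℝ≥0∞) < grandMax q K f x := hx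
        refine lt_of_le_of_lt ?_ hx'
        exact_mod_cast le_mul_of_one_le_left (by positivity) hβ.le
      obtain ⟨c, hc, hxc⟩ := exists_mem_gaps hΩ hfin hxΩ
      exact Set.mem_iUnion.2 ⟨⟨c, hc⟩, hxc, hx, hM⟩
  refine (measure_mono hcover).trans ((measure_union_le _ _).trans (add_le_add ?_ le_rfl))
  calc μ (⋃ c, E c) ≤ ∑' c, μ (E c) := measure_iUnion_le _
    _ ≤ ∑' c : gaps Ω, θ * μ (Set.Ioo c.1.1 c.1.2) := ENNReal.tsum_le_tsum fun c =>
        hθ' _ _ c.2.1 _ Set.inter_subset_left (hEm c) (hEvol c)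
    _ = θ * μ Ω := by
        rw [ENNReal.tsum_mul_left]
        conv_rhs => rw [← biUnion_gaps hΩ hfin, measure_iUnion (pairwise_disjoint_gaps Ω)
          fun _ => measurableSet_Ioo]

end KernelBounds

theorem ENNReal.le_tsum_of_recursion {θ : ℝ≥0} (hθ : θ < 1) {X Y : ℤ → ℝ≥0∞} {B : ℝ≥0∞}
    (hB : B ≠ ∞) (hX : ∀ k ≤ 0, X k ≤ B) (h : ∀ k, X (k + 1) ≤ θ * X k + Y k) (k : ℤ) :
    X k ≤ ∑' i : ℕ, (θ : ℝ≥0∞) ^ i * Y (k - 1 - i) := by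
  have hfin : ∀ n : ℕ, X k ≤ (θ : ℝ≥0∞) ^ n * X (k - n) +
      ∑ i ∈ Finset.range n, (θ : ℝ≥0∞) ^ i * Y (k - 1 - i) := by
    intro n
    induction n with
    | zero => simp
    | succ n ih =>
      refine ih.trans ?_
      have h1 := h (k - (n + 1 : ℕ))
      rw [show k - ((n + 1 : ℕ) : ℤ) + 1 = k - n by push_cast; ring] at h1
      rw [Finset.sum_range_succ]
      calc _ ≤ (θ : ℝ≥0∞) ^ n * (θ * X (k - (n + 1 : ℕ)) + Y (k - (n + 1 : ℕ))) +
            ∑ i ∈ Finset.range n, (θ : ℝ≥0∞) ^ i * Y (k - 1 - i) := by gcongr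
        _ = _ := by
          rw [show k - ((n + 1 : ℕ) : ℤ) = k - 1 - n by push_cast; ring]
          ring
  have hlim : Tendsto (fun n : ℕ => (θ : ℝ≥0∞) ^ n * B +
      ∑' i : ℕ, (θ : ℝ≥0∞) ^ i * Y (k - 1 - i)) atTop
      (𝓝 (0 * B + ∑' i : ℕ, (θ : ℝ≥0∞) ^ i * Y (k - 1 - i))) := by
    refine Tendsto.add (ENNReal.Tendsto.mul_const ?_ (Or.inr hB)) tendsto_const_nhds
    exact ENNReal.tendsto_pow_atTop_nhds_zero_of_lt_one (by exact_mod_cast hθ)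
  rw [zero_mul, zero_add] at hlim
  refine ge_of_tendsto hlim ?_
  filter_upwards [eventually_ge_atTop k.toNat] with n hn
  exact (hfin n).trans (add_le_add (mul_le_mul' le_rfl (hX _ (by omega))) (ENNReal.sum_le_tsum _))

theorem MuckenhouptBound.exists_measure_Icc_le {μ : Measure ℝ} {p : ℝ}
    (h : MuckenhouptBound μ p) : ∃ C : ℝ≥0, ∀ L : ℝ, 0 < L → ∀ ε : ℝ, 0 < ε → ε ≤ 1 →
      ENNReal.ofReal (ε ^ p) * μ (Set.Icc (-(L / ε)) (L / ε)) ≤ C * μ (Set.Icc (-L) L) := by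
  obtain ⟨C, hC⟩ := h
  refine ⟨C, fun L hL ε hε hε1 => ?_⟩
  have hLε : L ≤ L / ε := by rw [le_div_iff₀ hε]; nlinarith
  have h1 := hC (-(L / ε)) (L / ε) (by linarith) (Set.Icc (-L) L)
    (Set.Icc_subset_Icc (by linarith) hLε) measurableSet_Icc
  rw [Real.volume_Icc, ENNReal.ofReal_rpow_of_pos (by linarith),
    ENNReal.ofReal_rpow_of_pos (by linarith)] at h1
  have h0 : ENNReal.ofReal ((L / ε - -(L / ε)) ^ p) ≠ 0 := by
    have : 0 < (L / ε - -(L / ε)) ^ p := Real.rpow_pos_of_pos (by linarith) _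
    simpa using this
  rw [← ENNReal.mul_le_mul_iff_right h0 ENNReal.ofReal_ne_top]
  calc _ = μ (Set.Icc (-(L / ε)) (L / ε)) * ENNReal.ofReal ((L - -L) ^ p) := by
        rw [← mul_assoc, ← ENNReal.ofReal_mul (Real.rpow_nonneg (by linarith) _), mul_comm,
          ← Real.mul_rpow (by linarith) hε.le]
        congr 3; field_simp
    _ ≤ _ := h1.trans (le_of_eq (by ring))

namespace KernelBounds

variable {K : ℝ → ℝ → ℂ} {δ A : ℝ} (hK : KernelBounds K δ A) {q : ℝ}
include hK

theorem grandMax_le_of_support (hq : 1 ≤ q) {f : ℝ → ℂ} (hf : Integrable f) {r : ℝ}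
    (hr : ∀ y, r < |y| → f y = 0) {x : ℝ} (hx : 2 * r < |x|) (hx0 : 0 < |x|) :
    grandMax q K f x ≤ ENNReal.ofReal (4 * A / |x|) * ∫⁻ y, ‖f y‖ₑ := by
  refine grandMax_le fun a b z hxab hz => ?_
  have hm := (measurableSet_dilate a b).compl
  refine (varOp_le_lintegral hq (hK.truncConverges (hf.indicator hm) z)).trans ?_
  rw [← lintegral_const_mul' _ _ ENNReal.ofReal_ne_top]
  refine lintegral_mono fun y => ?_
  by_cases hy : y ∈ dilate a b
  · simp [hy]
  by_cases hyr : r < |y|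
  · rw [Set.indicator_of_mem (by exact hy), hr y hyr]; simp
  rw [Set.indicator_of_mem (by exact hy), enorm_mul]
  refine mul_le_mul' ?_ le_rfl
  have h1 : 2 * (b - a) ≤ |z - y| := by
    by_contra hc
    have := abs_lt.1 (not_le.1 hc)
    exact hy ⟨by linarith [hz.1], by linarith [hz.2]⟩
  have h2 : |x - z| ≤ b - a := abs_le.2 ⟨by linarith [hxab.1, hz.2], by linarith [hxab.2, hz.1]⟩
  have h3 := abs_sub_le x z y
  have h4 : |x| - |y| ≤ |x - y| := abs_sub_abs_le_abs_sub x y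
  have h5 : |x| / 4 ≤ |z - y| := by
    have := abs_nonneg (z - y)
    linarith [not_lt.1 hyr, abs_nonneg (x - z)]
  refine (hK.enorm_le (by positivity) h5).trans (le_of_eq ?_)
  congr 1; field_simp

theorem exists_measure_lt_grandMax_le (hq : 1 ≤ q) {μ : Measure ℝ} [IsLocallyFiniteMeasure μ]
    {p : ℝ} (hμ : MuckenhouptBound μ p) {f : ℝ → ℂ} (hf : Integrable f) {r : ℝ}
    (hr : ∀ y, r < |y| → f y = 0) : ∃ B : ℝ≥0∞, B ≠ ∞ ∧ ∀ ε : ℝ, 0 < ε → ε ≤ 1 →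
      ENNReal.ofReal (ε ^ p) * μ {x | ENNReal.ofReal ε < grandMax q K f x} ≤ B := by
  obtain ⟨C, hC⟩ := hμ.exists_measure_Icc_le
  have hA := hK.const_pos
  set N := (∫⁻ y, ‖f y‖ₑ).toReal
  have hNe : ENNReal.ofReal N = ∫⁻ y, ‖f y‖ₑ := ENNReal.ofReal_toReal hf.2.ne
  set L := 2 * |r| + 4 * A * N + 1
  have hL0 : 0 < L := by positivity
  refine ⟨C * μ (Set.Icc (-L) L), ENNReal.mul_ne_top ENNReal.coe_ne_top
    isCompact_Icc.measure_lt_top.ne, fun ε hε hε1 => ?_⟩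
  refine le_trans (mul_le_mul' le_rfl (measure_mono fun x hx => ?_)) (hC L hL0 ε hε hε1)
  by_contra hc
  have hxL : L / ε < |x| := by
    by_contra h
    have := abs_le.1 (not_lt.1 h)
    exact hc ⟨this.1, this.2⟩
  have hx0 : 0 < |x| := lt_trans (by positivity) hxL
  have hLε : L ≤ L / ε := by rw [le_div_iff₀ hε]; nlinarith
  have h1 := hK.grandMax_le_of_support hq hf hr (x := x)
    (by have : 0 ≤ 4 * A * N := by positivity
        linarith [le_abs_self r]) hx0
  have hx' : ENNReal.ofReal ε < grandMax q K f x := hx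
  refine absurd hx' (not_lt.2 (h1.trans ?_))
  rw [← hNe, ← ENNReal.ofReal_mul (by positivity)]
  refine ENNReal.ofReal_le_ofReal ?_
  rw [div_mul_eq_mul_div, div_le_iff₀ hx0]
  rw [div_lt_iff₀ hε] at hxL
  linarith [abs_nonneg r]

theorem exists_tsum_bound (hq : 2 ≤ q) {p₀ : ℝ} (hp₀ : 1 < p₀)
    (hbdd : ∃ C : ℝ≥0, ∀ f : ℝ → ℂ, MemLp f (ENNReal.ofReal p₀) volume →
      ∫⁻ x, varOp q K f x ^ p₀ ≤ C * ∫⁻ x, ‖f x‖ₑ ^ p₀)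
    {μ : Measure ℝ} [IsLocallyFiniteMeasure μ] {p : ℝ} (hp : 0 < p) (hμ : MuckenhouptBound μ p) :
    ∃ β : ℝ, 1 < β ∧ ∃ γ : ℝ, 0 < γ ∧ ∃ θ : ℝ≥0, θ < 1 ∧ ∃ D : ℝ≥0, ∀ f : ℝ → ℂ, Integrable f →
      (∃ r, ∀ y, r < |y| → f y = 0) → ∀ k : ℤ,
      ENNReal.ofReal ((β ^ k) ^ p) * μ {x | ENNReal.ofReal (β ^ k) < grandMax q K f x} ≤
        D * ∑' i : ℕ, (θ : ℝ≥0∞) ^ i * (ENNReal.ofReal ((β ^ (k - 1 - i)) ^ p) *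
          μ {x | ENNReal.ofReal (γ * β ^ (k - 1 - i)) <
            maxFn volume (fun y => ‖f y‖ₑ) x}) := by
  obtain ⟨θ, hθ, hgood⟩ := hK.exists_good_lambda hq hp₀ hbdd hp hμ
  obtain ⟨β, hβ, hθβ⟩ : ∃ β : ℝ≥0, 1 < β ∧ θ * β ^ p < 1 := by
    have hc : Continuous fun β : ℝ≥0 => θ * β ^ p :=
      continuous_const.mul (NNReal.continuous_rpow_const hp.le)
    have h1 : ∀ᶠ β in 𝓝 (1 : ℝ≥0), θ * β ^ p < 1 :=
      (hc.tendsto 1).eventually (gt_mem_nhds (by simpa using hθ))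
    have h2 : ∀ᶠ β in 𝓝[>] (1 : ℝ≥0), θ * β ^ p < 1 := h1.filter_mono nhdsWithin_le_nhds
    obtain ⟨β, hβ1, hβ2⟩ := (h2.and self_mem_nhdsWithin).exists
    exact ⟨β, hβ2, hβ1⟩
  obtain ⟨γ, hγ, hgood⟩ := hgood β hβ
  have hβ0 : (0 : ℝ) < β := by positivity
  have hβ1 : (1 : ℝ) < β := by exact_mod_cast hβ
  refine ⟨β, hβ1, γ, by positivity, θ * β ^ p, hθβ, β ^ p, ?_⟩
  rintro f hf ⟨r, hr⟩ k
  obtain ⟨B, hB, hBf⟩ := hK.exists_measure_lt_grandMax_le (q := q) (by linarith) hμ hf hr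
  have hcoe : ∀ (c : ℝ≥0) (k : ℤ), ENNReal.ofReal (c * (β : ℝ) ^ k) =
      ((c * β ^ k : ℝ≥0) : ℝ≥0∞) := by
    intro c k
    rw [← ENNReal.ofReal_coe_nnreal]; push_cast; rfl
  have hcoe1 : ∀ k : ℤ, ENNReal.ofReal ((β : ℝ) ^ k) = ((β ^ k : ℝ≥0) : ℝ≥0∞) := by
    intro k
    rw [← ENNReal.ofReal_coe_nnreal]; push_cast; rfl
  have hpow : ∀ k : ℤ, ENNReal.ofReal (((β : ℝ) ^ (k + 1)) ^ p) =
      (β ^ p : ℝ≥0) * ENNReal.ofReal (((β : ℝ) ^ k) ^ p) := by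
    intro k
    rw [← ENNReal.ofReal_coe_nnreal, ← ENNReal.ofReal_mul (by positivity)]
    congr 1
    rw [zpow_add_one₀ hβ0.ne', mul_comm, Real.mul_rpow hβ0.le (by positivity)]
    rfl
  have hrec := ENNReal.le_tsum_of_recursion hθβ
    (X := fun k => ENNReal.ofReal (((β : ℝ) ^ k) ^ p) *
      μ {x | ENNReal.ofReal ((β : ℝ) ^ k) < grandMax q K f x})
    (Y := fun k => (β ^ p : ℝ≥0) * (ENNReal.ofReal (((β : ℝ) ^ k) ^ p) *
      μ {x | ENNReal.ofReal (γ * (β : ℝ) ^ k) < maxFn volume (fun y => ‖f y‖ₑ) x}))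
    hB (fun k hk => hBf _ (by positivity) (zpow_le_one_of_nonpos₀ hβ1.le hk)) (fun k => ?_) k
  · refine hrec.trans (le_of_eq ?_)
    rw [← ENNReal.tsum_mul_left]
    congr 1; ext i
    ring
  · have h1 := hgood f hf (β ^ k) (by positivity)
    have h2 : ENNReal.ofReal ((β : ℝ) ^ (k + 1)) = ((β * β ^ k : ℝ≥0) : ℝ≥0∞) := by
      rw [hcoe1, zpow_add_one₀ (by positivity), mul_comm]
    simp only [h2, hcoe, hcoe1, hpow]
    calc _ ≤ (β ^ p : ℝ≥0) * ENNReal.ofReal (((β : ℝ) ^ k) ^ p) *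
          (θ * μ {x | ((β ^ k : ℝ≥0) : ℝ≥0∞) < grandMax q K f x} +
          μ {x | ((γ * β ^ k : ℝ≥0) : ℝ≥0∞) < maxFn volume (fun y => ‖f y‖ₑ) x}) :=
          mul_le_mul' le_rfl h1
      _ = _ := by rw [ENNReal.coe_mul θ]; ring

/-- For compactly supported functions, the grand maximal truncation is controlled in `L^p(μ)` by
the maximal function. -/
theorem exists_lintegral_grandMax_le (hq : 2 ≤ q) {p₀ : ℝ} (hp₀ : 1 < p₀)
    (hbdd : ∃ C : ℝ≥0, ∀ f : ℝ → ℂ, MemLp f (ENNReal.ofReal p₀) volume →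
      ∫⁻ x, varOp q K f x ^ p₀ ≤ C * ∫⁻ x, ‖f x‖ₑ ^ p₀)
    {μ : Measure ℝ} [IsLocallyFiniteMeasure μ] {p : ℝ} (hp : 0 < p) (hμ : MuckenhouptBound μ p) :
    ∃ C : ℝ≥0, ∀ f : ℝ → ℂ, Integrable f → (∃ r, ∀ y, r < |y| → f y = 0) →
      ∫⁻ x, grandMax q K f x ^ p ∂μ ≤ C * ∫⁻ x, maxFn volume (fun y => ‖f y‖ₑ) x ^ p ∂μ := by
  obtain ⟨β, hβ, γ, hγ, θ, hθ, D, hD⟩ := hK.exists_tsum_bound hq hp₀ hbdd hp hμ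
  obtain ⟨C, hC⟩ := exists_tsum_measure_le_lintegral_rpow (α := ℝ) hβ hp
  have hgeo : ∑' i : ℕ, (θ : ℝ≥0∞) ^ i ≠ ∞ := by
    rw [ENNReal.tsum_geometric]
    refine ENNReal.inv_ne_top.2 ?_
    rw [Ne, tsub_eq_zero_iff_le, not_le]
    exact_mod_cast hθ
  refine ⟨(β ^ p).toNNReal * (D * ((∑' i : ℕ, (θ : ℝ≥0∞) ^ i).toNNReal *
    (C * (γ⁻¹ ^ p).toNNReal))), fun f hf hr => ?_⟩
  set M := maxFn volume (fun y => ‖f y‖ₑ)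
  set Y : ℤ → ℝ≥0∞ := fun k => ENNReal.ofReal ((β ^ k) ^ p) *
    μ {x | ENNReal.ofReal (γ * β ^ k) < M x} with hY
  have hYsum : ∑' k, Y k ≤ C * (ENNReal.ofReal (γ⁻¹ ^ p) * ∫⁻ x, M x ^ p ∂μ) := by
    have h1 := hC μ (fun x => ENNReal.ofReal γ⁻¹ * M x)
      ((measurable_maxFn _ _).const_mul _)
    have h2 : ∀ k : ℤ, {x | ENNReal.ofReal (β ^ k) < ENNReal.ofReal γ⁻¹ * M x} =
        {x | ENNReal.ofReal (γ * β ^ k) < M x} := by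
      intro k
      ext x
      simp only [Set.mem_ofPred_eq]
      rw [ENNReal.ofReal_inv_of_pos hγ, mul_comm _ (M x), ← div_eq_mul_inv,
        ENNReal.lt_div_iff_mul_lt (Or.inl (by simpa using hγ)) (Or.inl ENNReal.ofReal_ne_top),
        mul_comm γ, ENNReal.ofReal_mul (by positivity)]
    simp only [h2] at h1
    refine h1.trans (mul_le_mul' le_rfl (le_of_eq ?_))
    rw [← lintegral_const_mul' _ _ ENNReal.ofReal_ne_top]
    congr 1; ext x
    rw [ENNReal.mul_rpow_of_nonneg _ _ hp.le, ENNReal.ofReal_rpow_of_pos (by positivity)]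
  calc ∫⁻ x, grandMax q K f x ^ p ∂μ
      ≤ ENNReal.ofReal (β ^ p) * ∑' k : ℤ, ENNReal.ofReal ((β ^ k) ^ p) *
        μ {x | ENNReal.ofReal (β ^ k) < grandMax q K f x} :=
        lintegral_rpow_le_tsum_measure hβ hp μ measurable_grandMax
    _ ≤ ENNReal.ofReal (β ^ p) * ∑' k : ℤ, D * ∑' i : ℕ, (θ : ℝ≥0∞) ^ i * Y (k - 1 - i) :=
        mul_le_mul' le_rfl (ENNReal.tsum_le_tsum fun k => hD f hf hr k)
    _ = ENNReal.ofReal (β ^ p) * (D * ((∑' i : ℕ, (θ : ℝ≥0∞) ^ i) * ∑' k, Y k)) := by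
        rw [ENNReal.tsum_mul_left, ENNReal.tsum_comm]
        congr 2
        rw [← ENNReal.tsum_mul_right]
        congr 1; ext i
        rw [ENNReal.tsum_mul_left]
        congr 1
        have := (Equiv.subRight ((1 : ℤ) + i)).tsum_eq Y
        rw [← this]
        congr 1; ext k
        simp [sub_sub]
    _ ≤ ENNReal.ofReal (β ^ p) * (D * ((∑' i : ℕ, (θ : ℝ≥0∞) ^ i) *
        (C * (ENNReal.ofReal (γ⁻¹ ^ p) * ∫⁻ x, M x ^ p ∂μ)))) :=
        mul_le_mul' le_rfl (mul_le_mul' le_rfl (mul_le_mul' le_rfl hYsum))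
    _ = _ := by
        simp only [ENNReal.coe_mul, ENNReal.coe_toNNReal hgeo, ENNReal.ofReal]
        ring

/-- Weak type bounds for the maximal function pass to the grand maximal truncation. -/
theorem exists_measure_grandMax_le (hq : 2 ≤ q) {p₀ : ℝ} (hp₀ : 1 < p₀)
    (hbdd : ∃ C : ℝ≥0, ∀ f : ℝ → ℂ, MemLp f (ENNReal.ofReal p₀) volume →
      ∫⁻ x, varOp q K f x ^ p₀ ≤ C * ∫⁻ x, ‖f x‖ₑ ^ p₀)
    {μ : Measure ℝ} [IsLocallyFiniteMeasure μ] (hμ : MuckenhouptBound μ 1) :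
    ∃ C : ℝ≥0, ∀ f : ℝ → ℂ, Integrable f → (∃ r, ∀ y, r < |y| → f y = 0) → ∀ B : ℝ≥0∞,
      (∀ s : ℝ, 0 < s → ENNReal.ofReal s *
        μ {x | ENNReal.ofReal s < maxFn volume (fun y => ‖f y‖ₑ) x} ≤ B) →
      ∀ l : ℝ, 0 < l → ENNReal.ofReal l * μ {x | ENNReal.ofReal l < grandMax q K f x} ≤ C * B := by
  obtain ⟨β, hβ, γ, hγ, θ, hθ, D, hD⟩ := hK.exists_tsum_bound hq hp₀ hbdd one_pos hμ
  have hgeo : ∑' i : ℕ, (θ : ℝ≥0∞) ^ i ≠ ∞ := by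
    rw [ENNReal.tsum_geometric]
    refine ENNReal.inv_ne_top.2 ?_
    rw [Ne, tsub_eq_zero_iff_le, not_le]
    exact_mod_cast hθ
  have hβ0 : 0 < β := by linarith
  refine ⟨β.toNNReal * (D * ((∑' i : ℕ, (θ : ℝ≥0∞) ^ i).toNNReal * γ⁻¹.toNNReal)),
    fun f hf hr B hB l hl => ?_⟩
  obtain ⟨k, hk1, hk2⟩ := exists_mem_Ico_zpow hl hβ
  simp only [Real.rpow_one] at hD
  have hYB : ∀ k : ℤ, ENNReal.ofReal (β ^ k) *
      μ {x | ENNReal.ofReal (γ * β ^ k) < maxFn volume (fun y => ‖f y‖ₑ) x} ≤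
      ENNReal.ofReal γ⁻¹ * B := by
    intro k
    have e : ENNReal.ofReal (β ^ k) = ENNReal.ofReal γ⁻¹ * ENNReal.ofReal (γ * β ^ k) := by
      rw [← ENNReal.ofReal_mul (by positivity), inv_mul_cancel_left₀ hγ.ne']
    rw [e, mul_assoc]
    exact mul_le_mul' le_rfl (hB _ (by positivity))
  calc ENNReal.ofReal l * μ {x | ENNReal.ofReal l < grandMax q K f x}
      ≤ ENNReal.ofReal (β * β ^ k) * μ {x | ENNReal.ofReal (β ^ k) < grandMax q K f x} := by
        refine mul_le_mul' (ENNReal.ofReal_le_ofReal ?_) (measure_mono fun x hx => ?_)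
        · rw [mul_comm, ← zpow_add_one₀ hβ0.ne']; exact hk2.le
        · exact (ENNReal.ofReal_le_ofReal hk1).trans_lt hx
    _ = ENNReal.ofReal β * (ENNReal.ofReal (β ^ k) *
        μ {x | ENNReal.ofReal (β ^ k) < grandMax q K f x}) := by
        rw [ENNReal.ofReal_mul hβ0.le, mul_assoc]
    _ ≤ ENNReal.ofReal β * (D * ∑' i : ℕ, (θ : ℝ≥0∞) ^ i * (ENNReal.ofReal γ⁻¹ * B)) :=
        mul_le_mul' le_rfl ((hD f hf hr k).trans (mul_le_mul' le_rfl
          (ENNReal.tsum_le_tsum fun i => mul_le_mul' le_rfl (hYB _))))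
    _ = _ := by
        rw [ENNReal.tsum_mul_right]
        simp only [ENNReal.coe_mul, ENNReal.coe_toNNReal hgeo, ENNReal.ofReal]
        ring

end KernelBounds

theorem isLocallyFiniteMeasure_withDensity_of_Icc {u : ℝ → ℝ≥0∞}
    (h : ∀ a b, ∫⁻ x in Set.Icc a b, u x ≠ ∞) : IsLocallyFiniteMeasure (volume.withDensity u) :=
  ⟨fun x => ⟨Set.Icc (x - 1) (x + 1), Icc_mem_nhds (by linarith) (by linarith), by
    rw [withDensity_apply _ measurableSet_Icc]; exact (h _ _).lt_top⟩⟩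

/-- A weight `u` in `A_p`, with values in `[0, ∞]` and not almost everywhere zero, together with its
dual weight `v = u ^ (-1 / (p - 1))`. -/
structure ApPair (p : ℝ) (u v : ℝ → ℝ≥0∞) : Prop where
  one_lt : 1 < p
  measurable_left : Measurable u
  ae_pos : ∀ᵐ x, u x ≠ 0 ∧ u x ≠ ∞
  right_eq : ∀ x, v x = u x ^ (-1 / (p - 1))
  left_fin : ∀ a b, ∫⁻ x in Set.Icc a b, u x ≠ ∞
  right_fin : ∀ a b, ∫⁻ x in Set.Icc a b, v x ≠ ∞
  bound : ∃ C : ℝ≥0, ∀ a b : ℝ, a < b → (∫⁻ x in Set.Icc a b, u x) *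
    (∫⁻ x in Set.Icc a b, v x) ^ (p - 1) ≤ C * ENNReal.ofReal (b - a) ^ p

namespace ApPair

variable {p : ℝ} {u v : ℝ → ℝ≥0∞} (h : ApPair p u v)
include h

theorem measurable_right : Measurable v := by
  rw [funext h.right_eq]
  exact h.measurable_left.pow_const _

theorem ae_pos_right : ∀ᵐ x, v x ≠ 0 ∧ v x ≠ ∞ := by
  filter_upwards [h.ae_pos] with x hx
  rw [h.right_eq]
  exact ⟨(ENNReal.rpow_pos (pos_iff_ne_zero.2 hx.1) hx.2).ne',
    ENNReal.rpow_ne_top_of_ne_zero hx.1 hx.2⟩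

theorem symm : ApPair (p / (p - 1)) v u := by
  have hp := h.one_lt
  have hp1 : 0 < p - 1 := by linarith
  have hp' : p / (p - 1) - 1 = 1 / (p - 1) := by field_simp; ring
  refine ⟨by rw [lt_div_iff₀ hp1]; linarith, h.measurable_right, h.ae_pos_right, fun x => ?_,
    h.right_fin, h.left_fin, ?_⟩
  · rw [h.right_eq, hp', ← ENNReal.rpow_mul, show -1 / (p - 1) * (-1 / (1 / (p - 1))) = 1 by
      field_simp, ENNReal.rpow_one]
  · obtain ⟨C, hC⟩ := h.bound
    refine ⟨C ^ (1 / (p - 1)), fun a b hab => ?_⟩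
    rw [hp']
    have h1 := ENNReal.rpow_le_rpow (hC a b hab) (z := 1 / (p - 1)) (by positivity)
    rw [ENNReal.mul_rpow_of_nonneg _ _ (by positivity), ← ENNReal.rpow_mul,
      mul_one_div_cancel hp1.ne', ENNReal.rpow_one, ENNReal.mul_rpow_of_nonneg _ _ (by positivity),
      ← ENNReal.rpow_mul, mul_one_div] at h1
    rw [mul_comm, ENNReal.coe_rpow_of_nonneg _ (by positivity)]
    exact h1

theorem isLocallyFiniteMeasure : IsLocallyFiniteMeasure (volume.withDensity u) :=
  isLocallyFiniteMeasure_withDensity_of_Icc h.left_fin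

theorem muckenhouptBound : MuckenhouptBound (volume.withDensity u) p := by
  have hp := h.one_lt
  have hp1 : 0 < p - 1 := by linarith
  obtain ⟨C, hC⟩ := h.bound
  refine ⟨C, fun a b hab E hE hEm => ?_⟩
  rw [withDensity_apply _ measurableSet_Icc, withDensity_apply _ hEm]
  have hpq := Real.HolderConjugate.conjExponent hp
  have hH := ENNReal.lintegral_mul_le_Lp_mul_Lq (volume.restrict E) hpq
    (f := fun x => u x ^ (1 / p)) (g := fun x => v x ^ ((p - 1) / p))
    (h.measurable_left.pow_const _).aemeasurable (h.measurable_right.pow_const _).aemeasurable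
  have e1 : ∫⁻ x in E, ((fun x => u x ^ (1 / p)) * fun x => v x ^ ((p - 1) / p)) x = volume E := by
    rw [← setLIntegral_one]
    refine lintegral_congr_ae (ae_restrict_of_ae ?_)
    filter_upwards [h.ae_pos] with x hx
    rw [Pi.mul_apply, h.right_eq, ← ENNReal.rpow_mul, ← ENNReal.rpow_add _ _ hx.1 hx.2]
    rw [show 1 / p + -1 / (p - 1) * ((p - 1) / p) = 0 by field_simp; ring, ENNReal.rpow_zero]
  have e2 : ∀ x, (u x ^ (1 / p)) ^ p = u x := fun x => by
    rw [← ENNReal.rpow_mul, one_div_mul_cancel (by linarith), ENNReal.rpow_one]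
  have e3 : ∀ x, (v x ^ ((p - 1) / p)) ^ p.conjExponent = v x := fun x => by
    rw [← ENNReal.rpow_mul, Real.conjExponent, show (p - 1) / p * (p / (p - 1)) = 1 by field_simp,
      ENNReal.rpow_one]
  rw [e1] at hH
  simp only [e2, e3] at hH
  have h1 : volume E ^ p ≤ (∫⁻ x in E, u x) * (∫⁻ x in Set.Icc a b, v x) ^ (p - 1) := by
    calc volume E ^ p ≤ ((∫⁻ x in E, u x) ^ (1 / p) *
          (∫⁻ x in E, v x) ^ (1 / p.conjExponent)) ^ p := ENNReal.rpow_le_rpow hH (by linarith)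
      _ = (∫⁻ x in E, u x) * (∫⁻ x in E, v x) ^ (p - 1) := by
          rw [ENNReal.mul_rpow_of_nonneg _ _ (by linarith), ← ENNReal.rpow_mul, ← ENNReal.rpow_mul,
            one_div_mul_cancel (by linarith), ENNReal.rpow_one, Real.conjExponent]
          congr 2; field_simp
      _ ≤ _ := mul_le_mul' le_rfl (ENNReal.rpow_le_rpow (lintegral_mono_set hE) hp1.le)
  calc _ ≤ (∫⁻ x in Set.Icc a b, u x) *
        ((∫⁻ x in E, u x) * (∫⁻ x in Set.Icc a b, v x) ^ (p - 1)) := mul_le_mul' le_rfl h1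
    _ = ((∫⁻ x in Set.Icc a b, u x) * (∫⁻ x in Set.Icc a b, v x) ^ (p - 1)) * ∫⁻ x in E, u x := by
        ring
    _ ≤ _ := mul_le_mul' (hC a b hab) le_rfl

theorem doublingOnIntervals : DoublingOnIntervals (volume.withDensity u) :=
  h.muckenhouptBound.doublingOnIntervals (by linarith [h.one_lt])

/-- Muckenhoupt's theorem: the maximal function is bounded on `L^p(u)` for `u` in `A_p`. -/
theorem exists_lintegral_maxFn_le : ∃ C : ℝ≥0, ∀ f : ℝ → ℝ≥0∞, Measurable f →
    ∫⁻ x, maxFn volume f x ^ p ∂(volume.withDensity u) ≤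
      C * ∫⁻ x, f x ^ p ∂(volume.withDensity u) := by
  have hp := h.one_lt
  have hp1 : 0 < p - 1 := by linarith
  have := h.isLocallyFiniteMeasure
  have := h.symm.isLocallyFiniteMeasure
  obtain ⟨C, hC⟩ := h.bound
  obtain ⟨C₁, hC₁⟩ := h.doublingOnIntervals.exists_maxFn_strong h.symm.one_lt
  obtain ⟨C₂, hC₂⟩ := h.symm.doublingOnIntervals.exists_maxFn_strong hp
  set μ := volume.withDensity u with hμ
  set ν := volume.withDensity v with hν
  have hum := h.measurable_left
  have hvm := h.measurable_right
  refine ⟨C ^ (p / (p - 1)) * (C₁ * C₂), fun f hf => ?_⟩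
  set g : ℝ → ℝ≥0∞ := fun x => f x * (v x)⁻¹ with hg
  have hgm : Measurable g := hf.mul hvm.inv
  set F : ℝ → ℝ≥0∞ := fun x => maxFn ν g x ^ (p - 1) * (u x)⁻¹ with hF
  have hFm : Measurable F := ((measurable_maxFn _ _).pow_const _).mul hum.inv
  have hpt : ∀ x, maxFn volume f x ^ p ≤ (C * maxFn μ F x) ^ (p / (p - 1)) := by
    intro x
    have key : maxFn volume f x ≤ (C * maxFn μ F x) ^ (1 / (p - 1)) := by
      refine iSup_le fun a => iSup_le fun b => iSup_le fun hx => ?_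
      have hab : a < b := hx.1.trans hx.2
      have hL0 : volume (Set.Ioo a b) ≠ 0 := by rw [Real.volume_Ioo]; simpa using hab
      have hLt : volume (Set.Ioo a b) ≠ ∞ := measure_Ioo_lt_top.ne
      have hA : μ (Set.Ioo a b) * ν (Set.Ioo a b) ^ (p - 1) ≤ C * volume (Set.Ioo a b) ^ p := by
        rw [Real.volume_Ioo]
        refine le_trans (mul_le_mul' (measure_mono Set.Ioo_subset_Icc_self) (ENNReal.rpow_le_rpow
          (measure_mono Set.Ioo_subset_Icc_self) hp1.le)) (le_trans (le_of_eq ?_) (hC a b hab))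
        rw [hμ, hν, withDensity_apply _ measurableSet_Icc, withDensity_apply _ measurableSet_Icc]
      have e1 : ∫⁻ y in Set.Ioo a b, f y = ∫⁻ y in Set.Ioo a b, g y ∂ν := by
        rw [hν, setLIntegral_withDensity_eq_setLIntegral_mul _ hvm hgm measurableSet_Ioo]
        refine lintegral_congr_ae (ae_restrict_of_ae ?_)
        filter_upwards [h.ae_pos_right] with y hy
        rw [Pi.mul_apply, hg, mul_comm (v y), mul_assoc, ENNReal.inv_mul_cancel hy.1 hy.2, mul_one]
      have e2 : ∫⁻ y in Set.Ioo a b, F y ∂μ = ∫⁻ y in Set.Ioo a b, maxFn ν g y ^ (p - 1) := by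
        rw [hμ, setLIntegral_withDensity_eq_setLIntegral_mul _ hum hFm measurableSet_Ioo]
        refine lintegral_congr_ae (ae_restrict_of_ae ?_)
        filter_upwards [h.ae_pos] with y hy
        rw [Pi.mul_apply, hF, mul_comm (u y), mul_assoc, ENNReal.inv_mul_cancel hy.1 hy.2, mul_one]
      have h1 : (∫⁻ y in Set.Ioo a b, f y) ^ (p - 1) * volume (Set.Ioo a b) ≤
          C * maxFn μ F x * volume (Set.Ioo a b) ^ p := by
        calc (∫⁻ y in Set.Ioo a b, f y) ^ (p - 1) * volume (Set.Ioo a b)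
            = ∫⁻ _ in Set.Ioo a b, (∫⁻ y in Set.Ioo a b, f y) ^ (p - 1) :=
              (setLIntegral_const _ _).symm
          _ ≤ ∫⁻ z in Set.Ioo a b, ν (Set.Ioo a b) ^ (p - 1) * maxFn ν g z ^ (p - 1) := by
              refine setLIntegral_mono' measurableSet_Ioo fun z hz => ?_
              rw [e1, ← ENNReal.mul_rpow_of_nonneg _ _ hp1.le, mul_comm]
              exact ENNReal.rpow_le_rpow (lintegral_le_maxFn_mul _ _ hz) hp1.le
          _ = ν (Set.Ioo a b) ^ (p - 1) * ∫⁻ y in Set.Ioo a b, F y ∂μ := by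
              rw [lintegral_const_mul _ ((measurable_maxFn _ _).pow_const _), e2]
          _ ≤ ν (Set.Ioo a b) ^ (p - 1) * (maxFn μ F x * μ (Set.Ioo a b)) :=
              mul_le_mul' le_rfl (lintegral_le_maxFn_mul _ _ hx)
          _ = maxFn μ F x * (μ (Set.Ioo a b) * ν (Set.Ioo a b) ^ (p - 1)) := by ring
          _ ≤ maxFn μ F x * (C * volume (Set.Ioo a b) ^ p) := mul_le_mul' le_rfl hA
          _ = _ := by ring
      rw [one_div, ENNReal.le_rpow_inv_iff hp1, ENNReal.div_rpow_of_nonneg _ _ hp1.le]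
      refine ENNReal.div_le_of_le_mul ?_
      rw [← ENNReal.mul_le_mul_iff_left hL0 hLt]
      refine h1.trans (le_of_eq ?_)
      have e3 := ENNReal.rpow_add (p - 1) 1 hL0 hLt
      rw [ENNReal.rpow_one, sub_add_cancel] at e3
      rw [e3]
      ring
    refine (ENNReal.rpow_le_rpow key (by linarith)).trans (le_of_eq ?_)
    rw [← ENNReal.rpow_mul]
    congr 1; ring
  have hF' : ∫⁻ x, F x ^ (p / (p - 1)) ∂μ = ∫⁻ x, maxFn ν g x ^ p ∂ν := by
    rw [hμ, hν, lintegral_withDensity_eq_lintegral_mul _ hum (hFm.pow_const _),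
      lintegral_withDensity_eq_lintegral_mul _ hvm ((measurable_maxFn _ _).pow_const _)]
    refine lintegral_congr_ae ?_
    filter_upwards [h.ae_pos] with y hy
    rw [Pi.mul_apply, Pi.mul_apply, hF, ENNReal.mul_rpow_of_nonneg _ _ (by positivity),
      ← ENNReal.rpow_mul, mul_div_cancel₀ _ hp1.ne', h.right_eq, mul_comm, mul_assoc, mul_comm]
    congr 1
    rw [← ENNReal.rpow_neg_one, ← ENNReal.rpow_mul]
    conv_lhs => rw [← ENNReal.rpow_one (u y), ← ENNReal.rpow_mul, ← ENNReal.rpow_add _ _ hy.1 hy.2]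
    congr 1; field_simp; ring
  have hg' : ∫⁻ x, g x ^ p ∂ν = ∫⁻ x, f x ^ p ∂μ := by
    rw [hμ, hν, lintegral_withDensity_eq_lintegral_mul _ hum (hf.pow_const _),
      lintegral_withDensity_eq_lintegral_mul _ hvm (hgm.pow_const _)]
    refine lintegral_congr_ae ?_
    filter_upwards [h.ae_pos] with y hy
    rw [Pi.mul_apply, Pi.mul_apply, hg, ENNReal.mul_rpow_of_nonneg _ _ (by linarith), h.right_eq,
      mul_comm, mul_assoc, mul_comm]
    congr 1
    rw [← ENNReal.rpow_neg_one, ← ENNReal.rpow_mul, ← ENNReal.rpow_mul,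
      ← ENNReal.rpow_add _ _ hy.1 hy.2]
    conv_rhs => rw [← ENNReal.rpow_one (u y)]
    congr 1; field_simp; ring
  have hp'0 : 0 ≤ p / (p - 1) := by positivity
  calc ∫⁻ x, maxFn volume f x ^ p ∂μ ≤ ∫⁻ x, (C * maxFn μ F x) ^ (p / (p - 1)) ∂μ :=
        lintegral_mono hpt
    _ = (C : ℝ≥0∞) ^ (p / (p - 1)) * ∫⁻ x, maxFn μ F x ^ (p / (p - 1)) ∂μ := by
        rw [← lintegral_const_mul _ ((measurable_maxFn _ _).pow_const _)]
        simp only [ENNReal.mul_rpow_of_nonneg _ _ hp'0]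
    _ ≤ (C : ℝ≥0∞) ^ (p / (p - 1)) * (C₁ * (C₂ * ∫⁻ x, f x ^ p ∂μ)) := by
        refine mul_le_mul' le_rfl ((hC₁ F hFm).trans (mul_le_mul' le_rfl ?_))
        rw [hF', ← hg']
        exact hC₂ g hgm
    _ = _ := by
        rw [← ENNReal.coe_rpow_of_nonneg _ hp'0]; push_cast; ring

end ApPair

/-- The function `1 / (1 + |y|)`, which governs the convergence of the truncated integrals. -/
def tailWeight (y : ℝ) : ℝ≥0∞ := ENNReal.ofReal (1 + |y|)⁻¹

theorem measurable_tailWeight : Measurable tailWeight := by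
  unfold tailWeight; fun_prop

theorem tailWeight_le_maxFn (y : ℝ) :
    tailWeight y ≤ maxFn volume ((Set.Ioo (-1) 1).indicator fun _ => 1) y := by
  have h0 : 0 < 1 + |y| := by positivity
  have hy : y ∈ Set.Ioo (-(1 + |y|)) (1 + |y|) := by
    constructor <;> [linarith [neg_abs_le y]; linarith [le_abs_self y]]
  refine le_trans (le_of_eq ?_) (average_le_maxFn volume _ hy)
  have e : Set.Ioo (-1) 1 ∩ Set.Ioo (-(1 + |y|)) (1 + |y|) = Set.Ioo (-1 : ℝ) 1 :=
    Set.inter_eq_left.2 (Set.Ioo_subset_Ioo (by linarith [abs_nonneg y])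
      (by linarith [abs_nonneg y]))
  rw [lintegral_indicator measurableSet_Ioo, Measure.restrict_restrict measurableSet_Ioo, e,
    setLIntegral_one, Real.volume_Ioo, Real.volume_Ioo, ← ENNReal.ofReal_div_of_pos (by linarith),
    tailWeight]
  congr 1; field_simp

theorem KernelBounds.truncConverges_of_tail {K : ℝ → ℝ → ℂ} {δ A : ℝ} (hK : KernelBounds K δ A)
    {f : ℝ → ℂ} (hf : AEStronglyMeasurable f) (h : ∫⁻ y, ‖f y‖ₑ * tailWeight y ≠ ∞) (x : ℝ) :
    TruncConverges K f x := by
  intro t ht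
  have hA := hK.const_pos
  refine ⟨((hK.aestronglyMeasurable x).mul hf).restrict, ?_⟩
  have hle : ∀ y ∈ {y : ℝ | t < |x - y|}, ‖K x y * f y‖ₑ ≤
      ENNReal.ofReal (A * ((1 + |x|) / t + 1)) * (‖f y‖ₑ * tailWeight y) := by
    intro y hy
    have hy' : t < |x - y| := hy
    have h0 : 0 < |x - y| := by linarith
    have h1 : 0 < 1 + |y| := by positivity
    rw [enorm_mul, mul_comm ‖f y‖ₑ, ← mul_assoc, tailWeight, ← ENNReal.ofReal_mul (by positivity)]
    refine mul_le_mul' ((hK.enorm_le h0 le_rfl).trans (ENNReal.ofReal_le_ofReal ?_)) le_rfl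
    rw [mul_assoc, div_eq_mul_inv]
    refine mul_le_mul_of_nonneg_left ?_ hA.le
    rw [← div_eq_mul_inv, le_div_iff₀ h1, inv_mul_le_iff₀ h0]
    have h2 : |y| ≤ |x| + |x - y| := by
      have := abs_sub_abs_le_abs_sub y x
      rw [abs_sub_comm] at this; linarith
    have h3 : 1 + |x| ≤ |x - y| * ((1 + |x|) / t) := by
      rw [mul_div_assoc', le_div_iff₀ ht]
      nlinarith [abs_nonneg x]
    linarith
  calc ∫⁻ y in {y : ℝ | t < |x - y|}, ‖K x y * f y‖ₑ
      ≤ ∫⁻ y in {y : ℝ | t < |x - y|},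
        ENNReal.ofReal (A * ((1 + |x|) / t + 1)) * (‖f y‖ₑ * tailWeight y) :=
        setLIntegral_mono' (measurableSet_truncSet x t) hle
    _ ≤ ∫⁻ y, ENNReal.ofReal (A * ((1 + |x|) / t + 1)) * (‖f y‖ₑ * tailWeight y) :=
        lintegral_mono' Measure.restrict_le_self le_rfl
    _ < ∞ := by
        rw [lintegral_const_mul' _ _ ENNReal.ofReal_ne_top]
        exact ENNReal.mul_lt_top ENNReal.ofReal_lt_top h.lt_top

theorem ApPair.lintegral_mul_tailWeight_ne_top {p : ℝ} {u v : ℝ → ℝ≥0∞} (h : ApPair p u v)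
    {f : ℝ → ℝ≥0∞} (hf : Measurable f) (hfin : ∫⁻ x, f x ^ p ∂(volume.withDensity u) ≠ ∞) :
    ∫⁻ y, f y * tailWeight y ≠ ∞ := by
  have hp := h.one_lt
  have hp1 : 0 < p - 1 := by linarith
  have hpq := Real.HolderConjugate.conjExponent hp
  have hum := h.measurable_left
  have hvm := h.measurable_right
  have hH := ENNReal.lintegral_mul_le_Lp_mul_Lq volume hpq
    (f := fun x => f x * u x ^ (1 / p)) (g := fun x => tailWeight x * v x ^ ((p - 1) / p))
    (hf.mul (hum.pow_const _)).aemeasurable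
    (measurable_tailWeight.mul (hvm.pow_const _)).aemeasurable
  have e1 : ∫⁻ x, ((fun x => f x * u x ^ (1 / p)) * fun x => tailWeight x * v x ^ ((p - 1) / p)) x =
      ∫⁻ y, f y * tailWeight y := by
    refine lintegral_congr_ae ?_
    filter_upwards [h.ae_pos] with x hx
    have e : u x ^ (1 / p) * v x ^ ((p - 1) / p) = 1 := by
      rw [h.right_eq, ← ENNReal.rpow_mul, ← ENNReal.rpow_add _ _ hx.1 hx.2,
        show 1 / p + -1 / (p - 1) * ((p - 1) / p) = 0 by field_simp; ring, ENNReal.rpow_zero]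
    rw [Pi.mul_apply]
    calc _ = f x * tailWeight x * (u x ^ (1 / p) * v x ^ ((p - 1) / p)) := by ring
      _ = _ := by rw [e, mul_one]
  have e2 : ∀ x, (f x * u x ^ (1 / p)) ^ p = u x * f x ^ p := fun x => by
    rw [ENNReal.mul_rpow_of_nonneg _ _ (by linarith), ← ENNReal.rpow_mul,
      one_div_mul_cancel (by linarith), ENNReal.rpow_one, mul_comm]
  have e3 : ∀ x, (tailWeight x * v x ^ ((p - 1) / p)) ^ p.conjExponent =
      v x * tailWeight x ^ (p / (p - 1)) := fun x => by
    rw [Real.conjExponent, ENNReal.mul_rpow_of_nonneg _ _ (by positivity), ← ENNReal.rpow_mul,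
      show (p - 1) / p * (p / (p - 1)) = 1 by field_simp, ENNReal.rpow_one, mul_comm]
  rw [e1] at hH
  simp only [e2, e3] at hH
  have f1 : ∫⁻ x, u x * f x ^ p = ∫⁻ x, f x ^ p ∂(volume.withDensity u) :=
    (lintegral_withDensity_eq_lintegral_mul _ hum (hf.pow_const _)).symm
  have f2 : ∫⁻ x, v x * tailWeight x ^ (p / (p - 1)) =
      ∫⁻ x, tailWeight x ^ (p / (p - 1)) ∂(volume.withDensity v) :=
    (lintegral_withDensity_eq_lintegral_mul _ hvm (measurable_tailWeight.pow_const _)).symm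
  obtain ⟨C, hC⟩ := h.symm.exists_lintegral_maxFn_le
  have f3 : ∫⁻ x, tailWeight x ^ (p / (p - 1)) ∂(volume.withDensity v) ≠ ∞ := by
    have hp'0 : 0 < p / (p - 1) := by positivity
    have hb := hC ((Set.Ioo (-1) 1).indicator fun _ => 1)
      (measurable_const.indicator measurableSet_Ioo)
    refine ne_top_of_le_ne_top ?_ ((lintegral_mono fun x =>
      ENNReal.rpow_le_rpow (tailWeight_le_maxFn x) hp'0.le).trans hb)
    have e4 : ∀ x, (Set.Ioo (-1 : ℝ) 1).indicator (fun _ => (1 : ℝ≥0∞)) x ^ (p / (p - 1)) =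
        (Set.Ioo (-1 : ℝ) 1).indicator (fun _ => 1) x := fun x => by
      by_cases hx : x ∈ Set.Ioo (-1 : ℝ) 1
      · rw [Set.indicator_of_mem hx, ENNReal.one_rpow]
      · rw [Set.indicator_of_notMem hx, ENNReal.zero_rpow_of_pos hp'0]
    simp only [e4]
    rw [lintegral_indicator measurableSet_Ioo, setLIntegral_one,
      withDensity_apply _ measurableSet_Ioo]
    exact ENNReal.mul_ne_top ENNReal.coe_ne_top (ne_top_of_le_ne_top (h.right_fin (-1) 1)
      (lintegral_mono_set Set.Ioo_subset_Icc_self))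
  refine ne_top_of_le_ne_top (ENNReal.mul_ne_top ?_ ?_) hH
  · rw [f1]; exact ENNReal.rpow_ne_top_of_nonneg (by positivity) hfin
  · rw [f2]; exact ENNReal.rpow_ne_top_of_nonneg (by have := hpq.symm.pos; positivity) f3

/-- A weight in `A_1` with values in `[0, ∞]`, not almost everywhere zero. -/
structure A1Weight (u : ℝ → ℝ≥0∞) : Prop where
  measurable : Measurable u
  fin : ∀ a b, ∫⁻ x in Set.Icc a b, u x ≠ ∞
  nonzero : ∫⁻ x, u x ≠ 0
  bound : ∃ C : ℝ≥0, ∀ᵐ x, maxFn volume u x ≤ C * u x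

namespace A1Weight

variable {u : ℝ → ℝ≥0∞} (h : A1Weight u)
include h

theorem isLocallyFiniteMeasure : IsLocallyFiniteMeasure (volume.withDensity u) :=
  isLocallyFiniteMeasure_withDensity_of_Icc h.fin

theorem exists_mul_le : ∃ C : ℝ≥0, ∀ᵐ x, ∀ a b : ℝ, x ∈ Set.Ioo a b →
    (volume.withDensity u) (Set.Ioo a b) ≤ C * ENNReal.ofReal (b - a) * u x := by
  obtain ⟨C, hC⟩ := h.bound
  refine ⟨C, ?_⟩
  filter_upwards [hC] with x hx a b hab
  rw [withDensity_apply _ measurableSet_Ioo]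
  refine (lintegral_le_maxFn_mul volume u hab).trans ?_
  rw [Real.volume_Ioo]
  refine (mul_le_mul' hx le_rfl).trans (le_of_eq (by ring))

theorem muckenhouptBound : MuckenhouptBound (volume.withDensity u) 1 := by
  obtain ⟨C, hC⟩ := h.exists_mul_le
  refine ⟨C, fun a b hab E hE hEm => ?_⟩
  simp only [ENNReal.rpow_one]
  have e : (volume.withDensity u) (Set.Icc a b) = (volume.withDensity u) (Set.Ioo a b) := by
    rw [withDensity_apply _ measurableSet_Ioo, withDensity_apply _ measurableSet_Icc,
      setLIntegral_congr Ioo_ae_eq_Icc]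
  have ha : ∀ᵐ y : ℝ, y ≠ a := by simp [ae_iff]
  have hb : ∀ᵐ y : ℝ, y ≠ b := by simp [ae_iff]
  calc (volume.withDensity u) (Set.Icc a b) * volume E
      = ∫⁻ _ in E, (volume.withDensity u) (Set.Icc a b) := (setLIntegral_const _ _).symm
    _ ≤ ∫⁻ x in E, C * ENNReal.ofReal (b - a) * u x := by
        refine lintegral_mono_ae ?_
        filter_upwards [ae_restrict_mem hEm, ae_restrict_of_ae hC, ae_restrict_of_ae ha,
          ae_restrict_of_ae hb] with x hx hCx hxa hxb
        rw [e]
        exact hCx a b ⟨lt_of_le_of_ne (hE hx).1 hxa.symm, lt_of_le_of_ne (hE hx).2 hxb⟩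
    _ = _ := by
        rw [lintegral_const_mul _ h.measurable, withDensity_apply _ hEm]

theorem doublingOnIntervals : DoublingOnIntervals (volume.withDensity u) :=
  h.muckenhouptBound.doublingOnIntervals one_pos

theorem exists_tailWeight_le : ∃ C : ℝ≥0, ∀ᵐ x, tailWeight x ≤ C * u x := by
  obtain ⟨C, hC⟩ := h.exists_mul_le
  obtain ⟨n, hn⟩ : ∃ n : ℕ, (volume.withDensity u) (Set.Ioo (-(n : ℝ)) n) ≠ 0 := by
    by_contra hc
    push Not at hc
    have h1 : (volume.withDensity u) (⋃ n : ℕ, Set.Ioo (-(n : ℝ)) n) = 0 := measure_iUnion_null hc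
    have h2 : (⋃ n : ℕ, Set.Ioo (-(n : ℝ)) n) = Set.univ := by
      refine Set.eq_univ_of_forall fun x => ?_
      obtain ⟨n, hn⟩ := exists_nat_gt |x|
      exact Set.mem_iUnion.2 ⟨n, abs_lt.1 hn⟩
    rw [h2, withDensity_apply _ MeasurableSet.univ, Measure.restrict_univ] at h1
    exact h.nonzero h1
  set m := (volume.withDensity u) (Set.Ioo (-(n : ℝ)) n) with hm
  have hmt : m ≠ ∞ := by
    rw [hm, withDensity_apply _ measurableSet_Ioo]
    exact ne_top_of_le_ne_top (h.fin (-n) n) (lintegral_mono_set Set.Ioo_subset_Icc_self)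
  refine ⟨(m⁻¹ * (C * ENNReal.ofReal (2 * (n + 1)))).toNNReal, ?_⟩
  rw [ENNReal.coe_toNNReal (ENNReal.mul_ne_top (ENNReal.inv_ne_top.2 hn) (by finiteness))]
  filter_upwards [hC] with x hx
  have h0 : 0 < 1 + |x| := by positivity
  have h1 := hx (-(n + 1 + |x|)) (n + 1 + |x|)
    ⟨by linarith [neg_abs_le x, (n.cast_nonneg : (0 : ℝ) ≤ n)],
      by linarith [le_abs_self x, (n.cast_nonneg : (0 : ℝ) ≤ n)]⟩
  have h2 : m ≤ C * ENNReal.ofReal (n + 1 + |x| - -(n + 1 + |x|)) * u x :=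
    (measure_mono (Set.Ioo_subset_Ioo (by linarith) (by linarith))).trans h1
  have h3 : n + 1 + |x| - -(n + 1 + |x|) ≤ 2 * (n + 1) * (1 + |x|) := by
    nlinarith [abs_nonneg x, (n.cast_nonneg : (0 : ℝ) ≤ n)]
  calc tailWeight x = m⁻¹ * m * tailWeight x := by rw [ENNReal.inv_mul_cancel hn hmt, one_mul]
    _ ≤ m⁻¹ * (C * ENNReal.ofReal (2 * (n + 1) * (1 + |x|)) * u x) * tailWeight x := by
        refine mul_le_mul' (mul_le_mul' le_rfl (h2.trans ?_)) le_rfl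
        exact mul_le_mul' (mul_le_mul' le_rfl (ENNReal.ofReal_le_ofReal h3)) le_rfl
    _ = m⁻¹ * (C * ENNReal.ofReal (2 * (n + 1))) * u x *
        (ENNReal.ofReal (1 + |x|) * tailWeight x) := by
        rw [ENNReal.ofReal_mul (by positivity)]; ring
    _ = _ := by
        rw [tailWeight, ← ENNReal.ofReal_mul h0.le, mul_inv_cancel₀ h0.ne', ENNReal.ofReal_one,
          mul_one]

theorem ae_ne_zero : ∀ᵐ x, u x ≠ 0 := by
  obtain ⟨C, hC⟩ := h.exists_tailWeight_le
  filter_upwards [hC] with x hx h0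
  rw [h0, mul_zero, nonpos_iff_eq_zero, tailWeight, ENNReal.ofReal_eq_zero] at hx
  have : 0 < (1 + |x|)⁻¹ := by positivity
  linarith

theorem lintegral_mul_tailWeight_ne_top {f : ℝ → ℝ≥0∞} (hf : Measurable f)
    (hfin : ∫⁻ x, f x ∂(volume.withDensity u) ≠ ∞) : ∫⁻ y, f y * tailWeight y ≠ ∞ := by
  obtain ⟨C, hC⟩ := h.exists_tailWeight_le
  have hle : ∫⁻ y, f y * tailWeight y ≤ C * ∫⁻ x, f x ∂(volume.withDensity u) := by
    rw [lintegral_withDensity_eq_lintegral_mul _ h.measurable hf,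
      ← lintegral_const_mul _ (h.measurable.mul hf)]
    refine lintegral_mono_ae ?_
    filter_upwards [hC] with x hx
    rw [Pi.mul_apply, ← mul_assoc, mul_comm (f x)]
    exact mul_le_mul' hx le_rfl
  exact ne_top_of_le_ne_top (ENNReal.mul_ne_top ENNReal.coe_ne_top hfin) hle

theorem exists_maxFn_weak : ∃ C : ℝ≥0, ∀ f : ℝ → ℝ≥0∞, Measurable f → ∀ s : ℝ≥0∞,
    s * (volume.withDensity u) {x | s < maxFn volume f x} ≤
      C * ∫⁻ x, f x ∂(volume.withDensity u) := by
  have := h.isLocallyFiniteMeasure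
  obtain ⟨C, hC⟩ := h.exists_mul_le
  obtain ⟨D, hD⟩ := h.doublingOnIntervals.exists_maxFn_weak
  set μ := volume.withDensity u with hμ
  refine ⟨(C + 1) * D, fun f hf s => ?_⟩
  have hC1 : ((C + 1 : ℝ≥0) : ℝ≥0∞) ≠ 0 := by positivity
  have hpt : ∀ x, maxFn volume f x ≤ (C + 1 : ℝ≥0) * maxFn μ f x := by
    intro x
    refine iSup_le fun a => iSup_le fun b => iSup_le fun hx => ?_
    have hab : a < b := hx.1.trans hx.2
    have hμ0 : μ (Set.Ioo a b) ≠ 0 := by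
      rw [hμ, withDensity_apply _ measurableSet_Ioo, Ne, lintegral_eq_zero_iff h.measurable]
      intro h0
      have h1 : ∀ᵐ x ∂(volume.restrict (Set.Ioo a b)), False := by
        filter_upwards [h0, ae_restrict_of_ae h.ae_ne_zero] with y hy hy'
        exact hy' hy
      rw [ae_iff] at h1
      simp [Real.volume_Ioo] at h1
      linarith
    have h1 : μ (Set.Ioo a b) * ∫⁻ y in Set.Ioo a b, f y ≤
        C * volume (Set.Ioo a b) * ∫⁻ y in Set.Ioo a b, f y ∂μ := by
      rw [hμ, setLIntegral_withDensity_eq_setLIntegral_mul _ h.measurable hf measurableSet_Ioo,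
        ← lintegral_const_mul _ (h.measurable.mul hf), ← lintegral_const_mul _ hf]
      refine lintegral_mono_ae ?_
      filter_upwards [ae_restrict_mem measurableSet_Ioo, ae_restrict_of_ae hC] with y hy hCy
      rw [Pi.mul_apply, ← mul_assoc, Real.volume_Ioo]
      exact mul_le_mul' (hCy a b hy) le_rfl
    refine ENNReal.div_le_of_le_mul ?_
    rw [← ENNReal.mul_le_mul_iff_right hμ0 measure_Ioo_lt_top.ne]
    calc _ ≤ C * volume (Set.Ioo a b) * ∫⁻ y in Set.Ioo a b, f y ∂μ := h1
      _ ≤ (C + 1 : ℝ≥0) * volume (Set.Ioo a b) * (maxFn μ f x * μ (Set.Ioo a b)) := by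
          refine mul_le_mul' (mul_le_mul' ?_ le_rfl) (lintegral_le_maxFn_mul _ _ hx)
          exact_mod_cast le_self_add
      _ = _ := by ring
  calc s * μ {x | s < maxFn volume f x}
      ≤ s * μ {x | s / (C + 1 : ℝ≥0) < maxFn μ f x} := by
        refine mul_le_mul' le_rfl (measure_mono fun x (hx : s < maxFn volume f x) => ?_)
        have := hx.trans_le (hpt x)
        exact ENNReal.div_lt_of_lt_mul' this
    _ = (C + 1 : ℝ≥0) * (s / (C + 1 : ℝ≥0) * μ {x | s / (C + 1 : ℝ≥0) < maxFn μ f x}) := by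
        rw [← mul_assoc, ENNReal.mul_div_cancel hC1 ENNReal.coe_ne_top]
    _ ≤ (C + 1 : ℝ≥0) * (D * ∫⁻ x, f x ∂μ) := mul_le_mul' le_rfl (hD f _)
    _ = _ := by push_cast; ring

end A1Weight

section Truncation

variable {K : ℝ → ℝ → ℂ} {f g : ℝ → ℂ} {x q : ℝ}

theorem TruncConverges.congr_ae (h : f =ᵐ[volume] g) (hf : TruncConverges K f x) :
    TruncConverges K g x := fun t ht => by
  refine (hf t ht).congr (ae_restrict_of_ae ?_)
  filter_upwards [h] with y hy
  rw [hy]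

/-- Fatou's lemma for the variation operator. -/
theorem varOp_le_liminf (hq : 0 < q) {F : ℕ → ℝ → ℂ}
    (hF : ∀ t, 0 < t → Tendsto (fun n => truncOp K t (F n) x) atTop (𝓝 (truncOp K t f x))) :
    varOp q K f x ≤ liminf (fun n => varOp q K (F n) x) atTop := by
  refine qVariation_le fun t ht h0 => ?_
  rw [lqNorm, one_div, ENNReal.rpow_inv_le_iff hq, ENNReal.tsum_eq_iSup_sum]
  refine iSup_le fun s => ?_
  rw [← ENNReal.rpow_inv_le_iff hq]
  have h1 : Tendsto (fun n => (∑ j ∈ s, ‖truncOp K (t j) (F n) x -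
      truncOp K (t (j + 1)) (F n) x‖ₑ ^ q) ^ q⁻¹) atTop (𝓝 ((∑ j ∈ s, ‖truncOp K (t j) f x -
      truncOp K (t (j + 1)) f x‖ₑ ^ q) ^ q⁻¹)) := by
    refine (ENNReal.continuous_rpow_const.tendsto _).comp (tendsto_finsetSum s fun j _ => ?_)
    exact (ENNReal.continuous_rpow_const.tendsto _).comp
      (((hF _ (h0 j)).sub (hF _ (h0 (j + 1)))).enorm)
  rw [← h1.liminf_eq]
  refine liminf_le_liminf (Eventually.of_forall fun n => ?_)
  refine le_trans ?_ (lqNorm_le_qVariation ht h0)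
  rw [lqNorm, one_div]
  exact ENNReal.rpow_le_rpow (ENNReal.sum_le_tsum s) (by positivity)

/-- The restriction of `f` to the set of all `y` with `|y| ≤ n` and `|f y| ≤ n`. -/
def cutoff (f : ℝ → ℂ) (n : ℕ) : ℝ → ℂ := {y : ℝ | |y| ≤ n ∧ ‖f y‖ ≤ n}.indicator f

theorem measurableSet_cutoff (hf : Measurable f) (n : ℕ) :
    MeasurableSet {y : ℝ | |y| ≤ n ∧ ‖f y‖ ≤ n} := by
  have h : Measurable fun y : ℝ => |y| := by fun_prop
  exact (measurableSet_le h measurable_const).inter (measurableSet_le hf.norm measurable_const)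

theorem norm_cutoff_le (f : ℝ → ℂ) (n : ℕ) (y : ℝ) : ‖cutoff f n y‖ ≤ ‖f y‖ :=
  norm_indicator_le_norm_self _ _

theorem enorm_cutoff_le (f : ℝ → ℂ) (n : ℕ) (y : ℝ) : ‖cutoff f n y‖ₑ ≤ ‖f y‖ₑ :=
  enorm_indicator_le_enorm_self _ _

theorem cutoff_eq_zero (f : ℝ → ℂ) (n : ℕ) : ∃ r, ∀ y, r < |y| → cutoff f n y = 0 :=
  ⟨n, fun _ hy => Set.indicator_of_notMem (fun h => absurd h.1 (not_le.2 hy)) _⟩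

theorem integrable_cutoff (hf : Measurable f) (n : ℕ) : Integrable (cutoff f n) := by
  rw [cutoff, integrable_indicator_iff (measurableSet_cutoff hf n)]
  refine Measure.integrableOn_of_bounded (M := n) ?_ hf.aestronglyMeasurable ?_
  · refine ne_top_of_le_ne_top (measure_Icc_lt_top (a := -(n : ℝ)) (b := n)).ne
      (measure_mono fun y hy => abs_le.1 hy.1)
  · filter_upwards [ae_restrict_mem (measurableSet_cutoff hf n)] with y hy using hy.2

theorem tendsto_truncOp_cutoff (hm : Measurable f) (hf : TruncConverges K f x) {t : ℝ}
    (ht : 0 < t) :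
    Tendsto (fun n => truncOp K t (cutoff f n) x) atTop (𝓝 (truncOp K t f x)) := by
  refine tendsto_integral_of_dominated_convergence (fun y => ‖K x y * f y‖) (fun n => ?_)
    (hf t ht).norm (fun n => Eventually.of_forall fun y => ?_) (Eventually.of_forall fun y => ?_)
  · exact ((hf.indicator (measurableSet_cutoff hm n)) t ht).1
  · rw [norm_mul, norm_mul]
    exact mul_le_mul_of_nonneg_left (norm_cutoff_le f n y) (norm_nonneg _)
  · obtain ⟨N, hN⟩ := exists_nat_ge (max |y| ‖f y‖)
    refine tendsto_const_nhds.congr' ?_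
    filter_upwards [eventually_ge_atTop N] with n hn
    have hn' : (N : ℝ) ≤ n := by exact_mod_cast hn
    rw [cutoff, Set.indicator_of_mem]
    exact ⟨(le_max_left _ _).trans (hN.trans hn'), (le_max_right _ _).trans (hN.trans hn')⟩

theorem varOp_le_liminf_grandMax (hq : 0 < q) (hm : Measurable f) (hf : TruncConverges K f x) :
    varOp q K f x ≤ liminf (fun n => grandMax q K (cutoff f n) x) atTop :=
  (varOp_le_liminf hq fun _ ht => tendsto_truncOp_cutoff hm hf ht).trans
    (liminf_le_liminf (Eventually.of_forall fun _ => varOp_le_grandMax _ _))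

theorem lintegral_varOp_rpow_le {μ : Measure ℝ} (hq : 0 < q) (hm : Measurable f)
    (hf : ∀ x, TruncConverges K f x) {p : ℝ} (hp : 0 ≤ p) {B : ℝ≥0∞}
    (hB : ∀ n, ∫⁻ x, grandMax q K (cutoff f n) x ^ p ∂μ ≤ B) : ∫⁻ x, varOp q K f x ^ p ∂μ ≤ B := by
  calc ∫⁻ x, varOp q K f x ^ p ∂μ
      ≤ ∫⁻ x, liminf (fun n => grandMax q K (cutoff f n) x ^ p) atTop ∂μ := by
        refine lintegral_mono fun x => ?_
        refine (ENNReal.rpow_le_rpow (varOp_le_liminf_grandMax hq hm (hf x)) hp).trans (le_of_eq ?_)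
        exact (ENNReal.monotone_rpow_of_nonneg hp).map_liminf_of_continuousAt _
          ENNReal.continuous_rpow_const.continuousAt
    _ ≤ liminf (fun n => ∫⁻ x, grandMax q K (cutoff f n) x ^ p ∂μ) atTop :=
        lintegral_liminf_le fun n => measurable_grandMax.pow_const _
    _ ≤ liminf (fun _ : ℕ => B) atTop := liminf_le_liminf (Eventually.of_forall hB)
    _ = B := liminf_const B

theorem measure_lt_varOp_le {μ : Measure ℝ} (hq : 0 < q) (hm : Measurable f)
    (hf : ∀ x, TruncConverges K f x) {l B : ℝ≥0∞}
    (hB : ∀ n, μ {x | l < grandMax q K (cutoff f n) x} ≤ B) : μ {x | l < varOp q K f x} ≤ B := by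
  set E : ℕ → Set ℝ := fun n => {x | l < grandMax q K (cutoff f n) x}
  have hEm : ∀ n, MeasurableSet (E n) := fun n =>
    measurableSet_lt measurable_const measurable_grandMax
  calc μ {x | l < varOp q K f x}
      ≤ μ {x | 1 ≤ liminf (fun n => (E n).indicator (fun _ => (1 : ℝ≥0∞)) x) atTop} := by
        refine measure_mono fun x (hx : l < varOp q K f x) => ?_
        have h1 := eventually_lt_of_lt_liminf (hx.trans_le (varOp_le_liminf_grandMax hq hm (hf x)))
        change (1 : ℝ≥0∞) ≤ liminf (fun n => (E n).indicator (fun _ => (1 : ℝ≥0∞)) x) atTop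
        refine le_liminf_of_le ?_ ?_
        · isBoundedDefault
        filter_upwards [h1] with n hn
        rw [Set.indicator_of_mem (by exact hn)]
    _ ≤ ∫⁻ x, liminf (fun n => (E n).indicator (fun _ => (1 : ℝ≥0∞)) x) atTop ∂μ := by
        have := mul_meas_ge_le_lintegral₀ (μ := μ) (f := fun x =>
          liminf (fun n => (E n).indicator (fun _ => (1 : ℝ≥0∞)) x) atTop)
          (Measurable.liminf fun n => measurable_const.indicator (hEm n)).aemeasurable 1
        rwa [one_mul] at this
    _ ≤ liminf (fun n => ∫⁻ x, (E n).indicator (fun _ => (1 : ℝ≥0∞)) x ∂μ) atTop :=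
        lintegral_liminf_le fun n => measurable_const.indicator (hEm n)
    _ ≤ liminf (fun _ : ℕ => B) atTop := by
        refine liminf_le_liminf (Eventually.of_forall fun n => ?_)
        rw [lintegral_indicator (hEm n), setLIntegral_one]
        exact hB n
    _ = B := liminf_const B

end Truncation

theorem maxFn_mono {μ : Measure ℝ} {f g : ℝ → ℝ≥0∞} (h : ∀ y, f y ≤ g y) (x : ℝ) :
    maxFn μ f x ≤ maxFn μ g x := by
  unfold maxFn
  gcongr with a b hx y
  exact h y

namespace KernelBounds

variable {K : ℝ → ℝ → ℂ} {δ A : ℝ} (hK : KernelBounds K δ A) {q : ℝ}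
include hK

theorem exists_lintegral_varOp_le (hq : 2 ≤ q) {p₀ : ℝ} (hp₀ : 1 < p₀)
    (hbdd : ∃ C : ℝ≥0, ∀ f : ℝ → ℂ, MemLp f (ENNReal.ofReal p₀) volume →
      ∫⁻ x, varOp q K f x ^ p₀ ≤ C * ∫⁻ x, ‖f x‖ₑ ^ p₀)
    {p : ℝ} {u v : ℝ → ℝ≥0∞} (h : ApPair p u v) :
    ∃ C : ℝ≥0, ∀ f : ℝ → ℂ, Measurable f → ∫⁻ x, ‖f x‖ₑ ^ p ∂(volume.withDensity u) ≠ ∞ →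
      (∀ x, TruncConverges K f x) ∧ ∫⁻ x, varOp q K f x ^ p ∂(volume.withDensity u) ≤
        C * ∫⁻ x, ‖f x‖ₑ ^ p ∂(volume.withDensity u) := by
  have hp := h.one_lt
  have := h.isLocallyFiniteMeasure
  obtain ⟨C₁, hC₁⟩ := hK.exists_lintegral_grandMax_le hq hp₀ hbdd (by linarith) h.muckenhouptBound
  obtain ⟨C₂, hC₂⟩ := h.exists_lintegral_maxFn_le
  refine ⟨C₁ * C₂, fun f hf hfin => ?_⟩
  have hT := hK.truncConverges_of_tail hf.aestronglyMeasurable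
    (h.lintegral_mul_tailWeight_ne_top hf.enorm hfin)
  refine ⟨hT, lintegral_varOp_rpow_le (by linarith) hf hT (by linarith) fun n => ?_⟩
  refine (hC₁ _ (integrable_cutoff hf n) (cutoff_eq_zero f n)).trans ?_
  rw [ENNReal.coe_mul, mul_assoc]
  refine mul_le_mul' le_rfl (le_trans (lintegral_mono fun x => ?_) (hC₂ _ hf.enorm))
  exact ENNReal.rpow_le_rpow (maxFn_mono (enorm_cutoff_le f n) x) (by linarith)

theorem exists_measure_varOp_le (hq : 2 ≤ q) {p₀ : ℝ} (hp₀ : 1 < p₀)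
    (hbdd : ∃ C : ℝ≥0, ∀ f : ℝ → ℂ, MemLp f (ENNReal.ofReal p₀) volume →
      ∫⁻ x, varOp q K f x ^ p₀ ≤ C * ∫⁻ x, ‖f x‖ₑ ^ p₀)
    {u : ℝ → ℝ≥0∞} (h : A1Weight u) :
    ∃ C : ℝ≥0, ∀ f : ℝ → ℂ, Measurable f → ∫⁻ x, ‖f x‖ₑ ∂(volume.withDensity u) ≠ ∞ →
      (∀ x, TruncConverges K f x) ∧ ∀ l : ℝ, 0 < l →
        (volume.withDensity u) {x | ENNReal.ofReal l < varOp q K f x} ≤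
          C / ENNReal.ofReal l * ∫⁻ x, ‖f x‖ₑ ∂(volume.withDensity u) := by
  have := h.isLocallyFiniteMeasure
  obtain ⟨C₁, hC₁⟩ := hK.exists_measure_grandMax_le hq hp₀ hbdd h.muckenhouptBound
  obtain ⟨C₂, hC₂⟩ := h.exists_maxFn_weak
  refine ⟨C₁ * C₂, fun f hf hfin => ?_⟩
  have hT := hK.truncConverges_of_tail hf.aestronglyMeasurable
    (h.lintegral_mul_tailWeight_ne_top hf.enorm hfin)
  refine ⟨hT, fun l hl => measure_lt_varOp_le (by linarith) hf hT fun n => ?_⟩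
  have h1 := hC₁ _ (integrable_cutoff hf n) (cutoff_eq_zero f n)
    (C₂ * ∫⁻ x, ‖f x‖ₑ ∂(volume.withDensity u)) (fun s _ => le_trans (mul_le_mul' le_rfl
      (measure_mono fun x (hx : _ < _) => hx.trans_le (maxFn_mono (enorm_cutoff_le f n) x)))
      (hC₂ _ hf.enorm _)) l hl
  rw [div_eq_mul_inv, mul_right_comm, ← div_eq_mul_inv, ENNReal.le_div_iff_mul_le
    (Or.inl (by simpa using hl)) (Or.inl ENNReal.ofReal_ne_top), mul_comm, ENNReal.coe_mul,
    mul_assoc]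
  exact h1

end KernelBounds

theorem exists_measure_Icc_ne_zero {μ : Measure ℝ} (hμ : μ ≠ 0) :
    ∃ n : ℕ, μ (Set.Icc (-(n : ℝ)) n) ≠ 0 := by
  by_contra hc
  push Not at hc
  have h2 : (⋃ n : ℕ, Set.Icc (-(n : ℝ)) n) = Set.univ := by
    refine Set.eq_univ_of_forall fun x => ?_
    obtain ⟨n, hn⟩ := exists_nat_ge |x|
    exact Set.mem_iUnion.2 ⟨n, abs_le.1 hn⟩
  refine hμ (Measure.measure_univ_eq_zero.1 ?_)
  rw [← h2]
  exact measure_iUnion_null hc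

section Weights

variable {w : ℝ → ℝ} {p : ℝ}

theorem IsWeight.exists_density (hw : IsWeight w) : ∃ u : ℝ → ℝ≥0∞, Measurable u ∧
    (∀ x, u x ≠ ∞) ∧ (fun x => ENNReal.ofReal (w x)) =ᵐ[volume] u ∧
    weightMeasure w = volume.withDensity u := by
  have hm := hw.locallyIntegrable.aestronglyMeasurable
  have h : (fun x => ENNReal.ofReal (w x)) =ᵐ[volume] fun x => ENNReal.ofReal (hm.mk w x) := by
    filter_upwards [hm.ae_eq_mk] with x hx
    rw [hx]
  exact ⟨_, hm.stronglyMeasurable_mk.measurable.ennreal_ofReal, fun _ => ENNReal.ofReal_ne_top, h,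
    withDensity_congr_ae h⟩

theorem IsWeight.lintegral_Icc_ne_top (hw : IsWeight w) (a b : ℝ) :
    ∫⁻ x in Set.Icc a b, ENNReal.ofReal (w x) ≠ ∞ :=
  (hw.locallyIntegrable.integrableOn_isCompact isCompact_Icc).lintegral_lt_top.ne

theorem IsAp.exists_apPair (hp : 1 < p) (hw : IsAp p w) (h0 : weightMeasure w ≠ 0) :
    ∃ u v, weightMeasure w = volume.withDensity u ∧ ApPair p u v := by
  have hp1 : 0 < p - 1 := by linarith
  obtain ⟨u, hum, hut, hwu, hμ⟩ := hw.1.exists_density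
  obtain ⟨C, hC⟩ := hw.2
  have e1 : ∀ a b, ∫⁻ x in Set.Icc a b, ENNReal.ofReal (w x) = ∫⁻ x in Set.Icc a b, u x :=
    fun a b => lintegral_congr_ae (ae_restrict_of_ae hwu)
  have e2 : ∀ a b, ∫⁻ x in Set.Icc a b, ENNReal.ofReal (w x) ^ (-1 / (p - 1)) =
      ∫⁻ x in Set.Icc a b, u x ^ (-1 / (p - 1)) := fun a b => by
    refine lintegral_congr_ae (ae_restrict_of_ae ?_)
    filter_upwards [hwu] with x hx
    rw [hx]
  simp only [e1, e2] at hC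
  have hright : ∀ a b, ∫⁻ x in Set.Icc a b, u x ^ (-1 / (p - 1)) ≠ ∞ := by
    intro a b
    obtain ⟨n, hn⟩ := exists_measure_Icc_ne_zero h0
    rw [hμ, withDensity_apply _ measurableSet_Icc] at hn
    have hcd : min a (-n) - 1 < max b n + 1 := by
      have h1 : min a (-n) ≤ -(n : ℝ) := min_le_right _ _
      have h2 : (n : ℝ) ≤ max b n := le_max_right _ _
      linarith
    have hbd := hC _ _ hcd
    have hu0 : ∫⁻ x in Set.Icc (min a (-n) - 1) (max b n + 1), u x ≠ 0 := fun h =>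
      hn (le_antisymm ((lintegral_mono_set (Set.Icc_subset_Icc
        (by linarith [min_le_right a (-(n : ℝ))])
        (by linarith [le_max_right b (n : ℝ)]))).trans h.le) zero_le)
    refine ne_top_of_le_ne_top (fun htop => ?_) (lintegral_mono_set (Set.Icc_subset_Icc
      (a₂ := min a (-n) - 1) (b₂ := max b n + 1)
      (by linarith [min_le_left a (-(n : ℝ))]) (by linarith [le_max_left b (n : ℝ)])))
    rw [htop, ENNReal.top_rpow_of_pos hp1, ENNReal.mul_top hu0, top_le_iff] at hbd
    exact ENNReal.mul_ne_top ENNReal.coe_ne_top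
      (ENNReal.rpow_ne_top_of_nonneg (by linarith) ENNReal.ofReal_ne_top) hbd
  have hpos : ∀ᵐ x, u x ≠ 0 := by
    have h1 : ∀ n : ℕ, ∀ᵐ x, x ∈ Set.Icc (-(n : ℝ)) n → u x ^ (-1 / (p - 1)) < ∞ := fun n => by
      rw [← ae_restrict_iff' measurableSet_Icc]
      exact ae_lt_top (hum.pow_const _) (hright _ _)
    filter_upwards [ae_all_iff.2 h1] with x hx h
    obtain ⟨n, hn⟩ := exists_nat_ge |x|
    have h2 := hx n (abs_le.1 hn)
    rw [h, ENNReal.zero_rpow_of_neg (div_neg_of_neg_of_pos (by norm_num) hp1)] at h2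
    exact lt_irrefl _ h2
  exact ⟨u, fun x => u x ^ (-1 / (p - 1)), hμ, hp, hum, hpos.mono fun x hx => ⟨hx, hut x⟩,
    fun _ => rfl, fun a b => e1 a b ▸ hw.1.lintegral_Icc_ne_top a b, hright, C, hC⟩

theorem IsA1.exists_a1Weight (hw : IsA1 w) (h0 : weightMeasure w ≠ 0) :
    ∃ u, weightMeasure w = volume.withDensity u ∧ A1Weight u := by
  obtain ⟨u, hum, -, hwu, hμ⟩ := hw.1.exists_density
  obtain ⟨C, hC⟩ := hw.2
  refine ⟨u, hμ, hum, fun a b => ?_, fun h => h0 ?_, C, ?_⟩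
  · rw [← lintegral_congr_ae (ae_restrict_of_ae hwu)]
    exact hw.1.lintegral_Icc_ne_top a b
  · rw [hμ, ← Measure.measure_univ_eq_zero, withDensity_apply _ MeasurableSet.univ,
      Measure.restrict_univ, h]
  · filter_upwards [hC, hwu] with x hx hwx
    rw [← hwx]
    refine le_trans (iSup_le fun a => iSup_le fun b => iSup_le fun hab => ?_) hx
    refine le_trans ?_ (le_iSup₂_of_le a b (le_iSup₂_of_le (hab.1.trans hab.2)
      (Set.Ioo_subset_Icc_self hab) le_rfl))
    rw [Real.volume_Ioo]
    refine ENNReal.div_le_div_right (le_trans (le_of_eq ?_)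
      (lintegral_mono_set Set.Ioo_subset_Icc_self)) _
    refine lintegral_congr_ae (ae_restrict_of_ae ?_)
    filter_upwards [hwu] with y hy
    rw [← hy, Real.enorm_of_nonneg (hw.1.nonneg y)]

end Weights

theorem exists_measurable_ae_eq {u : ℝ → ℝ≥0∞} (hu : Measurable u) (h0 : ∀ᵐ x, u x ≠ 0) {f : ℝ → ℂ}
    (hf : AEStronglyMeasurable f (volume.withDensity u)) :
    ∃ g : ℝ → ℂ, Measurable g ∧ f =ᵐ[volume] g ∧ f =ᵐ[volume.withDensity u] g := by
  have h := hf.mono_ac (withDensity_absolutelyContinuous' hu.aemeasurable h0)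
  exact ⟨h.mk f, h.stronglyMeasurable_mk.measurable, h.ae_eq_mk,
    (withDensity_absolutelyContinuous volume u).ae_eq h.ae_eq_mk⟩

end

theorem mainTheorem2 (K : ℝ → ℝ → ℂ) (hK : IsRegularKernel K)
    (q : ℝ) (hq : 2 < q) (p₀ : ℝ) (hp₀ : 1 < p₀)
    (hbdd : ∃ C : ℝ≥0, ∀ f : ℝ → ℂ, MemLp f (ENNReal.ofReal p₀) volume →
      ∫⁻ x, varOp q K f x ^ p₀ ≤ C * ∫⁻ x, ‖f x‖ₑ ^ p₀) :
    (∀ w : ℝ → ℝ, IsA1 w →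
      ∃ C : ℝ≥0, ∀ f : ℝ → ℂ, MemLp f 1 (weightMeasure w) →
        (∀ᵐ x ∂(weightMeasure w), TruncConverges K f x) ∧
        ∀ l : ℝ, 0 < l →
          weightMeasure w {x | ENNReal.ofReal l < varOp q K f x} ≤
            C / ENNReal.ofReal l * ∫⁻ x, ‖f x‖ₑ ∂(weightMeasure w)) ∧
    (∀ p : ℝ, 1 < p → ∀ w : ℝ → ℝ, IsAp p w →
      ∃ C : ℝ≥0, ∀ f : ℝ → ℂ, MemLp f (ENNReal.ofReal p) (weightMeasure w) →
        (∀ᵐ x ∂(weightMeasure w), TruncConverges K f x) ∧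
        ∫⁻ x, varOp q K f x ^ p ∂(weightMeasure w) ≤
          C * ∫⁻ x, ‖f x‖ₑ ^ p ∂(weightMeasure w)) := by
  obtain ⟨δ, A, hK⟩ := hK.exists_kernelBounds
  refine ⟨fun w hw => ?_, fun p hp w hw => ?_⟩
  · by_cases h0 : weightMeasure w = 0
    · exact ⟨0, fun f _ => by simp [h0]⟩
    obtain ⟨u, hμ, hu⟩ := hw.exists_a1Weight h0
    obtain ⟨C, hC⟩ := hK.exists_measure_varOp_le hq.le hp₀ hbdd hu
    rw [hμ]
    refine ⟨C, fun f hf => ?_⟩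
    obtain ⟨g, hg, hfg, hfg'⟩ := exists_measurable_ae_eq hu.measurable hu.ae_ne_zero hf.1
    have e : ∫⁻ x, ‖f x‖ₑ ∂(volume.withDensity u) = ∫⁻ x, ‖g x‖ₑ ∂(volume.withDensity u) :=
      lintegral_congr_ae (hfg'.mono fun x hx => by simp only [hx])
    have hfin := hf.2
    rw [eLpNorm_one_eq_lintegral_enorm, e] at hfin
    obtain ⟨hT, hV⟩ := hC g hg hfin.ne
    simp only [varOp_congr_ae hfg, e]
    exact ⟨Eventually.of_forall fun x => (hT x).congr_ae hfg.symm, hV⟩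
  · by_cases h0 : weightMeasure w = 0
    · exact ⟨0, fun f _ => by simp [h0]⟩
    obtain ⟨u, v, hμ, hu⟩ := hw.exists_apPair hp h0
    obtain ⟨C, hC⟩ := hK.exists_lintegral_varOp_le hq.le hp₀ hbdd hu
    rw [hμ]
    refine ⟨C, fun f hf => ?_⟩
    obtain ⟨g, hg, hfg, hfg'⟩ := exists_measurable_ae_eq hu.measurable_left
      (hu.ae_pos.mono fun x hx => hx.1) hf.1
    have e : ∫⁻ x, ‖f x‖ₑ ^ p ∂(volume.withDensity u) =
        ∫⁻ x, ‖g x‖ₑ ^ p ∂(volume.withDensity u) :=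
      lintegral_congr_ae (hfg'.mono fun x hx => by simp only [hx])
    have hfin := (eLpNorm_lt_top_iff_lintegral_rpow_enorm_lt_top
      (by simpa using by linarith) ENNReal.ofReal_ne_top).1 hf.2
    rw [ENNReal.toReal_ofReal (by linarith), e] at hfin
    obtain ⟨hT, hV⟩ := hC g hg hfin.ne
    simp only [varOp_congr_ae hfg, e]
    exact ⟨Eventually.of_forall fun x => (hT x).congr_ae hfg.symm, hV⟩
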